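/- Let $q\ge 2$ be an integer, $\lambda\in[-\frac1{q-1},1]$, $d\ge 0$, and let the offspring law be either the constant $d$ (regular tree, $d$ an integer) or $\mathrm{Pois}(d)$ (Poisson tree). Let $P_\lambda(j\mid i)=\lambda\mathbf 1\{i=j\}+\frac{1-\lambda}q$ be the Potts channel on $[q]$. Define $$C^L(q,\lambda):=\sup_{\pi\in\mathcal P([q]),\; v\in\mathbf 1^\perp\subseteq\mathbb R^q}\frac{f^L\left(\lambda\pi+\frac{1-\lambda}q,\,v\right)}{f^L(\pi,v)},\qquad f^L(\pi,v):=\sum_{i\in[q]}\Big(\pi_i^{-1}+\frac1q\pi_i^{-2}\Big)v_i^2$$ (for $v\neq 0$; values in $[0,\infty]$ with $0^{-1}=\infty$, $\infty\cdot 0=0$, and quotients $\infty/\infty$, which occur only for $\pi$ on the boundary of the simplex, discarded). A channel $P:[q]\to\mathcal Y$ is $q$-FMS if there is a homomorphism $\iota:\mathrm{Aut}([q])\to\mathrm{Aut}(\mathcal Y)$ with $P(E\mid x)=P(\iota(\tau)E\mid\tau(x))$ for all measurable $E\subseteq\mathcal Y$, $x\in[q]$, $\tau\in\mathrm{Aut}([q])$;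 it is non-trivial if its output law depends on the input. Channels $P_k$ converge weakly to $L$ if the distributions on $\mathcal P([q])$ of the posterior of a uniform input given the output converge weakly. The belief propagation operator is $\mathrm{BP}(M):=\mathbb E_b\,(M\circ P_\lambda)^{\star b}$, where $b$ has the offspring law and is part of the output, and $M^{\star b}$ sends the input independently through $b$ copies of $M$. Let $T$ be the Galton–Watson tree with the given offspring law and root $\rho$; $\sigma_\rho$ is uniform on $[q]$ and, given the color $\sigma_u$, the children of $u$ have i.i.d. colors with law $P_\lambda(\cdot\mid\sigma_u)$; for a survey channel $W$, each vertex $v$ has an independent observation $\omega_v\sim W(\cdot\mid\sigma_v)$. Let $T_k$ be the set of vertices at distance at most $k$ from $\rho$ and $L_k$ the set of those at distance exactly $k$. **Theorem (Low SNR).** One has $C^L(q,\lambda)\le q^2$. If $$d\lambda^2\,C^L(q,\lambda)<1,$$ then 1. (Boundary irrelevance) for every non-trivial $q$-FMS channel $W$, $\displaystyle\lim_{k\to\infty} I(\sigma_\rho;\sigma_{L_k}\mid T_k,\omega_{T_k})=0$; 2. (Stability of the BP fixed point) there is a $q$-FMS channel $L$ such that $\mathrm{BP}^k(\mathrm{Id})\to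 L$ weakly and, for every non-trivial $q$-FMS channel $P$, $\mathrm{BP}^k(P)\to L$ weakly as $k\to\infty$. -/

import Mathlib

open MeasureTheory ProbabilityTheory Filter Topology
open scoped ENNReal NNReal

universe u v

namespace Potts

noncomputable section

/-! ### Channels with input alphabet `[q]` -/

/-- A (memoryless) channel with input alphabet `[q] = Fin q` and an arbitrary measurable output
alphabet: a Markov kernel. -/
structure Channel (q : ℕ) where
  /-- The output alphabet. -/
  Out : Type u
  /-- The σ-algebra of the output alphabet. -/
  [mOut : MeasurableSpace Out]
  /-- The transition kernel. -/
  kernel : Kernel (Fin q) Out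
  /-- It is a Markov kernel. -/
  [markov : IsMarkovKernel kernel]

attribute [instance] Channel.mOut Channel.markov

/-- `P` is a `q`-FMS channel: there is a homomorphism `ι : Aut([q]) → Aut(Out)` with
`P(E | x) = P(ι(τ) E | τ(x))` for all measurable `E`, all inputs `x` and all permutations `τ`.
(As `ι` is a homomorphism, the inverse of each `ι τ` is measurable as well.) -/
def Channel.IsFMS {q : ℕ} (P : Channel.{u} q) : Prop :=
  ∃ ι : Equiv.Perm (Fin q) →* Equiv.Perm P.Out,
    (∀ τ, Measurable (ι τ)) ∧
    ∀ (τ : Equiv.Perm (Fin q)) (x : Fin q) (E : Set P.Out), MeasurableSet E →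
      P.kernel x E = P.kernel (τ x) (ι τ '' E)

/-- A channel is non-trivial if its output law depends on the input. -/
def Channel.IsNontrivial {q : ℕ} (P : Channel.{u} q) : Prop :=
  ∃ x x' : Fin q, P.kernel x ≠ P.kernel x'

/-- The identity channel `Id`. -/
def Channel.ident (q : ℕ) : Channel.{0} q where
  Out := Fin q
  kernel := Kernel.id

/-- The uniform law on `[q]`. -/
def unif (q : ℕ) [NeZero q] : Measure (Fin q) := (PMF.uniformOfFintype (Fin q)).toMeasure

instance (q : ℕ) [NeZero q] : IsProbabilityMeasure (unif q) := by
  unfold unif; infer_instance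

/-- The posterior law of the input (uniform prior) given the output `y`, as a point of the
probability simplex `𝒫([q])`. -/
def Channel.posteriorAt {q : ℕ} [NeZero q] (P : Channel.{u} q) (y : P.Out) :
    stdSimplex ℝ (Fin q) :=
  ⟨fun i => ((posterior P.kernel (unif q)) y).real {i}, fun _ => measureReal_nonneg, by
    rw [sum_measureReal_singleton]; simp⟩

lemma Channel.measurable_posteriorAt {q : ℕ} [NeZero q] (P : Channel.{u} q) :
    Measurable P.posteriorAt := by
  refine Measurable.subtype_mk (measurable_pi_lambda _ fun i => ?_)
  exact ((Kernel.measurable_coe _ (measurableSet_singleton i))).ennreal_toReal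

/-- The distribution on `𝒫([q])` of the posterior law of the input, when the input is uniform. -/
def Channel.posteriorDist {q : ℕ} [NeZero q] (P : Channel.{u} q) :
    ProbabilityMeasure (stdSimplex ℝ (Fin q)) :=
  ⟨(P.kernel ∘ₘ unif q).map P.posteriorAt,
    Measure.isProbabilityMeasure_map P.measurable_posteriorAt.aemeasurable⟩

/-- Weak convergence of channels: weak convergence of the distributions of the posteriors. -/
def ConvergesWeakly {q : ℕ} [NeZero q] (P : ℕ → Channel.{u} q) (L : Channel.{v} q) : Prop :=
  Tendsto (fun k => (P k).posteriorDist) atTop (𝓝 L.posteriorDist)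

/-! ### Potts channels and the belief propagation operator -/

/-- The admissible parameters `λ ∈ [-1/(q-1), 1]`. -/
abbrev Param (q : ℕ) : Type := Set.Icc (-(1 / ((q : ℝ) - 1))) (1 : ℝ)

/-- The Potts channel `P_λ(j | i) = λ 1{i = j} + (1 - λ)/q`. -/
def pottsKernel (q : ℕ) (lam : Param q) : Kernel (Fin q) (Fin q) :=
  Kernel.ofFunOfCountable fun i =>
    ∑ j, ENNReal.ofReal ((lam : ℝ) * (if i = j then 1 else 0) + (1 - (lam : ℝ)) / q) •
      Measure.dirac j

lemma pottsEntry_nonneg (q : ℕ) [NeZero q] (lam : Param q) (i j : Fin q) :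
    0 ≤ (lam : ℝ) * (if i = j then 1 else 0) + (1 - (lam : ℝ)) / q := by
  obtain ⟨l, hl1, hl2⟩ := lam
  have hq : (1 : ℝ) ≤ q := by exact_mod_cast NeZero.one_le
  have h0 : 0 ≤ (1 - l) / q := div_nonneg (by linarith) (by linarith)
  simp only
  split_ifs
  · rcases eq_or_lt_of_le hq with h | h
    · rw [← h]; simp
    · have : l * 1 + (1 - l) / q = (1 + l * (q - 1)) / q := by field_simp; ring
      rw [this]
      apply div_nonneg _ (by linarith)
      have h1 : (0 : ℝ) < q - 1 := by linarith
      have h2 := mul_le_mul_of_nonneg_right hl1 h1.le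
      rw [neg_mul, one_div_mul_cancel h1.ne'] at h2
      linarith
  · simpa using h0

instance (q : ℕ) [NeZero q] (lam : Param q) : IsMarkovKernel (pottsKernel q lam) := by
  refine ⟨fun i => ⟨?_⟩⟩
  have hq : (q : ℝ) ≠ 0 := by exact_mod_cast NeZero.ne q
  change (∑ j, ENNReal.ofReal ((lam : ℝ) * (if i = j then 1 else 0) + (1 - (lam : ℝ)) / q) •
      Measure.dirac j : Measure (Fin q)) Set.univ = 1
  simp only [Measure.coe_finsetSum, Finset.sum_apply, Measure.smul_apply, measure_univ,
    smul_eq_mul, mul_one]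
  rw [← ENNReal.ofReal_sum_of_nonneg fun j _ => pottsEntry_nonneg q lam i j,
    Finset.sum_add_distrib, ← Finset.mul_sum]
  simp
  field_simp
  simp

/-- `E_b κ^{⋆b}`: draw a number `b` with law `ν`, reveal it, and send the input independently
through `b` copies of `κ`. -/
def branch {q : ℕ} (ν : Measure ℕ) {Z : Type u} [MeasurableSpace Z] (κ : Kernel (Fin q) Z) :
    Kernel (Fin q) (Σ b : ℕ, Fin b → Z) :=
  Kernel.ofFunOfCountable fun i =>
    ν.bind fun b => (Measure.pi fun _ : Fin b => κ i).map
      (fun z => (⟨b, z⟩ : Σ b : ℕ, Fin b → Z))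

lemma measurable_sigmaMk {ι : Type*} {X : ι → Type*} [∀ i, MeasurableSpace (X i)] (i : ι) :
    Measurable (Sigma.mk i : X i → Sigma X) :=
  measurable_iff_le_map.2 (iInf_le _ i)

instance {q : ℕ} (ν : Measure ℕ) [IsProbabilityMeasure ν] {Z : Type u} [MeasurableSpace Z]
    (κ : Kernel (Fin q) Z) [IsMarkovKernel κ] : IsMarkovKernel (branch ν κ) := by
  refine ⟨fun i => ⟨?_⟩⟩
  change (ν.bind fun b => (Measure.pi fun _ : Fin b => κ i).map
    (fun z => (⟨b, z⟩ : Σ b : ℕ, Fin b → Z))) Set.univ = 1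
  rw [Measure.bind_apply MeasurableSet.univ (measurable_of_countable _).aemeasurable]
  have h (b : ℕ) : (Measure.pi fun _ : Fin b => κ i).map
      (fun z => (⟨b, z⟩ : Σ b : ℕ, Fin b → Z)) Set.univ = 1 := by
    rw [Measure.map_apply (measurable_sigmaMk (X := fun b : ℕ => Fin b → Z) b)
      MeasurableSet.univ]; simp
  simp [h]

/-- The belief propagation operator `BP(M) = E_b (M ∘ P_λ)^{⋆b}`, with `b ∼ ν`. -/
def BP {q : ℕ} [NeZero q] (lam : Param q) (ν : Measure ℕ) [IsProbabilityMeasure ν]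
    (M : Channel.{u} q) : Channel.{u} q where
  Out := Σ b : ℕ, Fin b → M.Out
  kernel := branch ν (M.kernel ∘ₖ pottsKernel q lam)

/-- Stability of the BP fixed point: there is a channel `L` such that `BP^k(Id)` and `BP^k(P)`,
for every non-trivial `q`-FMS channel `P`, converge weakly to `L`. -/
def StableBPFixedPoint {q : ℕ} [NeZero q] (lam : Param q) (ν : Measure ℕ)
    [IsProbabilityMeasure ν] : Prop :=
  ∃ L : Channel.{0} q, L.IsFMS ∧
    ConvergesWeakly (fun k => (BP lam ν)^[k] (Channel.ident q)) L ∧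
    ∀ P : Channel.{u} q, P.IsFMS → P.IsNontrivial →
      ConvergesWeakly (fun k => (BP lam ν)^[k] P) L

/-! ### Broadcasting on trees with survey -/

/-- Rooted plane trees of depth at most `k` with every vertex labelled by `α`. A tree of height
bound `k + 1` is a root label, a number `b` of children, and the `b` subtrees. -/
def LTree (α : Type u) : ℕ → Type u
  | 0 => α
  | k + 1 => α × (Σ b : ℕ, Fin b → LTree α k)

instance LTree.instMeasurableSpace (α : Type u) [MeasurableSpace α] :
    ∀ k, MeasurableSpace (LTree α k)
  | 0 => inferInstanceAs (MeasurableSpace α)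
  | k + 1 =>
    letI := LTree.instMeasurableSpace α k
    inferInstanceAs (MeasurableSpace (α × (Σ b : ℕ, Fin b → LTree α k)))

/-- Rooted plane trees of depth at most `k` with only the vertices at depth exactly `k` labelled
by `α`. -/
def LeafTree (α : Type u) : ℕ → Type u
  | 0 => α
  | k + 1 => Σ b : ℕ, Fin b → LeafTree α k

instance LeafTree.instMeasurableSpace (α : Type u) [MeasurableSpace α] :
    ∀ k, MeasurableSpace (LeafTree α k)
  | 0 => inferInstanceAs (MeasurableSpace α)
  | k + 1 =>
    letI := LeafTree.instMeasurableSpace α k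
    inferInstanceAs (MeasurableSpace (Σ b : ℕ, Fin b → LeafTree α k))

/-- The label of the root. -/
def LTree.root {α : Type u} : ∀ k, LTree α k → α
  | 0 => fun a => a
  | _ + 1 => fun t => t.1

/-- Relabelling of all vertices. -/
def LTree.map {α : Type u} {β : Type v} (f : α → β) : ∀ k, LTree α k → LTree β k
  | 0 => fun a => f a
  | k + 1 => fun t => (f t.1, ⟨t.2.1, fun j => LTree.map f k (t.2.2 j)⟩)

/-- Forget all labels but those of the vertices at depth `k`. -/
def LTree.leaves {α : Type u} : ∀ k, LTree α k → LeafTree α k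
  | 0 => fun a => a
  | k + 1 => fun t => ⟨t.2.1, fun j => LTree.leaves k (t.2.2 j)⟩

lemma measurable_sigmaMap {Z : Type u} {Z' : Type v} [MeasurableSpace Z] [MeasurableSpace Z']
    {g : Z → Z'} (hg : Measurable g) :
    Measurable fun s : (Σ b : ℕ, Fin b → Z) =>
      (⟨s.1, fun j => g (s.2 j)⟩ : Σ b : ℕ, Fin b → Z') := by
  rw [measurable_iff_le_map, ← MeasurableSpace.comap_le_iff_le_map]
  refine le_iInf fun b => ?_
  rw [MeasurableSpace.comap_le_iff_le_map, MeasurableSpace.map_comp]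
  refine measurable_iff_le_map.1 ?_
  exact (measurable_sigmaMk (X := fun b : ℕ => Fin b → Z') b).comp
    (measurable_pi_lambda _ fun j => hg.comp (measurable_pi_apply j))

lemma LTree.measurable_root {α : Type u} [MeasurableSpace α] :
    ∀ k, Measurable (LTree.root (α := α) k)
  | 0 => measurable_id
  | _ + 1 => measurable_fst

lemma LTree.measurable_map {α : Type u} {β : Type v} [MeasurableSpace α] [MeasurableSpace β]
    {f : α → β} (hf : Measurable f) : ∀ k, Measurable (LTree.map f k)
  | 0 => hf
  | k + 1 => (hf.comp measurable_fst).prodMk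
      ((measurable_sigmaMap (LTree.measurable_map hf k)).comp measurable_snd)

lemma LTree.measurable_leaves {α : Type u} [MeasurableSpace α] :
    ∀ k, Measurable (LTree.leaves (α := α) k)
  | 0 => measurable_id
  | k + 1 => (measurable_sigmaMap (LTree.measurable_leaves k)).comp measurable_snd

/-- Broadcasting on the Galton-Watson tree with offspring law `ν`, truncated at depth `k`: the law
of the tree with labels `(σ_v, ω_v)`, given the color of its root. Each vertex with color `i`
emits `ω ∼ W(· | i)` and, below depth `k`, has `b ∼ ν` children, whose colors are i.i.d. with law
`P_λ(· | i)`. -/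
def broadcast {q : ℕ} (lam : Param q) (ν : Measure ℕ) (W : Channel.{u} q) :
    ∀ k, Kernel (Fin q) (LTree (Fin q × W.Out) k)
  | 0 => Kernel.id ×ₖ W.kernel
  | k + 1 => (Kernel.id ×ₖ W.kernel) ×ₖ branch ν (broadcast lam ν W k ∘ₖ pottsKernel q lam)

instance broadcast.instIsMarkovKernel {q : ℕ} [NeZero q] (lam : Param q) (ν : Measure ℕ)
    [IsProbabilityMeasure ν] (W : Channel.{u} q) : ∀ k, IsMarkovKernel (broadcast lam ν W k)
  | 0 => inferInstanceAs (IsMarkovKernel (Kernel.id ×ₖ W.kernel))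
  | k + 1 =>
    letI := broadcast.instIsMarkovKernel lam ν W k
    inferInstanceAs (IsMarkovKernel
      ((Kernel.id ×ₖ W.kernel) ×ₖ branch ν (broadcast lam ν W k ∘ₖ pottsKernel q lam)))

/-- The joint law of `(T_k, (σ_v)_{v ∈ T_k}, (ω_v)_{v ∈ T_k})` with a uniform root color. -/
def botsLaw {q : ℕ} [NeZero q] (lam : Param q) (ν : Measure ℕ) (W : Channel.{u} q) (k : ℕ) :
    Measure (LTree (Fin q × W.Out) k) :=
  broadcast lam ν W k ∘ₘ unif q

instance {q : ℕ} [NeZero q] (lam : Param q) (ν : Measure ℕ) [IsProbabilityMeasure ν]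
    (W : Channel.{u} q) (k : ℕ) : IsProbabilityMeasure (botsLaw lam ν W k) := by
  unfold botsLaw; infer_instance

/-- The conditional mutual information `I(X; Y | Z) = D(P_{YZX} ‖ P_{YZ} P_{X|Z})`, for `X` with
values in a standard Borel space. -/
def condMutualInfo {Ω A B C : Type*} [MeasurableSpace Ω] [MeasurableSpace A]
    [StandardBorelSpace A] [Nonempty A] [MeasurableSpace B] [MeasurableSpace C]
    (μ : Measure Ω) [IsFiniteMeasure μ] (X : Ω → A) (Y : Ω → B) (Z : Ω → C) : ℝ≥0∞ :=
  InformationTheory.klDiv (μ.map fun t => ((Y t, Z t), X t))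
    ((μ.map fun t => (Y t, Z t)) ⊗ₘ Kernel.prodMkLeft B (condDistrib X Z μ))

/-- `I(σ_ρ; σ_{L_k} | T_k, ω_{T_k})`. The unlabelled tree `T_k` is part of the conditioning
variable `LTree.map Prod.snd`, whose value is the tree with its labels `ω`. -/
def boundaryInfo {q : ℕ} [NeZero q] (lam : Param q) (ν : Measure ℕ) [IsProbabilityMeasure ν]
    (W : Channel.{u} q) (k : ℕ) : ℝ≥0∞ :=
  condMutualInfo (botsLaw lam ν W k)
    (fun t => (LTree.root k t).1)
    (fun t => LTree.leaves k (LTree.map Prod.fst k t))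
    (fun t => LTree.map Prod.snd k t)

/-- Boundary irrelevance: `I(σ_ρ; σ_{L_k} | T_k, ω_{T_k}) → 0` for every non-trivial `q`-FMS
survey channel. -/
def BoundaryIrrelevance {q : ℕ} [NeZero q] (lam : Param q) (ν : Measure ℕ)
    [IsProbabilityMeasure ν] : Prop :=
  ∀ W : Channel.{u} q, W.IsFMS → W.IsNontrivial →
    Tendsto (boundaryInfo lam ν W) atTop (𝓝 0)

/-! ### The constant of the low SNR condition -/

/-- `f^L(π, v) = ⟨π⁻¹ + π⁻² / q, v²⟩` for an entrywise nonnegative `π`, with values in `[0, ∞]`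
(so `0⁻¹ = ∞` and `∞ * 0 = 0`). -/
def fL (q : ℕ) (p v : Fin q → ℝ) : ℝ≥0∞ :=
  ∑ i, ((ENNReal.ofReal (p i))⁻¹ + (q : ℝ≥0∞)⁻¹ * ((ENNReal.ofReal (p i))⁻¹) ^ 2) *
    ENNReal.ofReal (v i ^ 2)

/-- `C^L(q, λ)`: the supremum of `f^L(λπ + (1-λ)/q, v) / f^L(π, v)` over `π ∈ 𝒫([q])` and `v`
orthogonal to the all-ones vector (in `[0, ∞]`, `0 / 0` and `∞ / ∞` count as `0`; they occur only
for `v = 0` and for `π` on the boundary of the simplex). -/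
def CL (q : ℕ) (lam : ℝ) : ℝ≥0∞ :=
  ⨆ (p : stdSimplex ℝ (Fin q)) (v : {v : Fin q → ℝ // ∑ i, v i = 0}),
    fL q (fun i => lam * p.1 i + (1 - lam) / q) v.1 / fL q p.1 v.1

/-- The offspring law `ν` of a regular tree with offspring `d`, or of a Poisson tree with expected
offspring `d`. -/
def IsOffspringLaw (d : ℝ≥0) (ν : Measure ℕ) : Prop :=
  (∃ n : ℕ, d = n ∧ ν = Measure.dirac n) ∨ ν = poissonMeasure d

end

end Potts

/-!
The idea is to follow the posterior law of the root color up the tree and to compare two versions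
of it, `m` (given more information) and `n` (given less). Each is tracked through its belief
propagation recursion: a level of the tree applies the Potts channel, whose effect on a posterior
is the affine map `p ↦ λ p + (1 - λ) / q` (`pottsMap`), and then multiplies independent copies and
normalises (`treePosterior`).

The distance is the expected Bregman divergence of the potential `∑ᵢ (pᵢ - 1 / q) log pᵢ`
(`bregman`). The Hessian of the potential at `p` is the quadratic form `f^L(p, ·)`. So, integrating
along the segment from `n` to `m`, the definition of `C^L` says exactly that the Potts channel
multiplies the divergence by at most `λ ^ 2 * C^L` (`bregman_pottsMap_le`). On the other hand the
expected divergence is a linear functional of the log likelihood ratios between `m` and `n`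
(`ratioMean`), and these add up over independent observations of the color. So branching multiplies
the divergence by at most the mean offspring `d`, and the survey at the vertex does not increase it
(`lintegral_bregman_branch_le`). This step requires `m` to be a posterior, and of `n` only that it
is calibrated, that is, the posterior given its own value. Hence each level contracts by
`d * λ ^ 2 * C^L < 1`, and the divergence bounds the relative entropy of `m` with respect to `n`.

For extreme `λ` the potential may be infinite on the image of the Potts channel. There, however,
`1 ≤ λ ^ 2 * C^L` (`one_le_sq_mul_CL_of_extreme`), so the hypothesis forces `d < 1`: the tree dies out
and `m` differs from `n` with probability at most `d ^ k`. Both regimes are carried together by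
`IsSmall`, propagated by `IsSmall.step`, and turned into a bound on the relative entropy by
`eventually_lintegral_kl_le`.

For boundary irrelevance, `m` is the posterior given the boundary colors and the survey, `n` the
posterior given the survey only; the conditional mutual information is at most the expected
relative entropy (`condMutualInfo_le`). For the belief propagation operator, `m` is the posterior
of `BP^k(P)` and `n` is the uniform law, the posterior given nothing. So `BP^k(P)` converges to the
channel with a single output, for every channel `P`. The bound `C^L ≤ q ^ 2` is elementary
(`sum_hess_pottsMap_le`): the two Hessians differ by a factor of at most `q ^ 2` in each
coordinate, except possibly in one coordinate when `λ < 0`, where `∑ᵢ vᵢ = 0` and the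
Cauchy–Schwarz inequality help.
-/

namespace Potts

open InformationTheory

/-! ### The constant of the low SNR condition -/

/-- The map `p ↦ λ p + (1 - λ) / q` on laws: the effect of the Potts channel on a posterior. -/
noncomputable def pottsMap {q : ℕ} (lam : ℝ) (p : Fin q → ℝ) : Fin q → ℝ :=
  fun i => lam * p i + (1 - lam) / q

/-- The second derivative `x⁻¹ + x⁻² / q` of `x ↦ x log x - (log x) / q`. -/
noncomputable def hess (q : ℕ) (x : ℝ) : ℝ := x⁻¹ + (q : ℝ)⁻¹ * x⁻¹ ^ 2

lemma hess_nonneg (q : ℕ) {x : ℝ} (hx : 0 ≤ x) : 0 ≤ hess q x := by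
  unfold hess; positivity

lemma hess_anti (q : ℕ) {x y : ℝ} (hx : 0 < x) (hxy : x ≤ y) : hess q y ≤ hess q x := by
  unfold hess
  have : y⁻¹ ≤ x⁻¹ := inv_anti₀ hx hxy
  have h0 : 0 ≤ y⁻¹ := inv_nonneg.2 (hx.le.trans hxy)
  gcongr

lemma le_one_of_mem_stdSimplex {q : ℕ} {p : Fin q → ℝ} (hp : p ∈ stdSimplex ℝ (Fin q))
    (i : Fin q) : p i ≤ 1 := by
  rw [← hp.2]
  exact Finset.single_le_sum (fun j _ => hp.1 j) (Finset.mem_univ i)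

lemma pottsMap_mem_stdSimplex {q : ℕ} [NeZero q] (lam : Param q) {p : Fin q → ℝ}
    (hp : p ∈ stdSimplex ℝ (Fin q)) : pottsMap lam p ∈ stdSimplex ℝ (Fin q) := by
  have hq : (q : ℝ) ≠ 0 := by exact_mod_cast NeZero.ne q
  refine ⟨fun i => ?_, ?_⟩
  · have h1 := pottsEntry_nonneg q lam i i
    have h2 : 0 ≤ (1 - (lam : ℝ)) / q :=
      div_nonneg (by linarith [lam.2.2]) (Nat.cast_nonneg q)
    have h3 := hp.1 i
    have h4 := le_one_of_mem_stdSimplex hp i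
    simp only [if_true, mul_one] at h1
    unfold pottsMap
    nlinarith [mul_nonneg h3 h1, mul_nonneg (sub_nonneg.2 h4) h2]
  · unfold pottsMap
    rw [Finset.sum_add_distrib, ← Finset.mul_sum, hp.2]
    simp
    field_simp
    ring

lemma fL_eq_ofReal {q : ℕ} [NeZero q] {a v : Fin q → ℝ} (h : ∀ i, v i ≠ 0 → 0 < a i) :
    fL q a v = ENNReal.ofReal (∑ i, hess q (a i) * v i ^ 2) := by
  have key (i : Fin q) :
      ((ENNReal.ofReal (a i))⁻¹ + (q : ℝ≥0∞)⁻¹ * ((ENNReal.ofReal (a i))⁻¹) ^ 2) *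
      ENNReal.ofReal (v i ^ 2) = ENNReal.ofReal (hess q (a i) * v i ^ 2) ∧
        0 ≤ hess q (a i) * v i ^ 2 := by
    by_cases hv : v i = 0
    · simp [hv]
    · have ha := h i hv
      have hq : (0 : ℝ) < q := by exact_mod_cast NeZero.pos q
      have h1 : 0 ≤ hess q (a i) := hess_nonneg q ha.le
      refine ⟨?_, by positivity⟩
      rw [ENNReal.ofReal_mul h1]
      congr 1
      unfold hess
      rw [ENNReal.ofReal_add (by positivity) (by positivity), ENNReal.ofReal_mul (by positivity),
        ENNReal.ofReal_pow (by positivity), ENNReal.ofReal_inv_of_pos ha,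
        ENNReal.ofReal_inv_of_pos hq, ENNReal.ofReal_natCast]
  unfold fL
  rw [ENNReal.ofReal_sum_of_nonneg fun i _ => (key i).2]
  exact Finset.sum_congr rfl fun i _ => (key i).1

lemma fL_eq_top {q : ℕ} [NeZero q] {a v : Fin q → ℝ} {i : Fin q} (hv : v i ≠ 0) (ha : a i ≤ 0) :
    fL q a v = ⊤ := by
  unfold fL
  rw [ENNReal.sum_eq_top]
  refine ⟨i, Finset.mem_univ i, ?_⟩
  have hv' : ENNReal.ofReal (v i ^ 2) ≠ 0 := by
    simpa using hv
  rw [ENNReal.ofReal_of_nonpos ha, ENNReal.inv_zero, top_add, ENNReal.top_mul hv']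

/-- Off a coordinate `i`, the Cauchy–Schwarz inequality bounds `v i ^ 2` for `v ⊥ 1` by the
contributions of the other coordinates. -/
lemma sq_le_of_sum_eq_zero {q : ℕ} {v w : Fin q → ℝ} (hv : ∑ i, v i = 0) (hw : ∀ i, 0 ≤ w i)
    (hsupp : ∀ i, w i = 0 → v i = 0) (i : Fin q) :
    v i ^ 2 ≤ (∑ j ∈ Finset.univ.erase i, w j) *
      ∑ j ∈ Finset.univ.erase i, (w j)⁻¹ * v j ^ 2 := by
  have h1 : v i = - ∑ j ∈ Finset.univ.erase i, v j := by
    rw [← Finset.add_sum_erase _ _ (Finset.mem_univ i)] at hv; linarith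
  rw [h1, neg_sq]
  refine Finset.sum_sq_le_sum_mul_sum_of_sq_le_mul _ (fun j _ => hw j)
    (fun j _ => mul_nonneg (inv_nonneg.2 (hw j)) (sq_nonneg _)) fun j _ => le_of_eq ?_
  by_cases h : w j = 0
  · simp [hsupp j h, h]
  · field_simp

/-- If `p ≤ q a` then the weight at `a` is at most `q ^ 2` times the weight at `p`. -/
lemma hess_le_of_le_mul {q : ℕ} (hq : 2 ≤ q) {p a : ℝ} (hp : 0 < p) (h : p ≤ q * a) :
    hess q a ≤ (q : ℝ) ^ 2 * hess q p := by
  have hq' : (2 : ℝ) ≤ q := by exact_mod_cast hq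
  have ha : p / q ≤ a := by rw [div_le_iff₀ (by linarith)]; linarith
  have hpq : 0 < p / q := by positivity
  refine (hess_anti q hpq ha).trans ?_
  unfold hess
  have h1 : (p / q)⁻¹ = q * p⁻¹ := by field_simp
  rw [h1]
  have hp' : 0 < p⁻¹ := inv_pos.2 hp
  have h2 : (q : ℝ) * p⁻¹ ≤ q ^ 2 * p⁻¹ := by gcongr; nlinarith
  have h3 : (q : ℝ)⁻¹ * (q * p⁻¹) ^ 2 = q ^ 2 * ((q : ℝ)⁻¹ * p⁻¹ ^ 2) := by ring
  rw [h3, mul_add]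
  linarith

/-- The pointwise form of `C^L ≤ q ^ 2`. For negative `λ` at most one coordinate `i`, with `p i`
close to `1`, violates `p i ≤ q a i`; its contribution is absorbed in those of the other
coordinates, which vary by `v i` in total. -/
lemma sum_hess_pottsMap_le {q : ℕ} [NeZero q] (hq : 2 ≤ q) (lam : Param q) {p v : Fin q → ℝ}
    (hp : p ∈ stdSimplex ℝ (Fin q)) (hv : ∑ i, v i = 0) (hsupp : ∀ i, p i = 0 → v i = 0) :
    ∑ i, hess q (pottsMap lam p i) * v i ^ 2 ≤ (q : ℝ) ^ 2 * ∑ i, hess q (p i) * v i ^ 2 := by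
  have hq' : (2 : ℝ) ≤ q := by exact_mod_cast hq
  have hq1 : (0 : ℝ) < q - 1 := by linarith
  have hq0 : (0 : ℝ) < q := by linarith
  obtain ⟨l, hl1, hl2⟩ := lam
  have hl1' : -1 ≤ l * (q - 1) := by
    have := mul_le_mul_of_nonneg_right hl1 hq1.le
    rwa [neg_mul, one_div_mul_cancel hq1.ne'] at this
  have aeq (i) : (q : ℝ) * pottsMap l p i = q * l * p i + (1 - l) := by
    unfold pottsMap; field_simp
  have term (i) (h : p i ≤ q * pottsMap l p i) :
      hess q (pottsMap l p i) * v i ^ 2 ≤ (q : ℝ) ^ 2 * (hess q (p i) * v i ^ 2) := by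
    by_cases hi : p i = 0
    · simp [hsupp i hi]
    · have := hess_le_of_le_mul hq (lt_of_le_of_ne (hp.1 i) (Ne.symm hi)) h
      rw [← mul_assoc]
      gcongr
  simp only
  by_cases hall : ∀ i, p i ≤ q * pottsMap l p i
  · rw [Finset.mul_sum]
    exact Finset.sum_le_sum fun i _ => term i (hall i)
  push Not at hall
  obtain ⟨i, hi⟩ := hall
  have hpi0 := hp.1 i
  have hpi1 := le_one_of_mem_stdSimplex hp i
  rw [aeq] at hi
  have hl : l < 0 := by
    by_contra hl
    push Not at hl
    rcases le_total 1 ((q : ℝ) * p i) with h | h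
    · nlinarith
    · nlinarith
  have hpq : 1 < q * p i := by
    by_contra h
    push Not at h
    nlinarith
  -- the coordinate `i` carries more than half of the mass
  have hbig : (q : ℝ) * (1 - p i) < (q - 1) * p i := by
    nlinarith [mul_nonneg (sub_nonneg.2 hpq.le) (by linarith : 0 ≤ l * (q - 1) + 1)]
  set e := 1 - p i with he
  have he0 : 0 ≤ e := by linarith
  have hsum : ∑ j ∈ Finset.univ.erase i, p j = e := by
    have := hp.2
    rw [← Finset.add_sum_erase _ _ (Finset.mem_univ i)] at this; linarith
  have hje (j) (hj : j ∈ Finset.univ.erase i) : p j ≤ e := by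
    rw [← hsum]; exact Finset.single_le_sum (fun k _ => hp.1 k) hj
  have hehalf : e < 1 / 2 := by nlinarith
  -- at a vertex of the simplex, `v` vanishes
  rcases he0.eq_or_lt with he00 | hepos
  · have hv0 (j) (hj : j ∈ Finset.univ.erase i) : v j = 0 :=
      hsupp j (le_antisymm (he00 ▸ hje j hj) (hp.1 j))
    have hvi : v i = 0 := by
      rw [← Finset.add_sum_erase _ _ (Finset.mem_univ i), Finset.sum_eq_zero hv0] at hv
      linarith
    have hv' (j) : v j = 0 := by
      by_cases hj : j = i
      · rw [hj, hvi]
      · exact hv0 j (by simp [hj])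
    simp [hv']
  have hai : e / (q - 1) ≤ pottsMap l p i := by
    rw [div_le_iff₀ hq1]
    have h1 : (0:ℝ) ≤ (q * p i - 1) * (l * (q - 1) + 1) :=
      mul_nonneg (by linarith) (by linarith)
    have h2 : q * (pottsMap l p i * (q - 1)) = (q * l * p i + (1 - l)) * (q - 1) := by
      rw [← aeq]; ring
    have h3 : (q : ℝ) * e ≤ q * (pottsMap l p i * (q - 1)) := by
      rw [h2, he]; nlinarith
    exact le_of_mul_le_mul_left h3 hq0
  -- the Cauchy–Schwarz inequality with weights `p j` and `p j ^ 2` for the two terms of `hess`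
  have hi_term : hess q (pottsMap l p i) * v i ^ 2 ≤ ∑ j ∈ Finset.univ.erase i,
      ((q - 1) * (p j)⁻¹ + (q - 1) ^ 2 * ((q : ℝ)⁻¹ * (p j)⁻¹ ^ 2)) * v j ^ 2 := by
    have h1 := sq_le_of_sum_eq_zero hv hp.1 hsupp i
    have h2 := sq_le_of_sum_eq_zero (w := fun j => p j ^ 2) hv (fun j => sq_nonneg _)
      (fun j hj => hsupp j (by simpa using hj)) i
    rw [hsum] at h1
    have h3 : ∑ j ∈ Finset.univ.erase i, p j ^ 2 ≤ e ^ 2 := by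
      rw [sq e]
      nth_rw 2 [← hsum]
      rw [Finset.mul_sum]
      exact Finset.sum_le_sum fun j hj => by
        rw [sq]; exact mul_le_mul_of_nonneg_right (hje j hj) (hp.1 j)
    have h4 : v i ^ 2 ≤ e ^ 2 * ∑ j ∈ Finset.univ.erase i, (p j ^ 2)⁻¹ * v j ^ 2 :=
      h2.trans (mul_le_mul_of_nonneg_right h3 (Finset.sum_nonneg fun j _ => by positivity))
    calc hess q (pottsMap l p i) * v i ^ 2 ≤ hess q (e / (q - 1)) * v i ^ 2 := by
          gcongr; exact hess_anti q (by positivity) hai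
      _ = (q - 1) * e⁻¹ * v i ^ 2 + (q - 1) ^ 2 * (q : ℝ)⁻¹ * (e ^ 2)⁻¹ * v i ^ 2 := by
          unfold hess; field_simp
      _ ≤ (q - 1) * e⁻¹ * (e * ∑ j ∈ Finset.univ.erase i, (p j)⁻¹ * v j ^ 2)
          + (q - 1) ^ 2 * (q : ℝ)⁻¹ * (e ^ 2)⁻¹ *
            (e ^ 2 * ∑ j ∈ Finset.univ.erase i, (p j ^ 2)⁻¹ * v j ^ 2) := by gcongr
      _ = (q - 1) * (∑ j ∈ Finset.univ.erase i, (p j)⁻¹ * v j ^ 2)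
          + (q - 1) ^ 2 * (q : ℝ)⁻¹ *
            (∑ j ∈ Finset.univ.erase i, (p j ^ 2)⁻¹ * v j ^ 2) := by
          field_simp
      _ = _ := by
          rw [Finset.mul_sum, Finset.mul_sum, ← Finset.sum_add_distrib]
          exact Finset.sum_congr rfl fun j _ => by rw [inv_pow]; ring
  -- as `p j < 1 / 2`, the other coordinates have room for this contribution
  have hj_term (j) (hj : j ∈ Finset.univ.erase i) : hess q (pottsMap l p j) * v j ^ 2 +
      ((q - 1) * (p j)⁻¹ + (q - 1) ^ 2 * ((q : ℝ)⁻¹ * (p j)⁻¹ ^ 2)) * v j ^ 2 ≤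
      (q : ℝ) ^ 2 * (hess q (p j) * v j ^ 2) := by
    by_cases hj0 : p j = 0
    · simp [hsupp j hj0]
    have hpj : 0 < p j := lt_of_le_of_ne (hp.1 j) (Ne.symm hj0)
    have hpj2 : p j < 1 / 2 := (hje j hj).trans_lt hehalf
    have haj : 1 / (2 * (q - 1)) ≤ pottsMap l p j := by
      rw [div_le_iff₀ (by positivity)]
      have h1 : 0 ≤ (1 + l * (q - 1)) := by linarith
      have h3 : (q : ℝ) * 1 ≤ q * (pottsMap l p j * (2 * (q - 1))) := by
        have h2 : q * (pottsMap l p j * (2 * (q - 1)))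
            = (q * l * p j + (1 - l)) * (2 * (q - 1)) := by
          rw [← aeq]; ring
        rw [h2]
        rcases le_total 1 ((q : ℝ) * p j) with h | h
        · nlinarith [mul_nonneg (sub_nonneg.2 h) h1]
        · have : 0 ≤ -l * (1 - q * p j) := mul_nonneg (by linarith) (by linarith)
          nlinarith [mul_nonneg this hq1.le]
      exact le_of_mul_le_mul_left h3 hq0
    have hg : hess q (pottsMap l p j) ≤ 2 * (q - 1) + (q : ℝ)⁻¹ * (2 * (q - 1)) ^ 2 := by
      refine (hess_anti q (by positivity) haj).trans (le_of_eq ?_)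
      unfold hess; simp
    have hx : 2 ≤ (p j)⁻¹ := by
      rw [le_inv_comm₀ (by norm_num) hpj]; linarith
    have hmain : hess q (pottsMap l p j) +
        ((q - 1) * (p j)⁻¹ + (q - 1) ^ 2 * ((q : ℝ)⁻¹ * (p j)⁻¹ ^ 2)) ≤
        (q : ℝ) ^ 2 * hess q (p j) := by
      refine (add_le_add_left hg _).trans ?_
      unfold hess
      set x := (p j)⁻¹
      have h4 : (4 : ℝ) ≤ x ^ 2 := by nlinarith
      have h5 : 0 ≤ (x - 2) * ((q : ℝ) ^ 2 - q + 1) :=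
        mul_nonneg (by linarith) (by nlinarith)
      have h6 : 0 ≤ (x ^ 2 - 4) * (2 * (q : ℝ) - 1) :=
        mul_nonneg (by linarith) (by linarith)
      have h7 : 0 ≤ 2 * (q : ℝ) * (q - 2) ^ 2 + 12 * q - 8 := by
        have : 0 ≤ 2 * (q : ℝ) * (q - 2) ^ 2 := by positivity
        linarith
      have h8 : 0 ≤ (q : ℝ)⁻¹ * ((x ^ 2 - 4) * (2 * (q : ℝ) - 1)
          + (2 * (q : ℝ) * (q - 2) ^ 2 + 12 * q - 8)) := by positivity
      have h9 : (q : ℝ) ^ 2 * (x + (q : ℝ)⁻¹ * x ^ 2) -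
          (2 * (q - 1) + (q : ℝ)⁻¹ * (2 * (q - 1)) ^ 2
          + ((q - 1) * x + (q - 1) ^ 2 * ((q : ℝ)⁻¹ * x ^ 2))) =
          (x - 2) * ((q : ℝ) ^ 2 - q + 1) + (q : ℝ)⁻¹ * ((x ^ 2 - 4) * (2 * (q : ℝ) - 1)
          + (2 * (q : ℝ) * (q - 2) ^ 2 + 12 * q - 8)) := by
        field_simp
        ring
      linarith
    rw [← add_mul, ← mul_assoc ((q : ℝ) ^ 2)]
    exact mul_le_mul_of_nonneg_right hmain (sq_nonneg _)
  rw [Finset.mul_sum, ← Finset.add_sum_erase _ _ (Finset.mem_univ i),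
    ← Finset.add_sum_erase Finset.univ (fun j => (q : ℝ) ^ 2 * (hess q (p j) * v j ^ 2))
      (Finset.mem_univ i)]
  have h1 := Finset.sum_le_sum hj_term
  rw [Finset.sum_add_distrib] at h1
  have h2 : 0 ≤ (q : ℝ) ^ 2 * (hess q (p i) * v i ^ 2) := by
    have := hess_nonneg q (hp.1 i)
    positivity
  linarith

theorem CL_le_sq {q : ℕ} [NeZero q] (hq : 2 ≤ q) (lam : Param q) :
    CL q lam ≤ (q : ℝ≥0∞) ^ 2 := by
  refine iSup_le fun ⟨p, hp⟩ => iSup_le fun ⟨v, hv⟩ => ?_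
  simp only
  by_cases hsupp : ∀ i, p i = 0 → v i = 0
  -- otherwise the denominator is infinite
  swap
  · push Not at hsupp
    obtain ⟨i, hi, hvi⟩ := hsupp
    rw [fL_eq_top hvi hi.le, ENNReal.div_top]
    exact zero_le
  refine ENNReal.div_le_of_le_mul ?_
  have hq' : (2 : ℝ) ≤ q := by exact_mod_cast hq
  have hpos (i) (hi : v i ≠ 0) : 0 < p i :=
    lt_of_le_of_ne (hp.1 i) fun h => hi (hsupp i h.symm)
  have hapos (i) (hi : v i ≠ 0) : 0 < (lam : ℝ) * p i + (1 - (lam : ℝ)) / q := by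
    -- a vector orthogonal to `1` and supported on `p` has a second nonzero coordinate
    have hp1 : p i < 1 := by
      refine lt_of_le_of_ne (le_one_of_mem_stdSimplex hp i) fun h => hi ?_
      have h0 (j) (hj : j ∈ Finset.univ.erase i) : v j = 0 := by
        refine hsupp j (le_antisymm ?_ (hp.1 j))
        have := hp.2
        rw [← Finset.add_sum_erase _ _ (Finset.mem_univ i), h] at this
        have h2 := Finset.single_le_sum (fun k _ => hp.1 k) hj
        linarith
      rw [← Finset.add_sum_erase _ _ (Finset.mem_univ i), Finset.sum_eq_zero h0] at hv
      linarith
    have h0 := hpos i hi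
    obtain ⟨l, hl1, hl2⟩ := lam
    have hq1 : (0 : ℝ) < q - 1 := by linarith
    have hl1' : -1 ≤ l * (q - 1) := by
      have := mul_le_mul_of_nonneg_right hl1 hq1.le
      rwa [neg_mul, one_div_mul_cancel hq1.ne'] at this
    have : l * p i + (1 - l) / q = (q * l * p i + (1 - l)) / q := by field_simp
    simp only
    rw [this]
    apply div_pos _ (by linarith)
    have h3 : q * l * p i + (1 - l) = (1 + l * (q - 1)) * p i + (1 - l) * (1 - p i) := by ring
    rw [h3]
    rcases hl2.eq_or_lt with h | h
    · subst h; nlinarith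
    · have := mul_pos (sub_pos.2 h) (sub_pos.2 hp1)
      have := mul_nonneg (by linarith : 0 ≤ 1 + l * (q - 1)) h0.le
      linarith
  have hqq : (q : ℝ≥0∞) ^ 2 = ENNReal.ofReal ((q : ℝ) ^ 2) := by
    rw [ENNReal.ofReal_pow (by positivity), ENNReal.ofReal_natCast]
  rw [fL_eq_ofReal hapos, fL_eq_ofReal hpos, hqq, ← ENNReal.ofReal_mul (by positivity)]
  exact ENNReal.ofReal_le_ofReal (sum_hess_pottsMap_le hq lam hp hv hsupp)

/-- The defining inequality of `C^L`, for real numbers. -/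
lemma sum_hess_pottsMap_le_CL {q : ℕ} [NeZero q] (hq : 2 ≤ q) (lam : Param q) {p v : Fin q → ℝ}
    (hp : p ∈ stdSimplex ℝ (Fin q)) (hv : ∑ i, v i = 0) (hpos : ∀ i, v i ≠ 0 → 0 < p i)
    (hapos : ∀ i, v i ≠ 0 → 0 < pottsMap lam p i) :
    ∑ i, hess q (pottsMap lam p i) * v i ^ 2 ≤
      (CL q lam).toReal * ∑ i, hess q (p i) * v i ^ 2 := by
  by_cases hv0 : ∀ i, v i = 0
  · simp [hv0]
  push Not at hv0
  obtain ⟨i, hi⟩ := hv0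
  have hterm (j) : 0 ≤ hess q (p j) * v j ^ 2 :=
    mul_nonneg (hess_nonneg q (hp.1 j)) (sq_nonneg _)
  have hfpos : 0 < ∑ i, hess q (p i) * v i ^ 2 := by
    refine Finset.sum_pos' (fun j _ => hterm j) ⟨i, Finset.mem_univ i, ?_⟩
    have := hpos i hi
    have : 0 < hess q (p i) := by unfold hess; positivity
    positivity
  have h1 : fL q (pottsMap lam p) v / fL q p v ≤ CL q lam :=
    le_iSup_of_le (⟨p, hp⟩ : stdSimplex ℝ (Fin q)) (le_iSup_of_le ⟨v, hv⟩ le_rfl)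
  have htop : CL q lam ≠ ⊤ :=
    ((CL_le_sq hq lam).trans_lt (ENNReal.pow_lt_top (ENNReal.natCast_lt_top q))).ne
  rw [fL_eq_ofReal hapos, fL_eq_ofReal hpos, ENNReal.div_le_iff (by simpa using hfpos)
    ENNReal.ofReal_ne_top, ← ENNReal.ofReal_toReal htop, ← ENNReal.ofReal_mul ENNReal.toReal_nonneg,
    ENNReal.ofReal_le_ofReal_iff (mul_nonneg ENNReal.toReal_nonneg hfpos.le)] at h1
  exact h1

/-! ### The potential and its Bregman divergence -/

/-- One coordinate of the Bregman divergence of the potential `∑ᵢ (pᵢ - 1 / q) log pᵢ`. For `a` and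
`b` both positive this is `φ a - φ b - φ' b * (a - b)` with `φ x = x log x - (log x) / q`; it is `0`
when `a = b = 0`. -/
noncomputable def bregmanTerm (q : ℕ) (a b : ℝ) : ℝ :=
  b * klFun (a / b) + (q : ℝ)⁻¹ * (a / b * klFun (b / a))

/-- The Bregman divergence of the potential `∑ᵢ (pᵢ - 1 / q) log pᵢ`, whose Hessian is `f^L`. It is
only used between laws with the same support. -/
noncomputable def bregman {q : ℕ} (m n : Fin q → ℝ) : ℝ := ∑ i, bregmanTerm q (m i) (n i)

/-- The Kullback-Leibler divergence of two laws on `[q]`. The coordinates with `n i = 0` contribute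
`0`, which is the correct value only if `m i = 0` as well. -/
noncomputable def kl {q : ℕ} (m n : Fin q → ℝ) : ℝ := ∑ i, n i * klFun (m i / n i)

lemma bregmanTerm_nonneg (q : ℕ) {a b : ℝ} (ha : 0 ≤ a) (hb : 0 ≤ b) : 0 ≤ bregmanTerm q a b := by
  unfold bregmanTerm
  have h1 := klFun_nonneg (div_nonneg ha hb)
  have h2 := klFun_nonneg (div_nonneg hb ha)
  positivity

lemma bregman_nonneg {q : ℕ} {m n : Fin q → ℝ} (hm : ∀ i, 0 ≤ m i) (hn : ∀ i, 0 ≤ n i) :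
    0 ≤ bregman m n :=
  Finset.sum_nonneg fun i _ => bregmanTerm_nonneg q (hm i) (hn i)

lemma kl_nonneg {q : ℕ} {m n : Fin q → ℝ} (hm : ∀ i, 0 ≤ m i) (hn : ∀ i, 0 ≤ n i) :
    0 ≤ kl m n :=
  Finset.sum_nonneg fun i _ => mul_nonneg (hn i) (klFun_nonneg (div_nonneg (hm i) (hn i)))

lemma kl_le_bregman {q : ℕ} {m n : Fin q → ℝ} (hm : ∀ i, 0 ≤ m i) (hn : ∀ i, 0 ≤ n i) :
    kl m n ≤ bregman m n := by
  refine Finset.sum_le_sum fun i _ => ?_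
  unfold bregmanTerm
  have h2 := klFun_nonneg (div_nonneg (hn i) (hm i))
  have := div_nonneg (hm i) (hn i)
  have : 0 ≤ (q : ℝ)⁻¹ * (m i / n i * klFun (n i / m i)) := by positivity
  linarith

lemma bregmanTerm_self (q : ℕ) (a : ℝ) : bregmanTerm q a a = 0 := by
  unfold bregmanTerm
  by_cases h : a = 0
  · simp [h]
  · simp [div_self h, klFun_one]

lemma measurable_bregman {q : ℕ} :
    Measurable fun p : (Fin q → ℝ) × (Fin q → ℝ) => bregman p.1 p.2 := by
  unfold bregman bregmanTerm
  refine Finset.measurable_fun_sum _ fun i _ => ?_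
  have h1 : Measurable fun p : (Fin q → ℝ) × (Fin q → ℝ) => p.1 i := by fun_prop
  have h2 : Measurable fun p : (Fin q → ℝ) × (Fin q → ℝ) => p.2 i := by fun_prop
  exact (h2.mul (measurable_klFun.comp (h1.div h2))).add
    (((h1.div h2).mul (measurable_klFun.comp (h2.div h1))).const_mul _)

lemma measurable_kl {q : ℕ} :
    Measurable fun p : (Fin q → ℝ) × (Fin q → ℝ) => kl p.1 p.2 := by
  unfold kl
  refine Finset.measurable_fun_sum _ fun i _ => ?_
  have h1 : Measurable fun p : (Fin q → ℝ) × (Fin q → ℝ) => p.1 i := by fun_prop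
  have h2 : Measurable fun p : (Fin q → ℝ) × (Fin q → ℝ) => p.2 i := by fun_prop
  exact h2.mul (measurable_klFun.comp (h1.div h2))

lemma bregmanTerm_eq_log {q : ℕ} {a b : ℝ} (ha : 0 < a) (hb : 0 < b) :
    bregmanTerm q a b =
      (a - (q : ℝ)⁻¹) * Real.log (a / b) + (b - a) + (q : ℝ)⁻¹ * (a / b - 1) := by
  unfold bregmanTerm
  have h : Real.log (b / a) = -Real.log (a / b) := by rw [← Real.log_inv, inv_div]
  rw [klFun_apply, klFun_apply, h]
  field_simp
  ring

lemma klFun_le_sq {x : ℝ} (hx : 0 < x) : klFun x ≤ (x - 1) ^ 2 := by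
  rw [klFun_apply]
  nlinarith [Real.log_le_sub_one_of_pos hx]

lemma bregmanTerm_le {q : ℕ} [NeZero q] {a b c : ℝ} (hc : 0 < c) (ha : c ≤ a) (hb : c ≤ b)
    (ha1 : a ≤ 1) (hb1 : b ≤ 1) : bregmanTerm q a b ≤ c⁻¹ + c⁻¹ ^ 2 := by
  have ha0 : 0 < a := hc.trans_le ha
  have hb0 : 0 < b := hc.trans_le hb
  have hq : (1 : ℝ) ≤ q := by exact_mod_cast NeZero.one_le
  have hac : a⁻¹ ≤ c⁻¹ := inv_anti₀ hc ha
  have hbc : b⁻¹ ≤ c⁻¹ := inv_anti₀ hc hb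
  have hab : (a - b) ^ 2 ≤ 1 := by nlinarith
  unfold bregmanTerm
  have h1 : b * klFun (a / b) ≤ c⁻¹ := by
    calc b * klFun (a / b) ≤ b * (a / b - 1) ^ 2 := by
          gcongr; exact klFun_le_sq (by positivity)
      _ = (a - b) ^ 2 * b⁻¹ := by field_simp
      _ ≤ 1 * c⁻¹ := by gcongr
      _ = c⁻¹ := one_mul _
  have h2 : (q : ℝ)⁻¹ * (a / b * klFun (b / a)) ≤ c⁻¹ ^ 2 := by
    have h0 : 0 ≤ a / b * klFun (b / a) := by
      have := klFun_nonneg (div_nonneg hb0.le ha0.le)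
      positivity
    calc (q : ℝ)⁻¹ * (a / b * klFun (b / a)) ≤ 1 * (a / b * klFun (b / a)) := by
          gcongr; exact inv_le_one_of_one_le₀ hq
      _ ≤ 1 * (a / b * (b / a - 1) ^ 2) := by
          gcongr; exact klFun_le_sq (by positivity)
      _ = (a - b) ^ 2 * (a⁻¹ * b⁻¹) := by field_simp; ring
      _ ≤ 1 * (c⁻¹ * c⁻¹) := by gcongr
      _ = c⁻¹ ^ 2 := by ring
  linarith

/-- A uniform lower bound on the entries of `λ p + (1 - λ) / q` for non-extreme `λ`. -/
lemma exists_le_pottsMap {q : ℕ} (hq : 2 ≤ q) {l : ℝ} (h1 : -(1 / ((q : ℝ) - 1)) < l)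
    (h2 : l < 1) : ∃ c, 0 < c ∧ ∀ p ∈ stdSimplex ℝ (Fin q), ∀ i, c ≤ pottsMap l p i := by
  have hq' : (2 : ℝ) ≤ q := by exact_mod_cast hq
  have hq1 : (0 : ℝ) < q - 1 := by linarith
  have hl : -1 < l * (q - 1) := by
    have := mul_lt_mul_of_pos_right h1 hq1
    rwa [neg_mul, one_div_mul_cancel hq1.ne'] at this
  refine ⟨min ((1 - l) / q) ((1 + l * (q - 1)) / q), lt_min (div_pos (by linarith) (by linarith))
    (div_pos (by linarith) (by linarith)), fun p hp i => ?_⟩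
  have h3 := hp.1 i
  have h4 := le_one_of_mem_stdSimplex hp i
  have h5 : pottsMap l p i = (1 - p i) * ((1 - l) / q) + p i * ((1 + l * (q - 1)) / q) := by
    unfold pottsMap; field_simp; ring
  rw [h5]
  have h6 := mul_le_mul_of_nonneg_left (min_le_left ((1 - l) / q) ((1 + l * (q - 1)) / q))
    (sub_nonneg.2 h4)
  have h7 := mul_le_mul_of_nonneg_left (min_le_right ((1 - l) / q) ((1 + l * (q - 1)) / q)) h3
  linarith

/-- The potential `φ x = x log x - (log x) / q` of one coordinate. -/
noncomputable def pot (q : ℕ) (x : ℝ) : ℝ := x * Real.log x - (q : ℝ)⁻¹ * Real.log x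

/-- The derivative of `pot`. -/
noncomputable def potDeriv (q : ℕ) (x : ℝ) : ℝ := Real.log x + 1 - (q : ℝ)⁻¹ * x⁻¹

lemma hasDerivAt_pot (q : ℕ) {x : ℝ} (hx : 0 < x) : HasDerivAt (pot q) (potDeriv q x) x := by
  have h := (Real.hasDerivAt_mul_log hx.ne').sub ((Real.hasDerivAt_log hx.ne').const_mul (q : ℝ)⁻¹)
  exact h

lemma hasDerivAt_potDeriv (q : ℕ) {x : ℝ} (hx : 0 < x) :
    HasDerivAt (potDeriv q) (hess q x) x := by
  have h := ((Real.hasDerivAt_log hx.ne').add_const 1).sub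
    ((hasDerivAt_inv hx.ne').const_mul (q : ℝ)⁻¹)
  refine h.congr_deriv ?_
  unfold hess
  rw [inv_pow]; ring

lemma bregmanTerm_eq_pot (q : ℕ) {a b : ℝ} (ha : 0 < a) (hb : 0 < b) :
    bregmanTerm q a b = pot q a - pot q b - potDeriv q b * (a - b) := by
  rw [bregmanTerm_eq_log ha hb, Real.log_div ha.ne' hb.ne']
  unfold pot potDeriv
  field_simp
  ring

/-- The Potts channel contracts the Bregman divergence by `λ ^ 2 * C^L`. By definition of `C^L` the
Hessians compare on the segment from `n` to `m`, hence so do the Bregman divergences. -/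
lemma bregman_pottsMap_le {q : ℕ} [NeZero q] (hq : 2 ≤ q) (lam : Param q)
    (h1 : -(1 / ((q : ℝ) - 1)) < (lam : ℝ)) (h2 : (lam : ℝ) < 1) {m n : Fin q → ℝ}
    (hm : m ∈ stdSimplex ℝ (Fin q)) (hn : n ∈ stdSimplex ℝ (Fin q))
    (hsupp : ∀ i, m i = 0 ↔ n i = 0) :
    bregman (pottsMap lam m) (pottsMap lam n) ≤ (lam : ℝ) ^ 2 * (CL q lam).toReal * bregman m n := by
  classical
  obtain ⟨c, hc0, hc⟩ := exists_le_pottsMap hq h1 h2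
  obtain ⟨l, hl⟩ := lam
  simp only at h1 h2 hc ⊢
  set C := (CL q l).toReal
  set S : Finset (Fin q) := Finset.univ.filter fun i => n i ≠ 0
  set v : Fin q → ℝ := fun i => m i - n i with hv
  have hvsum : ∑ i, v i = 0 := by simp [hv, hm.2, hn.2]
  have hx (t : ℝ) (ht : t ∈ Set.Icc (0 : ℝ) 1) :
      (fun i => n i + t * v i) ∈ stdSimplex ℝ (Fin q) := by
    refine ⟨fun i => ?_, ?_⟩
    · have := mul_nonneg ht.1 (hm.1 i)
      have := mul_nonneg (sub_nonneg.2 ht.2) (hn.1 i)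
      simp only [hv]; linarith
    · rw [Finset.sum_add_distrib, ← Finset.mul_sum, hvsum, hn.2]; simp
  have hxpos (t : ℝ) (ht : t ∈ Set.Icc (0 : ℝ) 1) (i) (hi : n i ≠ 0) : 0 < n i + t * v i := by
    have h3 : 0 < n i := lt_of_le_of_ne (hn.1 i) (Ne.symm hi)
    have h4 : 0 < m i := lt_of_le_of_ne (hm.1 i) (fun h => hi ((hsupp i).1 h.symm))
    have : n i + t * v i = t * m i + (1 - t) * n i := by simp only [hv]; ring
    rw [this]
    rcases ht.1.eq_or_lt with h | h
    · rw [← h]; simpa using h3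
    · have := mul_pos h h4
      have := mul_nonneg (sub_nonneg.2 ht.2) h3.le
      linarith
  have hapos (t : ℝ) (ht : t ∈ Set.Icc (0 : ℝ) 1) (i) :
      0 < l * (n i + t * v i) + (1 - l) / q := hc0.trans_le (hc _ (hx t ht) i)
  have dx (i : Fin q) (t : ℝ) : HasDerivAt (fun t => n i + t * v i) (v i) t := by
    simpa using ((hasDerivAt_id t).mul_const (v i)).const_add (n i)
  have da (i : Fin q) (t : ℝ) :
      HasDerivAt (fun t => l * (n i + t * v i) + (1 - l) / q) (l * v i) t :=
    ((dx i t).const_mul l).add_const _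
  -- the difference of the two potentials along the segment, with its derivatives: `G` is convex,
  -- and the claim says that it lies above its tangent at `0`
  set G : ℝ → ℝ := fun t => ∑ i ∈ S, (l ^ 2 * C * pot q (n i + t * v i)
    - pot q (l * (n i + t * v i) + (1 - l) / q)) with hG
  set G' : ℝ → ℝ := fun t => ∑ i ∈ S, (l ^ 2 * C * (potDeriv q (n i + t * v i) * v i)
    - potDeriv q (l * (n i + t * v i) + (1 - l) / q) * (l * v i)) with hG'
  set G'' : ℝ → ℝ := fun t => ∑ i ∈ S, (l ^ 2 * C * (hess q (n i + t * v i) * v i * v i)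
    - hess q (l * (n i + t * v i) + (1 - l) / q) * (l * v i) * (l * v i)) with hG''
  have hS {i} (hi : i ∈ S) : n i ≠ 0 := (Finset.mem_filter.1 hi).2
  have d1 (t : ℝ) (ht : t ∈ Set.Icc (0 : ℝ) 1) : HasDerivAt G (G' t) t := by
    refine HasDerivAt.fun_sum fun i hi => ?_
    exact (((hasDerivAt_pot q (hxpos t ht i (hS hi))).comp t (dx i t)).const_mul _).sub
      ((hasDerivAt_pot q (hapos t ht i)).comp t (da i t))
  have d2 (t : ℝ) (ht : t ∈ Set.Icc (0 : ℝ) 1) : HasDerivAt G' (G'' t) t := by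
    refine HasDerivAt.fun_sum fun i hi => ?_
    exact ((((hasDerivAt_potDeriv q (hxpos t ht i (hS hi))).comp t (dx i t)).mul_const _).const_mul
      _).sub (((hasDerivAt_potDeriv q (hapos t ht i)).comp t (da i t)).mul_const _)
  have hvS (i) (hi : i ∉ S) : v i = 0 := by
    have h3 : n i = 0 := by simpa [S] using hi
    simp [hv, h3, (hsupp i).2 h3]
  have hGnn (t : ℝ) (ht : t ∈ Set.Icc (0 : ℝ) 1) : 0 ≤ G'' t := by
    have h3 := sum_hess_pottsMap_le_CL hq ⟨l, hl⟩ (hx t ht) hvsum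
      (fun i hi => hxpos t ht i fun h => hi (hvS i (by simp [S, h]))) (fun i _ => hapos t ht i)
    have h4 : G'' t = l ^ 2 * (C * (∑ i, hess q (n i + t * v i) * v i ^ 2)
        - ∑ i, hess q (l * (n i + t * v i) + (1 - l) / q) * v i ^ 2) := by
      rw [Finset.mul_sum, ← Finset.sum_sub_distrib, Finset.mul_sum,
        ← Finset.sum_subset (Finset.subset_univ S)]
      · exact Finset.sum_congr rfl fun i _ => by ring
      · intro i _ hi
        simp [hvS i hi]
    rw [h4]
    exact mul_nonneg (sq_nonneg l) (sub_nonneg.2 h3)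
  have hconv : ConvexOn ℝ (Set.Icc (0 : ℝ) 1) G := by
    refine convexOn_of_hasDerivWithinAt2_nonneg (f' := G') (f'' := G'') (convex_Icc 0 1)
      (fun t ht => (d1 t ht).continuousAt.continuousWithinAt)
      (fun t ht => (d1 t (interior_subset ht)).hasDerivWithinAt)
      (fun t ht => (d2 t (interior_subset ht)).hasDerivWithinAt)
      (fun t ht => hGnn t (interior_subset ht))
  have h0 : (0 : ℝ) ∈ Set.Icc (0 : ℝ) 1 := by simp
  have h01 : (1 : ℝ) ∈ Set.Icc (0 : ℝ) 1 := by simp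
  have hslope := hconv.le_slope_of_hasDerivAt h0 h01 one_pos (d1 0 h0)
  rw [slope_def_field, sub_zero, div_one] at hslope
  have hfinal : l ^ 2 * C * bregman m n - bregman (pottsMap l m) (pottsMap l n)
      = G 1 - G 0 - G' 0 := by
    unfold bregman
    rw [Finset.mul_sum, ← Finset.sum_sub_distrib, ← Finset.sum_subset (Finset.subset_univ S)]
    · rw [← Finset.sum_sub_distrib, ← Finset.sum_sub_distrib]
      refine Finset.sum_congr rfl fun i hi => ?_
      have hn0 := hxpos 0 h0 i (hS hi)
      have hm0 := hxpos 1 h01 i (hS hi)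
      have ha0 := hapos 0 h0 i
      have ha1 := hapos 1 h01 i
      simp only [hv, zero_mul, add_zero, one_mul, add_sub_cancel] at hn0 hm0 ha0 ha1 ⊢
      rw [bregmanTerm_eq_pot q hm0 hn0]
      unfold pottsMap
      rw [bregmanTerm_eq_pot q ha1 ha0]
      ring
    · intro i _ hi
      have h3 : m i = n i := by have := hvS i hi; simp only [hv] at this; linarith
      have h4 : pottsMap l m i = pottsMap l n i := by simp [pottsMap, h3]
      rw [h3, h4, bregmanTerm_self, bregmanTerm_self]
      simp
  linarith

/-! ### Extreme parameters -/

/-- At an extreme parameter the low SNR condition forces the tree to be subcritical: `C^L` is at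
least `1 / λ ^ 2`, as one sees at the uniform law for `λ = 1`, and near a vertex of the simplex for
`λ = -1 / (q - 1)`. -/
lemma one_le_sq_mul_CL_of_extreme {q : ℕ} [NeZero q] (hq : 2 ≤ q) (lam : Param q)
    (h : ¬ (-(1 / ((q : ℝ) - 1)) < (lam : ℝ) ∧ (lam : ℝ) < 1)) :
    1 ≤ (lam : ℝ) ^ 2 * (CL q lam).toReal := by
  classical
  have hq' : (2 : ℝ) ≤ q := by exact_mod_cast hq
  have hq1 : (0 : ℝ) < q - 1 := by linarith
  have hq0 : (0 : ℝ) < q := by linarith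
  obtain ⟨i, j, hij⟩ : ∃ i j : Fin q, i ≠ j :=
    ⟨⟨0, by omega⟩, ⟨1, by omega⟩, by simp [Fin.ext_iff]⟩
  set v : Fin q → ℝ := fun k => if k = i then 1 else if k = j then -1 else 0 with hv
  have hsum (f : Fin q → ℝ) : ∑ k, f k * v k ^ 2 = f i + f j := by
    rw [Finset.sum_eq_add_of_mem i j (Finset.mem_univ _) (Finset.mem_univ _) hij]
    · simp [hv, hij.symm]
    · intro k _ hk
      simp [hv, hk.1, hk.2]
  have hvsum : ∑ k, v k = 0 := by
    rw [Finset.sum_eq_add_of_mem i j (Finset.mem_univ _) (Finset.mem_univ _) hij]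
    · simp [hv, hij.symm]
    · intro k _ hk
      simp [hv, hk.1, hk.2]
  have hvne (k) (hk : v k ≠ 0) : k = i ∨ k = j := by
    by_contra hcon
    push Not at hcon
    exact hk (by simp [hv, hcon.1, hcon.2])
  rw [not_and_or, not_lt, not_lt] at h
  rcases h with h | h
  · have hl : (lam : ℝ) = -(1 / ((q : ℝ) - 1)) := le_antisymm h lam.2.1
    set C := (CL q lam).toReal with hC
    -- test the definition of `C^L` at the law `(1 - e) δ_i + e δ_j`
    have key (e : ℝ) (he0 : 0 < e) (he1 : e < 1 / 2) :
        (q - 1) ^ 2 ≤ C * (1 + q * e + 2 * q * e ^ 2 + 4 * e ^ 2) := by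
      set p : Fin q → ℝ := fun k => if k = i then 1 - e else if k = j then e else 0 with hp
      have hpmem : p ∈ stdSimplex ℝ (Fin q) := by
        refine ⟨fun k => ?_, ?_⟩
        · simp only [hp]; split_ifs <;> linarith
        · rw [Finset.sum_eq_add_of_mem i j (Finset.mem_univ _) (Finset.mem_univ _) hij]
          · simp [hp, hij.symm]
          · intro k _ hk
            simp [hp, hk.1, hk.2]
      have hpi : p i = 1 - e := by simp [hp]
      have hpj : p j = e := by simp [hp, hij.symm]
      have hmap (k) : pottsMap lam p k = (1 - p k) / (q - 1) := by
        unfold pottsMap; rw [hl]; field_simp; ring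
      have h1 := sum_hess_pottsMap_le_CL hq lam hpmem hvsum
        (fun k hk => by
          rcases hvne k hk with rfl | rfl
          · rw [hpi]; linarith
          · rw [hpj]; exact he0)
        (fun k hk => by
          rw [hmap]
          rcases hvne k hk with rfl | rfl
          · rw [hpi]; exact div_pos (by linarith) hq1
          · rw [hpj]; exact div_pos (by linarith) hq1)
      rw [hsum, hsum, hmap, hmap, hpi, hpj, ← hC, sub_sub_cancel] at h1
      have h2 : 0 ≤ hess q ((1 - e) / (q - 1)) :=
        hess_nonneg q (div_nonneg (by linarith) hq1.le)
      have h3 : (q - 1) ^ 2 / (q * e ^ 2) ≤ hess q (e / (q - 1)) := by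
        have : hess q (e / (q - 1)) = (q - 1) / e + (q - 1) ^ 2 / (q * e ^ 2) := by
          unfold hess; field_simp
        rw [this]
        have : 0 ≤ (q - 1) / e := by positivity
        linarith
      have h4 : hess q (1 - e) ≤ 2 + 4 / q := by
        refine (hess_anti q (x := 1 / 2) (by norm_num) (by linarith)).trans (le_of_eq ?_)
        unfold hess; norm_num; ring
      have h5 : hess q e = 1 / e + 1 / (q * e ^ 2) := by unfold hess; field_simp
      have hC0 : 0 ≤ C := ENNReal.toReal_nonneg
      have h6 : (q - 1) ^ 2 / (q * e ^ 2) ≤ C * (2 + 4 / q + (1 / e + 1 / (q * e ^ 2))) := by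
        rw [← h5]
        have := mul_le_mul_of_nonneg_left h4 hC0
        nlinarith
      rw [div_le_iff₀ (by positivity)] at h6
      refine h6.trans (le_of_eq ?_)
      field_simp
      ring
    have hlim : Tendsto (fun e : ℝ => C * (1 + q * e + 2 * q * e ^ 2 + 4 * e ^ 2)) (𝓝[>] 0)
        (𝓝 (C * (1 + q * 0 + 2 * q * 0 ^ 2 + 4 * 0 ^ 2))) :=
      (Continuous.tendsto (by fun_prop) 0).mono_left nhdsWithin_le_nhds
    have hle := ge_of_tendsto hlim (b := ((q : ℝ) - 1) ^ 2) <| by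
      filter_upwards [Ioo_mem_nhdsGT (show (0 : ℝ) < 1 / 2 by norm_num)] with e he
      exact key e he.1 he.2
    simp only [mul_zero, add_zero, mul_one, ne_eq, OfNat.ofNat_ne_zero, not_false_eq_true,
      zero_pow] at hle
    rw [hl, neg_sq, div_pow, one_pow, one_div_mul_eq_div, le_div_iff₀ (by positivity), one_mul]
    exact hle
  · have hl : (lam : ℝ) = 1 := le_antisymm lam.2.2 h
    have hmem : (fun _ : Fin q => (q : ℝ)⁻¹) ∈ stdSimplex ℝ (Fin q) :=
      ⟨fun _ => by positivity, by simp⟩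
    have hpot : pottsMap (lam : ℝ) (fun _ : Fin q => (q : ℝ)⁻¹) = fun _ => (q : ℝ)⁻¹ := by
      funext k; simp [pottsMap, hl]
    have h1 := sum_hess_pottsMap_le_CL hq lam hmem hvsum (fun _ _ => by positivity)
      (fun _ _ => by rw [hpot]; positivity)
    rw [hpot, hsum] at h1
    have h2 : 0 < hess q (q : ℝ)⁻¹ := by unfold hess; positivity
    rw [hl, one_pow, one_mul]
    rw [hl] at h1
    refine le_of_mul_le_mul_right ?_ (add_pos h2 h2)
    rwa [one_mul]

/-! ### Normalised vectors and branching measures -/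

/-- The law on `[q]` proportional to the nonnegative vector `x` (uniform if `x = 0`). -/
noncomputable def normalize {q : ℕ} (x : Fin q → ℝ) : Fin q → ℝ :=
  fun i => if ∑ j, x j = 0 then (q : ℝ)⁻¹ else x i / ∑ j, x j

lemma normalize_mem {q : ℕ} [NeZero q] {x : Fin q → ℝ} (hx : ∀ i, 0 ≤ x i) :
    normalize x ∈ stdSimplex ℝ (Fin q) := by
  unfold normalize
  split_ifs with h
  · exact ⟨fun _ => by positivity, by simp⟩
  · refine ⟨fun i => div_nonneg (hx i) (Finset.sum_nonneg fun j _ => hx j), ?_⟩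
    rw [← Finset.sum_div, div_self h]

lemma normalize_smul {q : ℕ} (x : Fin q → ℝ) {c : ℝ} (hc : c ≠ 0) :
    normalize (fun i => c * x i) = normalize x := by
  funext i
  unfold normalize
  rw [← Finset.mul_sum]
  by_cases h : ∑ j, x j = 0
  · simp [h]
  · rw [if_neg h, if_neg (mul_ne_zero hc h), mul_div_mul_left _ _ hc]

lemma normalize_of_mem {q : ℕ} {x : Fin q → ℝ} (hx : x ∈ stdSimplex ℝ (Fin q)) :
    normalize x = x := by
  funext i
  simp [normalize, hx.2]

lemma normalize_of_sum_ne_zero {q : ℕ} {x : Fin q → ℝ} (hx : ∑ j, x j ≠ 0) (i : Fin q) :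
    normalize x i = x i / ∑ j, x j := by
  simp [normalize, hx]

lemma measurable_normalize {q : ℕ} : Measurable (normalize (q := q)) := by
  refine measurable_pi_lambda _ fun i => ?_
  have hs : Measurable fun x : Fin q → ℝ => ∑ j, x j :=
    Finset.measurable_fun_sum _ fun j _ => measurable_pi_apply j
  exact Measurable.ite (hs (measurableSet_singleton 0)) measurable_const
    ((measurable_pi_apply i).div hs)

section Branch

variable {Ω Ω' : Type*} [MeasurableSpace Ω] [MeasurableSpace Ω']

/-- The law of a tuple of `b` independent samples of `μ`, where `b` has law `ν`. -/
noncomputable def branchMeasure (ν : Measure ℕ) (μ : Measure Ω) : Measure (Σ b : ℕ, Fin b → Ω) :=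
  ν.bind fun b => (Measure.pi fun _ : Fin b => μ).map
    (fun z => (⟨b, z⟩ : Σ b : ℕ, Fin b → Ω))

lemma branch_apply {q : ℕ} (ν : Measure ℕ) (K : Kernel (Fin q) Ω) (i : Fin q) :
    branch ν K i = branchMeasure ν (K i) := rfl

lemma measurable_of_sigma {ι : Type*} {X : ι → Type*} [∀ i, MeasurableSpace (X i)]
    {f : Sigma X → Ω} (h : ∀ i, Measurable fun x => f ⟨i, x⟩) : Measurable f := by
  rw [measurable_iff_le_map, ← MeasurableSpace.comap_le_iff_le_map]
  refine le_iInf fun i => ?_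
  rw [MeasurableSpace.comap_le_iff_le_map, MeasurableSpace.map_comp]
  exact measurable_iff_le_map.1 (h i)

lemma lintegral_branchMeasure (ν : Measure ℕ) (μ : Measure Ω)
    {f : (Σ b : ℕ, Fin b → Ω) → ℝ≥0∞} (hf : Measurable f) :
    ∫⁻ s, f s ∂branchMeasure ν μ =
      ∫⁻ b, ∫⁻ z, f ⟨b, z⟩ ∂(Measure.pi fun _ : Fin b => μ) ∂ν := by
  unfold branchMeasure
  rw [Measure.lintegral_bind (measurable_of_countable _).aemeasurable hf.aemeasurable]
  refine lintegral_congr fun b => ?_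
  rw [lintegral_map hf (measurable_sigmaMk (X := fun b : ℕ => Fin b → Ω) b)]

lemma branchMeasure_map (ν : Measure ℕ) (μ : Measure Ω) [IsProbabilityMeasure μ] {g : Ω → Ω'}
    (hg : Measurable g) :
    (branchMeasure ν μ).map (fun s => (⟨s.1, fun j => g (s.2 j)⟩ : Σ b : ℕ, Fin b → Ω')) =
      branchMeasure ν (μ.map g) := by
  have := Measure.isProbabilityMeasure_map (μ := μ) hg.aemeasurable
  ext s hs
  rw [← lintegral_indicator_one hs, ← lintegral_indicator_one hs,
    lintegral_map (measurable_one.indicator hs) (measurable_sigmaMap hg),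
    lintegral_branchMeasure ν μ (f := fun s' => s.indicator 1
      (⟨s'.1, fun j => g (s'.2 j)⟩ : Σ b : ℕ, Fin b → Ω'))
      ((measurable_one.indicator hs).comp (measurable_sigmaMap hg)),
    lintegral_branchMeasure _ _ (measurable_one.indicator hs)]
  refine lintegral_congr fun b => ?_
  rw [← Measure.pi_map_pi (μ := fun _ : Fin b => μ) (f := fun _ => g) fun _ => hg.aemeasurable]
  exact (lintegral_map (f := fun z => s.indicator 1 (⟨b, z⟩ : Σ b : ℕ, Fin b → Ω'))
    ((measurable_one.indicator hs).comp (measurable_sigmaMk (X := fun b : ℕ => Fin b → Ω') b))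
    (measurable_pi_lambda _ fun j => hg.comp (measurable_pi_apply j))).symm

lemma pi_withDensity {b : ℕ} (μ : Measure Ω) [IsProbabilityMeasure μ] {f : Ω → ℝ≥0∞}
    (hf : Measurable f) [IsProbabilityMeasure (μ.withDensity f)] :
    (Measure.pi fun _ : Fin b => μ.withDensity f) =
      (Measure.pi fun _ : Fin b => μ).withDensity fun z => ∏ l, f (z l) := by
  refine Measure.pi_eq fun s hs => ?_
  rw [withDensity_apply _ (MeasurableSet.univ_pi hs),
    ← lintegral_indicator (MeasurableSet.univ_pi hs)]
  have h1 (z : Fin b → Ω) : (Set.univ.pi s).indicator (fun z => ∏ l, f (z l)) z =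
      ∏ l, (s l).indicator f (z l) := by
    by_cases h : z ∈ Set.univ.pi s
    · rw [Set.indicator_of_mem h]
      exact Finset.prod_congr rfl fun l _ => by rw [Set.indicator_of_mem (h l (Set.mem_univ l))]
    · rw [Set.indicator_of_notMem h]
      simp only [Set.mem_univ_pi, not_forall] at h
      obtain ⟨l, hl⟩ := h
      exact (Finset.prod_eq_zero (Finset.mem_univ l) (Set.indicator_of_notMem hl f)).symm
  simp only [h1]
  have hmeas (l : Fin b) : Measurable ((s l).indicator f) := hf.indicator (hs l)
  rw [lintegral_prod_eq_prod_lintegral_of_indepFun Finset.univ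
    (fun (l : Fin b) (z : Fin b → Ω) => (s l).indicator f (z l))
    (iIndepFun_pi fun l => (hmeas l).aemeasurable) fun l => (hmeas l).comp (measurable_pi_apply l)]
  refine Finset.prod_congr rfl fun l _ => ?_
  rw [withDensity_apply _ (hs l), ← lintegral_indicator (hs l)]
  exact (measurePreserving_eval (fun _ : Fin b => μ) l).lintegral_comp (hmeas l)

end Branch

lemma comp_potts_apply {q : ℕ} {Ω : Type*} [MeasurableSpace Ω] (K : Kernel (Fin q) Ω)
    (lam : Param q) (i : Fin q) {s : Set Ω} (hs : MeasurableSet s) :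
    (K ∘ₖ pottsKernel q lam) i s = ∑ j, ENNReal.ofReal
      ((lam : ℝ) * (if i = j then 1 else 0) + (1 - (lam : ℝ)) / q) * K j s := by
  rw [Kernel.comp_apply' _ _ _ hs]
  change ∫⁻ b, K b s ∂(∑ j, ENNReal.ofReal ((lam : ℝ) * (if i = j then 1 else 0)
    + (1 - (lam : ℝ)) / q) • Measure.dirac j : Measure (Fin q)) = _
  rw [lintegral_finsetSum_measure]
  simp only [lintegral_smul_measure, lintegral_dirac, smul_eq_mul]

/-! ### Posteriors -/

section Posterior

variable {q : ℕ} [NeZero q] {Ω Ω' : Type*} [MeasurableSpace Ω] [MeasurableSpace Ω']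

lemma natCast_ne_zero_ennreal (q : ℕ) [NeZero q] : (q : ℝ≥0∞) ≠ 0 := by
  exact_mod_cast NeZero.ne q

lemma unif_singleton (i : Fin q) : unif q {i} = (q : ℝ≥0∞)⁻¹ := by
  unfold unif
  rw [PMF.toMeasure_apply_singleton _ _ (measurableSet_singleton i)]
  simp

lemma lintegral_unif (f : Fin q → ℝ≥0∞) : ∫⁻ i, f i ∂unif q = (q : ℝ≥0∞)⁻¹ * ∑ i, f i := by
  rw [lintegral_fintype, Finset.mul_sum]
  exact Finset.sum_congr rfl fun i _ => by rw [unif_singleton, mul_comm]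

/-- The output law for a uniform input is the average of the output laws. -/
lemma comp_unif_eq (K : Kernel (Fin q) Ω) : K ∘ₘ unif q = (q : ℝ≥0∞)⁻¹ • ∑ i, K i := by
  ext s hs
  rw [Measure.bind_apply hs K.aemeasurable, lintegral_unif]
  simp

lemma lintegral_comp_unif (K : Kernel (Fin q) Ω) (f : Ω → ℝ≥0∞) :
    ∫⁻ ω, f ω ∂(K ∘ₘ unif q) = (q : ℝ≥0∞)⁻¹ * ∑ i, ∫⁻ ω, f ω ∂K i := by
  rw [comp_unif_eq, lintegral_smul_measure, lintegral_finsetSum_measure, smul_eq_mul]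

lemma integrable_comp_unif {K : Kernel (Fin q) Ω} {f : Ω → ℝ} (hf : ∀ i, Integrable f (K i)) :
    Integrable f (K ∘ₘ unif q) := by
  rw [comp_unif_eq]
  refine Integrable.smul_measure (integrable_finsetSum_measure.2 fun i _ => hf i) ?_
  exact ENNReal.inv_ne_top.2 (natCast_ne_zero_ennreal q)

lemma integral_comp_unif {K : Kernel (Fin q) Ω} {f : Ω → ℝ} (hf : ∀ i, Integrable f (K i)) :
    ∫ ω, f ω ∂(K ∘ₘ unif q) = (q : ℝ)⁻¹ * ∑ i, ∫ ω, f ω ∂K i := by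
  rw [comp_unif_eq, integral_smul_measure, integral_finsetSum_measure fun i _ => hf i]
  simp

lemma map_comp_unif {K : Kernel (Fin q) Ω} {N : Kernel (Fin q) Ω'} {g : Ω → Ω'}
    (hg : Measurable g) (h : ∀ i, (K i).map g = N i) : (K ∘ₘ unif q).map g = N ∘ₘ unif q := by
  ext s hs
  rw [Measure.map_apply hg hs, Measure.bind_apply (hg hs) K.aemeasurable,
    Measure.bind_apply hs N.aemeasurable]
  refine lintegral_congr fun i => ?_
  rw [← h i, Measure.map_apply hg hs]

/-- `m ω` is the law of a uniform input of the channel `K` given that its output is `ω`: `q * m ω i`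
is the density of `K i` with respect to the average output law. -/
structure IsPosterior (K : Kernel (Fin q) Ω) (m : Ω → Fin q → ℝ) : Prop where
  measurable : Measurable m
  mem : ∀ ω, m ω ∈ stdSimplex ℝ (Fin q)
  eq_withDensity : ∀ i, K i = (K ∘ₘ unif q).withDensity fun ω => ENNReal.ofReal (q * m ω i)

/-- `n` is calibrated for the channel `K`: it is the posterior law of a uniform input given the
value of `n` itself. This holds for the posterior given any function of the output. -/
structure Calibrated (K : Kernel (Fin q) Ω) (n : Ω → Fin q → ℝ) : Prop where
  measurable : Measurable n
  mem : ∀ ω, n ω ∈ stdSimplex ℝ (Fin q)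
  lintegral_eq : ∀ (i : Fin q) (h : (Fin q → ℝ) → ℝ≥0∞), Measurable h →
    ∫⁻ ω, h (n ω) ∂K i = ∫⁻ ω, ENNReal.ofReal (q * n ω i) * h (n ω) ∂(K ∘ₘ unif q)

lemma IsPosterior.measurable_apply {K : Kernel (Fin q) Ω} {m : Ω → Fin q → ℝ}
    (hm : IsPosterior K m) (i : Fin q) : Measurable fun ω => m ω i :=
  (measurable_pi_apply i).comp hm.measurable

lemma Calibrated.measurable_apply {K : Kernel (Fin q) Ω} {m : Ω → Fin q → ℝ}
    (hm : Calibrated K m) (i : Fin q) : Measurable fun ω => m ω i :=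
  (measurable_pi_apply i).comp hm.measurable

lemma IsPosterior.lintegral_eq {K : Kernel (Fin q) Ω} {m : Ω → Fin q → ℝ} (hm : IsPosterior K m)
    (i : Fin q) {f : Ω → ℝ≥0∞} (hf : Measurable f) :
    ∫⁻ ω, f ω ∂K i = ∫⁻ ω, ENNReal.ofReal (q * m ω i) * f ω ∂(K ∘ₘ unif q) := by
  rw [hm.eq_withDensity i, lintegral_withDensity_eq_lintegral_mul _ _ hf]
  · rfl
  · exact ((hm.measurable_apply i).const_mul _).ennreal_ofReal

lemma IsPosterior.integral_eq {K : Kernel (Fin q) Ω} {m : Ω → Fin q → ℝ} (hm : IsPosterior K m)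
    (i : Fin q) (f : Ω → ℝ) :
    ∫ ω, f ω ∂K i = ∫ ω, q * m ω i * f ω ∂(K ∘ₘ unif q) := by
  conv_lhs => rw [hm.eq_withDensity i]
  rw [integral_withDensity_eq_integral_toReal_smul]
  · refine integral_congr_ae (ae_of_all _ fun ω => ?_)
    simp only [smul_eq_mul]
    rw [ENNReal.toReal_ofReal (mul_nonneg (Nat.cast_nonneg q) ((hm.mem ω).1 i))]
  · exact ((hm.measurable_apply i).const_mul _).ennreal_ofReal
  · exact ae_of_all _ fun _ => ENNReal.ofReal_lt_top

lemma IsPosterior.integrable_mul {K : Kernel (Fin q) Ω} {m : Ω → Fin q → ℝ} (hm : IsPosterior K m)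
    (i : Fin q) {f : Ω → ℝ} (hf : ∀ j, Integrable f (K j)) :
    Integrable (fun ω => m ω i * f ω) (K ∘ₘ unif q) := by
  refine (integrable_comp_unif hf).bdd_mul (c := 1) (hm.measurable_apply i).aestronglyMeasurable
    (ae_of_all _ fun ω => ?_)
  rw [Real.norm_of_nonneg ((hm.mem ω).1 i)]
  exact le_one_of_mem_stdSimplex (hm.mem ω) i

lemma IsPosterior.comp_calibrated {K : Kernel (Fin q) Ω} {N : Kernel (Fin q) Ω'} {g : Ω → Ω'}
    (hg : Measurable g) (h : ∀ i, (K i).map g = N i) {n : Ω' → Fin q → ℝ} (hn : IsPosterior N n) :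
    Calibrated K (n ∘ g) where
  measurable := hn.measurable.comp hg
  mem ω := hn.mem (g ω)
  lintegral_eq i f hf := by
    have h1 := hn.lintegral_eq i (hf.comp hn.measurable)
    rw [← h i, ← map_comp_unif hg h, lintegral_map (hf.comp hn.measurable) hg, lintegral_map] at h1
    · exact h1
    · exact (((hn.measurable_apply i).const_mul _).ennreal_ofReal).mul (hf.comp hn.measurable)
    · exact hg

/-- A calibrated function is, up to a relabelling of the outputs, a posterior. -/
lemma Calibrated.isPosterior_map {K : Kernel (Fin q) Ω} {n : Ω → Fin q → ℝ} (hn : Calibrated K n)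
    {N : Kernel (Fin q) (stdSimplex ℝ (Fin q))}
    (h : ∀ i, (K i).map (fun ω => (⟨n ω, hn.mem ω⟩ : stdSimplex ℝ (Fin q))) = N i) :
    IsPosterior N Subtype.val where
  measurable := measurable_subtype_coe
  mem p := p.2
  eq_withDensity i := by
    have hmeas : Measurable fun ω => (⟨n ω, hn.mem ω⟩ : stdSimplex ℝ (Fin q)) :=
      hn.measurable.subtype_mk
    ext s hs
    obtain ⟨t, ht, rfl⟩ := hs
    have hs' : MeasurableSet (Subtype.val ⁻¹' t : Set (stdSimplex ℝ (Fin q))) :=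
      measurable_subtype_coe ht
    have h1 := hn.lintegral_eq i (t.indicator 1) (measurable_one.indicator ht)
    rw [withDensity_apply _ hs', ← map_comp_unif hmeas h, ← lintegral_indicator hs', lintegral_map _
      hmeas, ← h i, Measure.map_apply hmeas hs', ← lintegral_indicator_one (hmeas hs')]
    · refine Eq.trans (lintegral_congr fun ω => ?_) (h1.trans (lintegral_congr fun ω => ?_))
      · rfl
      · by_cases hω : n ω ∈ t <;> simp [hω]
    · exact (Measurable.ennreal_ofReal
        (((measurable_pi_apply i).comp measurable_subtype_coe).const_mul _)).indicator hs'

/-- Mathlib's posterior kernel is a posterior in the present sense. -/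
lemma isPosterior_posteriorAt (P : Channel q) :
    IsPosterior P.kernel (fun y => (P.posteriorAt y).1) where
  measurable := measurable_subtype_coe.comp P.measurable_posteriorAt
  mem y := (P.posteriorAt y).2
  eq_withDensity i := by
    ext s hs
    have h := congrArg (fun μ => μ (s ×ˢ {i}))
      (compProd_posterior_eq_map_swap (κ := P.kernel) (μ := unif q))
    rw [Measure.compProd_apply_prod hs (measurableSet_singleton i),
      Measure.map_apply measurable_swap (hs.prod (measurableSet_singleton i)),
      Set.preimage_swap_prod, Measure.compProd_apply_prod (measurableSet_singleton i) hs,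
      lintegral_singleton, unif_singleton] at h
    rw [withDensity_apply _ hs]
    have h2 (y) : ENNReal.ofReal (q * (P.posteriorAt y).1 i)
        = q * (posterior P.kernel (unif q)) y {i} := by
      rw [ENNReal.ofReal_mul (Nat.cast_nonneg q), ENNReal.ofReal_natCast]
      congr 1
      exact ofReal_measureReal
    simp only [h2]
    rw [lintegral_const_mul _ (Kernel.measurable_coe _ (measurableSet_singleton i)), h,
      mul_comm (P.kernel i s), ← mul_assoc, ENNReal.mul_inv_cancel (natCast_ne_zero_ennreal q)
        (ENNReal.natCast_ne_top q), one_mul]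

lemma exists_isPosterior (K : Kernel (Fin q) Ω) [IsMarkovKernel K] :
    ∃ m, IsPosterior K m :=
  ⟨_, isPosterior_posteriorAt ⟨Ω, K⟩⟩

lemma IsPosterior.ae_eq {K : Kernel (Fin q) Ω} [IsMarkovKernel K] {m m' : Ω → Fin q → ℝ}
    (hm : IsPosterior K m) (hm' : IsPosterior K m') : m =ᵐ[K ∘ₘ unif q] m' := by
  have h (i : Fin q) : ∀ᵐ ω ∂(K ∘ₘ unif q), m ω i = m' ω i := by
    have h1 := (hm.eq_withDensity i).symm.trans (hm'.eq_withDensity i)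
    rw [withDensity_eq_iff_of_sigmaFinite
      ((hm.measurable_apply i).const_mul _).ennreal_ofReal.aemeasurable
      ((hm'.measurable_apply i).const_mul _).ennreal_ofReal.aemeasurable] at h1
    filter_upwards [h1] with ω hω
    have hq : (q : ℝ) ≠ 0 := by exact_mod_cast NeZero.ne q
    rw [ENNReal.ofReal_eq_ofReal_iff (mul_nonneg (Nat.cast_nonneg q) ((hm.mem ω).1 i))
      (mul_nonneg (Nat.cast_nonneg q) ((hm'.mem ω).1 i))] at hω
    exact mul_left_cancel₀ hq hω
  filter_upwards [ae_all_iff.2 h] with ω hω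
  exact funext hω

/-! ### Posteriors of composed channels -/

/-- Bayes' rule: the posterior is proportional to the likelihoods. -/
lemma isPosterior_normalize {K : Kernel (Fin q) Ω} (ref : Measure Ω) {g : Ω → Fin q → ℝ}
    (hg : Measurable g) (hg0 : ∀ ω i, 0 ≤ g ω i)
    (hK : ∀ i, K i = ref.withDensity fun ω => ENNReal.ofReal (g ω i)) :
    IsPosterior K fun ω => normalize (g ω) where
  measurable := measurable_normalize.comp hg
  mem ω := normalize_mem (hg0 ω)
  eq_withDensity i := by
    have hgi (i) : Measurable fun ω => ENNReal.ofReal (g ω i) :=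
      ((measurable_pi_apply i).comp hg).ennreal_ofReal
    have hni : Measurable fun ω => ENNReal.ofReal (q * normalize (g ω) i) :=
      (((measurable_pi_apply i).comp (measurable_normalize.comp hg)).const_mul _).ennreal_ofReal
    have hq : (q : ℝ) ≠ 0 := by exact_mod_cast NeZero.ne q
    ext s hs
    rw [withDensity_apply _ hs, ← lintegral_indicator hs, lintegral_comp_unif]
    have h1 (j) : ∫⁻ ω, s.indicator (fun ω => ENNReal.ofReal (q * normalize (g ω) i)) ω ∂K j =
        ∫⁻ ω in s, ENNReal.ofReal (g ω j) * ENNReal.ofReal (q * normalize (g ω) i) ∂ref := by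
      rw [hK j, lintegral_withDensity_eq_lintegral_mul _ (hgi j) (hni.indicator hs),
        ← lintegral_indicator hs]
      refine lintegral_congr fun ω => ?_
      by_cases hω : ω ∈ s <;> simp [hω]
    simp only [h1]
    rw [← lintegral_finsetSum Finset.univ (f := fun j ω => ENNReal.ofReal (g ω j) *
      ENNReal.ofReal (q * normalize (g ω) i)) fun j _ => (hgi j).mul hni, ← lintegral_const_mul _
      (f := fun ω => ∑ j, ENNReal.ofReal (g ω j) * ENNReal.ofReal (q * normalize (g ω) i))
      (Finset.measurable_fun_sum _ fun j _ => (hgi j).mul hni), hK i, withDensity_apply _ hs]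
    refine lintegral_congr fun ω => ?_
    rw [← Finset.sum_mul, ← ENNReal.ofReal_sum_of_nonneg fun j _ => hg0 ω j,
      ← ENNReal.ofReal_mul (Finset.sum_nonneg fun j _ => hg0 ω j), ← ENNReal.ofReal_natCast,
      ← ENNReal.ofReal_inv_of_pos (by exact_mod_cast NeZero.pos q),
      ← ENNReal.ofReal_mul (by positivity)]
    congr 1
    by_cases h : ∑ j, g ω j = 0
    · rw [h, (Finset.sum_eq_zero_iff_of_nonneg fun j _ => hg0 ω j).1 h i (Finset.mem_univ i)]
      simp
    · rw [normalize_of_sum_ne_zero h]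
      field_simp

lemma sum_pottsEntry (lam : Param q) (j : Fin q) : ∑ i, ENNReal.ofReal
    ((lam : ℝ) * (if i = j then 1 else 0) + (1 - (lam : ℝ)) / q) = 1 := by
  have hq : (q : ℝ) ≠ 0 := by exact_mod_cast NeZero.ne q
  rw [← ENNReal.ofReal_sum_of_nonneg fun i _ => pottsEntry_nonneg q lam i j,
    Finset.sum_add_distrib, ← Finset.mul_sum]
  simp
  field_simp
  simp

/-- The Potts channel preserves the uniform law. -/
lemma comp_potts_comp_unif (K : Kernel (Fin q) Ω) (lam : Param q) :
    (K ∘ₖ pottsKernel q lam) ∘ₘ unif q = K ∘ₘ unif q := by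
  ext s hs
  rw [comp_unif_eq, comp_unif_eq]
  simp only [Measure.smul_apply, Measure.coe_finsetSum, Finset.sum_apply]
  congr 1
  simp only [comp_potts_apply K lam _ hs]
  rw [Finset.sum_comm]
  exact Finset.sum_congr rfl fun j _ => by rw [← Finset.sum_mul, sum_pottsEntry, one_mul]

/-- The posterior of the Potts channel followed by a channel. -/
lemma IsPosterior.comp_potts {K : Kernel (Fin q) Ω} {m : Ω → Fin q → ℝ} (hm : IsPosterior K m)
    (lam : Param q) :
    IsPosterior (K ∘ₖ pottsKernel q lam) fun ω => pottsMap lam (m ω) := by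
  have hq : (q : ℝ) ≠ 0 := by exact_mod_cast NeZero.ne q
  have h1 (ω) : pottsMap lam (m ω) = normalize fun i => q * pottsMap lam (m ω) i := by
    rw [normalize_smul _ hq, normalize_of_mem (pottsMap_mem_stdSimplex lam (hm.mem ω))]
  rw [funext h1]
  refine isPosterior_normalize (K ∘ₘ unif q) ?_ ?_ fun i => ?_
  · refine measurable_pi_lambda _ fun i => ?_
    exact (((hm.measurable_apply i).const_mul _).add_const _).const_mul _
  · exact fun ω i => mul_nonneg (Nat.cast_nonneg q)
      ((pottsMap_mem_stdSimplex lam (hm.mem ω)).1 i)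
  · ext s hs
    have hmj (j) : Measurable fun ω => ENNReal.ofReal (q * m ω j) :=
      ((hm.measurable_apply j).const_mul _).ennreal_ofReal
    rw [comp_potts_apply K lam i hs, withDensity_apply _ hs]
    have h3 (j) : K j s = ∫⁻ ω in s, ENNReal.ofReal (q * m ω j) ∂(K ∘ₘ unif q) := by
      conv_lhs => rw [hm.eq_withDensity j]
      rw [withDensity_apply _ hs]
    simp only [h3]
    simp only [← lintegral_const_mul _ (hmj _)]
    rw [← lintegral_finsetSum _ fun j _ => (hmj j).const_mul _]
    refine lintegral_congr fun ω => ?_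
    have h4 (j) : 0 ≤ (q : ℝ) * m ω j := mul_nonneg (Nat.cast_nonneg q) ((hm.mem ω).1 j)
    simp only [← ENNReal.ofReal_mul (pottsEntry_nonneg q lam i _)]
    rw [← ENNReal.ofReal_sum_of_nonneg fun j _ => mul_nonneg (pottsEntry_nonneg q lam i j) (h4 j)]
    congr 1
    simp only [add_mul, Finset.sum_add_distrib, ← Finset.mul_sum, (hm.mem ω).2, pottsMap]
    simp
    field_simp

lemma Calibrated.comp_potts {K : Kernel (Fin q) Ω} {n : Ω → Fin q → ℝ} (hn : Calibrated K n)
    (lam : Param q) :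
    Calibrated (K ∘ₖ pottsKernel q lam) fun ω => pottsMap lam (n ω) := by
  have hmeas : Measurable fun ω => (⟨n ω, hn.mem ω⟩ : stdSimplex ℝ (Fin q)) :=
    hn.measurable.subtype_mk
  have h1 := (hn.isPosterior_map (N := K.map _)
    fun i => (Kernel.map_apply _ hmeas i).symm).comp_potts lam
  refine h1.comp_calibrated hmeas fun i => ?_
  rw [← Kernel.map_apply _ hmeas, Kernel.map_comp]

lemma prod_eq_withDensity {W : Kernel (Fin q) Ω'} [IsMarkovKernel W] {w : Ω' → Fin q → ℝ}
    (hw : IsPosterior W w) {K : Kernel (Fin q) Ω} [IsMarkovKernel K] {m : Ω → Fin q → ℝ}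
    (hm : IsPosterior K m) (i : Fin q) :
    (W ×ₖ K) i = ((W ∘ₘ unif q).prod (K ∘ₘ unif q)).withDensity
      fun p => ENNReal.ofReal (q * w p.1 i) * ENNReal.ofReal (q * m p.2 i) := by
  rw [Kernel.prod_apply]
  conv_lhs => rw [hw.eq_withDensity i, hm.eq_withDensity i]
  rw [prod_withDensity ((hw.measurable_apply i).const_mul _).ennreal_ofReal
    ((hm.measurable_apply i).const_mul _).ennreal_ofReal]

/-- The posterior given the outputs of two channels used independently. -/
lemma IsPosterior.prod {W : Kernel (Fin q) Ω'} [IsMarkovKernel W] {w : Ω' → Fin q → ℝ}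
    (hw : IsPosterior W w) {K : Kernel (Fin q) Ω} [IsMarkovKernel K] {m : Ω → Fin q → ℝ}
    (hm : IsPosterior K m) :
    IsPosterior (W ×ₖ K) fun p => normalize fun i => w p.1 i * m p.2 i := by
  have hq : (q : ℝ) ≠ 0 := by exact_mod_cast NeZero.ne q
  have h1 (p : Ω' × Ω) : (normalize fun i => w p.1 i * m p.2 i)
      = normalize fun i => (q * q : ℝ) * (w p.1 i * m p.2 i) :=
    (normalize_smul _ (mul_ne_zero hq hq)).symm
  rw [funext h1]
  refine isPosterior_normalize ((W ∘ₘ unif q).prod (K ∘ₘ unif q)) ?_ ?_ fun i => ?_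
  · refine measurable_pi_lambda _ fun i => ?_
    exact (((hw.measurable_apply i).comp measurable_fst).mul
      ((hm.measurable_apply i).comp measurable_snd)).const_mul _
  · intro p i
    have := (hw.mem p.1).1 i
    have := (hm.mem p.2).1 i
    positivity
  · rw [prod_eq_withDensity hw hm]
    congr 1
    funext p
    rw [← ENNReal.ofReal_mul (mul_nonneg (Nat.cast_nonneg q) ((hw.mem p.1).1 i))]
    congr 1
    ring

/-- The posterior given `b` independent observations of the input. -/
noncomputable def starPosterior (m : Ω → Fin q → ℝ) (s : Σ b : ℕ, Fin b → Ω) : Fin q → ℝ :=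
  normalize fun i => ∏ l, m (s.2 l) i

lemma IsPosterior.branch {K : Kernel (Fin q) Ω} [IsMarkovKernel K] {m : Ω → Fin q → ℝ}
    (hm : IsPosterior K m) (ν : Measure ℕ) :
    IsPosterior (branch ν K) (starPosterior m) := by
  have hq : (q : ℝ) ≠ 0 := by exact_mod_cast NeZero.ne q
  have h1 : starPosterior m = fun s => normalize fun i => ∏ l, (q * m (s.2 l) i) := by
    funext s
    simp only [Finset.prod_mul_distrib]
    rw [Finset.prod_const, normalize_smul _ (pow_ne_zero _ hq)]
    rfl
  rw [h1]
  have hmi (i) : Measurable fun ω => ENNReal.ofReal (q * m ω i) :=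
    ((hm.measurable_apply i).const_mul _).ennreal_ofReal
  have hmeas (i : Fin q) : Measurable fun s : (Σ b : ℕ, Fin b → Ω) => ∏ l, (q * m (s.2 l) i) :=
    measurable_of_sigma fun b => Finset.measurable_fun_prod Finset.univ
      (f := fun (l : Fin b) (z : Fin b → Ω) => (q : ℝ) * m (z l) i) fun l _ =>
      ((hm.measurable_apply i).comp (measurable_pi_apply l)).const_mul (q : ℝ)
  have hnn (ω i) : 0 ≤ (q : ℝ) * m ω i := mul_nonneg (Nat.cast_nonneg q) ((hm.mem ω).1 i)
  refine isPosterior_normalize (branchMeasure ν (K ∘ₘ unif q)) (measurable_pi_lambda _ hmeas)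
    (fun s i => Finset.prod_nonneg fun l _ => hnn _ i) fun i => ?_
  ext s hs
  have hd := hm.eq_withDensity i
  have hprob : IsProbabilityMeasure ((K ∘ₘ unif q).withDensity
      fun ω => ENNReal.ofReal (q * m ω i)) := by
    rw [← hd]; infer_instance
  rw [withDensity_apply _ hs, ← lintegral_indicator hs, branch_apply,
    ← lintegral_indicator_one hs, lintegral_branchMeasure _ _ (measurable_one.indicator hs),
    lintegral_branchMeasure _ _ ((hmeas i).ennreal_ofReal.indicator hs)]
  refine lintegral_congr fun b => ?_
  have hmb : Measurable fun z : Fin b → Ω => ∏ l, ENNReal.ofReal (q * m (z l) i) :=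
    Finset.measurable_fun_prod _ fun l _ => (hmi i).comp (measurable_pi_apply l)
  rw [hd, pi_withDensity _ (hmi i)]
  refine (lintegral_withDensity_eq_lintegral_mul _ hmb
    (g := fun z => s.indicator 1 (⟨b, z⟩ : Σ b : ℕ, Fin b → Ω))
    ((measurable_one.indicator hs).comp (measurable_sigmaMk (X := fun b : ℕ => Fin b → Ω) b))).trans
    (lintegral_congr fun z => ?_)
  simp only [Pi.mul_apply]
  by_cases hz : (⟨b, z⟩ : Σ b : ℕ, Fin b → Ω) ∈ s
  · simp [hz, ENNReal.ofReal_prod_of_nonneg fun l _ => hnn (z l) i]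
  · simp [hz]

lemma Calibrated.branch {K : Kernel (Fin q) Ω} [IsMarkovKernel K] {n : Ω → Fin q → ℝ}
    (hn : Calibrated K n) (ν : Measure ℕ) :
    Calibrated (branch ν K) (starPosterior n) := by
  have hmeas : Measurable fun ω => (⟨n ω, hn.mem ω⟩ : stdSimplex ℝ (Fin q)) :=
    hn.measurable.subtype_mk
  have hM : IsMarkovKernel (K.map fun ω => (⟨n ω, hn.mem ω⟩ : stdSimplex ℝ (Fin q))) :=
    Kernel.IsMarkovKernel.map _ hmeas
  have h1 := (hn.isPosterior_map (N := K.map _) fun i => (Kernel.map_apply _ hmeas i).symm).branch ν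
  refine h1.comp_calibrated (measurable_sigmaMap hmeas) fun i => ?_
  rw [branch_apply, branch_apply, Kernel.map_apply _ hmeas, branchMeasure_map ν _ hmeas]

end Posterior

/-! ### Additivity of the potential -/

lemma starPosterior_pos {q : ℕ} {Ω : Type*} {m : Ω → Fin q → ℝ} (hm : ∀ ω i, 0 < m ω i)
    (s : Σ b : ℕ, Fin b → Ω) (i : Fin q) : 0 < starPosterior m s i := by
  have h (j) : 0 < ∏ l, m (s.2 l) j := Finset.prod_pos fun l _ => hm _ j
  have h2 : 0 < ∑ j, ∏ l, m (s.2 l) j :=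
    Finset.sum_pos (fun j _ => h j) ⟨i, Finset.mem_univ i⟩
  unfold starPosterior
  rw [normalize_of_sum_ne_zero h2.ne']
  exact div_pos (h i) h2

section Additivity

variable {q : ℕ} [NeZero q] {Ω Ω' : Type*} [MeasurableSpace Ω] [MeasurableSpace Ω']

/-- The posterior may be replaced by a calibrated law against functions of the latter. -/
lemma lintegral_ofReal_mul_of_calibrated {K : Kernel (Fin q) Ω} {m n : Ω → Fin q → ℝ}
    (hm : IsPosterior K m) (hn : Calibrated K n) (i : Fin q) {h : (Fin q → ℝ) → ℝ≥0∞}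
    (hh : Measurable h) :
    ∫⁻ ω, ENNReal.ofReal (m ω i) * h (n ω) ∂(K ∘ₘ unif q) =
      ∫⁻ ω, ENNReal.ofReal (n ω i) * h (n ω) ∂(K ∘ₘ unif q) := by
  have h1 := (hm.lintegral_eq i (hh.comp hn.measurable)).symm.trans (hn.lintegral_eq i h hh)
  simp only [ENNReal.ofReal_mul (Nat.cast_nonneg q), ENNReal.ofReal_natCast, mul_assoc,
    Function.comp_apply] at h1
  rw [lintegral_const_mul _ (f := fun ω => ENNReal.ofReal (m ω i) * h (n ω))
      ((hm.measurable_apply i).ennreal_ofReal.mul (hh.comp hn.measurable)),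
    lintegral_const_mul _ (f := fun ω => ENNReal.ofReal (n ω i) * h (n ω))
      ((hn.measurable_apply i).ennreal_ofReal.mul (hh.comp hn.measurable))] at h1
  exact (ENNReal.mul_right_inj (natCast_ne_zero_ennreal q) (ENNReal.natCast_ne_top q)).1 h1

lemma Calibrated.lintegral_ofReal {K : Kernel (Fin q) Ω} [IsMarkovKernel K] {n : Ω → Fin q → ℝ}
    (hn : Calibrated K n) (i : Fin q) :
    ∫⁻ ω, ENNReal.ofReal (q * n ω i) ∂(K ∘ₘ unif q) = 1 := by
  have h := hn.lintegral_eq i 1 measurable_one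
  simpa using h.symm

/-- The mean `(1 / q) ∑ᵢ (∫ ℓᵢ dKᵢ - ∫ ℓᵢ dK̄)`, where `K̄` is the average of the laws `Kⱼ`. For log
likelihood ratios `ℓ` this is the expected Bregman divergence between the posteriors, and it is
visibly additive in `ℓ`. -/
noncomputable def ratioMean (K : Kernel (Fin q) Ω) (l : Fin q → Ω → ℝ) : ℝ :=
  (q : ℝ)⁻¹ * ∑ i, (∫ ω, l i ω ∂K i - (q : ℝ)⁻¹ * ∑ j, ∫ ω, l i ω ∂K j)

lemma integral_ratio {K : Kernel (Fin q) Ω} [IsMarkovKernel K] {m : Ω → Fin q → ℝ}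
    (hm : IsPosterior K m) {l r : Fin q → Ω → ℝ} (hl : ∀ i j, Integrable (l i) (K j))
    (hr : ∀ i, Integrable (r i) (K ∘ₘ unif q)) :
    Integrable (fun ω => ∑ i, (m ω i - (q : ℝ)⁻¹) * l i ω + (q : ℝ)⁻¹ * ∑ i, (r i ω - 1))
      (K ∘ₘ unif q) ∧
    ∫ ω, (∑ i, (m ω i - (q : ℝ)⁻¹) * l i ω + (q : ℝ)⁻¹ * ∑ i, (r i ω - 1)) ∂(K ∘ₘ unif q) =
      ratioMean K l + (q : ℝ)⁻¹ * ∑ i, (∫ ω, r i ω ∂(K ∘ₘ unif q) - 1) := by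
  have hq : (q : ℝ) ≠ 0 := by exact_mod_cast NeZero.ne q
  have h1 (i) : Integrable (fun ω => (m ω i - (q : ℝ)⁻¹) * l i ω) (K ∘ₘ unif q) := by
    simp only [sub_mul]
    exact (hm.integrable_mul i (hl i)).sub ((integrable_comp_unif (hl i)).const_mul _)
  have h2 (i) : Integrable (fun ω => r i ω - 1) (K ∘ₘ unif q) := (hr i).sub (integrable_const 1)
  have h3 := integrable_finsetSum Finset.univ fun i _ => h1 i
  have h4 := (integrable_finsetSum Finset.univ fun i _ => h2 i).const_mul (q : ℝ)⁻¹
  refine ⟨h3.add h4, ?_⟩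
  rw [integral_add h3 h4, integral_finsetSum _ fun i _ => h1 i, integral_const_mul,
    integral_finsetSum _ fun i _ => h2 i]
  congr 1
  · unfold ratioMean
    rw [Finset.mul_sum]
    refine Finset.sum_congr rfl fun i _ => ?_
    simp only [sub_mul]
    rw [integral_sub (hm.integrable_mul i (hl i)) ((integrable_comp_unif (hl i)).const_mul _),
      integral_const_mul, integral_comp_unif (hl i), hm.integral_eq i]
    simp only [mul_assoc]
    rw [integral_const_mul]
    field_simp
  · congr 1
    refine Finset.sum_congr rfl fun i _ => ?_
    rw [integral_sub (hr i) (integrable_const 1)]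
    simp

/-- The expected Bregman divergence is at most the mean log likelihood ratio, once the divergence is
bounded pointwise by the log likelihood ratios and by terms `rᵢ - 1` of mean zero. -/
lemma lintegral_le_ratioMean {K : Kernel (Fin q) Ω} [IsMarkovKernel K] {m : Ω → Fin q → ℝ}
    (hm : IsPosterior K m) {l r : Fin q → Ω → ℝ} (hl : ∀ i j, Integrable (l i) (K j))
    (hr : ∀ i, Measurable (r i)) (hr0 : ∀ i ω, 0 ≤ r i ω)
    (hr1 : ∀ i, ∫⁻ ω, ENNReal.ofReal (r i ω) ∂(K ∘ₘ unif q) = 1) {F : Ω → ℝ}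
    (hF : ∀ ω, 0 ≤ F ω)
    (hFle : ∀ ω, F ω ≤ ∑ i, (m ω i - (q : ℝ)⁻¹) * l i ω + (q : ℝ)⁻¹ * ∑ i, (r i ω - 1)) :
    ∫⁻ ω, ENNReal.ofReal (F ω) ∂(K ∘ₘ unif q) ≤ ENNReal.ofReal (ratioMean K l) := by
  have hri (i) : Integrable (r i) (K ∘ₘ unif q) := by
    refine ⟨(hr i).aestronglyMeasurable, ?_⟩
    rw [hasFiniteIntegral_iff_ofReal (ae_of_all _ (hr0 i)), hr1 i]
    exact ENNReal.one_lt_top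
  have hri1 (i) : ∫ ω, r i ω ∂(K ∘ₘ unif q) = 1 := by
    rw [integral_eq_lintegral_of_nonneg_ae (ae_of_all _ (hr0 i)) (hr i).aestronglyMeasurable, hr1 i]
    simp
  obtain ⟨h1, h2⟩ := integral_ratio hm hl hri
  simp only [hri1, sub_self, Finset.sum_const_zero, mul_zero, add_zero] at h2
  rw [← h2, ofReal_integral_eq_lintegral_ofReal h1
    (ae_of_all _ fun ω => (hF ω).trans (hFle ω))]
  exact lintegral_mono fun ω => ENNReal.ofReal_le_ofReal (hFle ω)

/-- For laws with a common lower bound, the mean log likelihood ratio is the expected Bregman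
divergence. -/
lemma ofReal_ratioMean_le {K : Kernel (Fin q) Ω} [IsMarkovKernel K] {m n : Ω → Fin q → ℝ}
    (hm : IsPosterior K m) (hn : Calibrated K n) (hm0 : ∀ ω i, 0 < m ω i) (hn0 : ∀ ω i, 0 < n ω i)
    (hl : ∀ i j, Integrable (fun ω => Real.log (m ω i / n ω i)) (K j)) :
    ENNReal.ofReal (ratioMean K fun i ω => Real.log (m ω i / n ω i)) ≤
      ∫⁻ ω, ENNReal.ofReal (bregman (m ω) (n ω)) ∂(K ∘ₘ unif q) := by
  have hr0 (i ω) : 0 ≤ m ω i / n ω i := (div_pos (hm0 ω i) (hn0 ω i)).le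
  have hr (i) : Measurable fun ω => m ω i / n ω i :=
    (hm.measurable_apply i).div (hn.measurable_apply i)
  have hr1 (i) : ∫⁻ ω, ENNReal.ofReal (m ω i / n ω i) ∂(K ∘ₘ unif q) = 1 := by
    have h1 := lintegral_ofReal_mul_of_calibrated hm hn i
      (h := fun x => ENNReal.ofReal (x i)⁻¹) (by fun_prop)
    have h2 (ω) : ENNReal.ofReal (n ω i) * ENNReal.ofReal (n ω i)⁻¹ = 1 := by
      rw [← ENNReal.ofReal_mul (hn0 ω i).le, mul_inv_cancel₀ (hn0 ω i).ne', ENNReal.ofReal_one]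
    simp only [h2, lintegral_const, measure_univ, mul_one] at h1
    rw [← h1]
    refine lintegral_congr fun ω => ?_
    rw [div_eq_mul_inv, ENNReal.ofReal_mul (hm0 ω i).le]
  have hri (i) : Integrable (fun ω => m ω i / n ω i) (K ∘ₘ unif q) := by
    refine ⟨(hr i).aestronglyMeasurable, ?_⟩
    rw [hasFiniteIntegral_iff_ofReal (ae_of_all _ (hr0 i)), hr1 i]
    exact ENNReal.one_lt_top
  have hri1 (i) : ∫ ω, m ω i / n ω i ∂(K ∘ₘ unif q) = 1 := by
    rw [integral_eq_lintegral_of_nonneg_ae (ae_of_all _ (hr0 i)) (hr i).aestronglyMeasurable, hr1 i]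
    simp
  obtain ⟨h1, h2⟩ := integral_ratio hm hl hri
  simp only [hri1, sub_self, Finset.sum_const_zero, mul_zero, add_zero] at h2
  have heq (ω) : bregman (m ω) (n ω) = ∑ i, (m ω i - (q : ℝ)⁻¹) * Real.log (m ω i / n ω i)
      + (q : ℝ)⁻¹ * ∑ i, (m ω i / n ω i - 1) := by
    have h3 : ∑ i, (n ω i - m ω i) = 0 := by
      rw [Finset.sum_sub_distrib, (hm.mem ω).2, (hn.mem ω).2, sub_self]
    unfold bregman
    simp only [bregmanTerm_eq_log (hm0 ω _) (hn0 ω _), Finset.sum_add_distrib, h3, add_zero,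
      Finset.mul_sum]
  rw [← h2]
  simp only [← heq] at h1 ⊢
  rw [ofReal_integral_eq_lintegral_ofReal h1
    (ae_of_all _ fun ω => bregman_nonneg (hm.mem ω).1 (hn.mem ω).1)]

/-! ### Branching multiplies the potential by the mean offspring -/

lemma lintegral_branchMeasure_sum (ν : Measure ℕ) (μ : Measure Ω) [IsProbabilityMeasure μ]
    {g : Ω → ℝ≥0∞} (hg : Measurable g) :
    ∫⁻ s, ∑ l, g (s.2 l) ∂branchMeasure ν μ = (∫⁻ b, (b : ℝ≥0∞) ∂ν) * ∫⁻ ω, g ω ∂μ := by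
  have hmeas : Measurable fun s : (Σ b : ℕ, Fin b → Ω) => ∑ l, g (s.2 l) :=
    measurable_of_sigma fun b => Finset.measurable_fun_sum Finset.univ
      (f := fun (l : Fin b) (z : Fin b → Ω) => g (z l)) fun l _ => hg.comp (measurable_pi_apply l)
  rw [lintegral_branchMeasure _ _ hmeas, ← lintegral_mul_const _ (measurable_of_countable _)]
  refine lintegral_congr fun b => ?_
  rw [lintegral_finsetSum Finset.univ (f := fun (l : Fin b) (z : Fin b → Ω) => g (z l))
    fun l _ => hg.comp (measurable_pi_apply l)]
  have h (l : Fin b) : ∫⁻ z, g (z l) ∂(Measure.pi fun _ : Fin b => μ) = ∫⁻ ω, g ω ∂μ :=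
    (measurePreserving_eval (fun _ : Fin b => μ) l).lintegral_comp hg
  simp [h]

lemma integral_branchMeasure_sum (ν : Measure ℕ) {d : ℝ≥0} (hν : ∫⁻ b, (b : ℝ≥0∞) ∂ν = d)
    (μ : Measure Ω) [IsProbabilityMeasure μ] {r : Ω → ℝ} (hr : Measurable r) {B : ℝ}
    (hB : ∀ ω, |r ω| ≤ B) :
    Integrable (fun s : (Σ b : ℕ, Fin b → Ω) => ∑ l, r (s.2 l)) (branchMeasure ν μ) ∧
      ∫ s, ∑ l, r (s.2 l) ∂branchMeasure ν μ = d * ∫ ω, r ω ∂μ := by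
  -- for nonnegative functions this is the corresponding statement for lower integrals
  have key {g : Ω → ℝ} (hg : Measurable g) (hg0 : ∀ ω, 0 ≤ g ω) {B : ℝ} (hB : ∀ ω, g ω ≤ B) :
      Integrable (fun s : (Σ b : ℕ, Fin b → Ω) => ∑ l, g (s.2 l)) (branchMeasure ν μ) ∧
      ∫ s, ∑ l, g (s.2 l) ∂branchMeasure ν μ = d * ∫ ω, g ω ∂μ := by
    have hmeas : Measurable fun s : (Σ b : ℕ, Fin b → Ω) => ∑ l, g (s.2 l) :=
      measurable_of_sigma fun b => Finset.measurable_fun_sum Finset.univ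
        (f := fun (l : Fin b) (z : Fin b → Ω) => g (z l)) fun l _ => hg.comp (measurable_pi_apply l)
    have h0 (s : Σ b : ℕ, Fin b → Ω) : 0 ≤ ∑ l, g (s.2 l) := Finset.sum_nonneg fun l _ => hg0 _
    have h1 := lintegral_branchMeasure_sum ν μ hg.ennreal_ofReal
    simp only [← ENNReal.ofReal_sum_of_nonneg fun l _ => hg0 _] at h1
    rw [hν] at h1
    have h2 : ∫⁻ ω, ENNReal.ofReal (g ω) ∂μ < ⊤ := by
      refine (lintegral_mono fun ω => ENNReal.ofReal_le_ofReal (hB ω)).trans_lt ?_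
      simp
    refine ⟨⟨hmeas.aestronglyMeasurable, ?_⟩, ?_⟩
    · rw [hasFiniteIntegral_iff_ofReal (ae_of_all _ h0), h1]
      exact ENNReal.mul_lt_top ENNReal.coe_lt_top h2
    · rw [integral_eq_lintegral_of_nonneg_ae (ae_of_all _ h0) hmeas.aestronglyMeasurable, h1,
        integral_eq_lintegral_of_nonneg_ae (ae_of_all _ hg0) hg.aestronglyMeasurable,
        ENNReal.toReal_mul]
      simp
  -- in general, add the constant `B`
  obtain ⟨i1, e1⟩ := key (g := fun ω => r ω + B) (hr.add_const B)
    (fun ω => by linarith [(abs_le.1 (hB ω)).1]) (B := 2 * B)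
    (fun ω => by linarith [(abs_le.1 (hB ω)).2])
  have hB0 (ω) : 0 ≤ B := (abs_nonneg _).trans (hB ω)
  obtain ⟨i2, e2⟩ := key (g := fun _ => B) measurable_const hB0 (B := B) (fun _ => le_rfl)
  have hsub : (fun s : (Σ b : ℕ, Fin b → Ω) => ∑ l, r (s.2 l)) =
      fun s => ∑ l, (r (s.2 l) + B) - ∑ _l : Fin s.1, B := by
    funext s
    rw [← Finset.sum_sub_distrib]
    simp
  have hri : Integrable r μ := Integrable.of_bound hr.aestronglyMeasurable B (ae_of_all _ hB)
  refine ⟨hsub ▸ i1.sub i2, ?_⟩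
  rw [hsub, integral_sub i1 i2, e1, e2, integral_add hri (integrable_const B)]
  ring

/-- Integration against the average output law of two channels used independently. -/
lemma lintegral_prod_comp_unif {W : Kernel (Fin q) Ω'} [IsMarkovKernel W] {w : Ω' → Fin q → ℝ}
    (hw : IsPosterior W w) {K : Kernel (Fin q) Ω} [IsMarkovKernel K] {m : Ω → Fin q → ℝ}
    (hm : IsPosterior K m) {f : Ω' × Ω → ℝ≥0∞} (hf : Measurable f) :
    ∫⁻ p, f p ∂((W ×ₖ K) ∘ₘ unif q) =
      ∫⁻ a, ∫⁻ ω, ENNReal.ofReal (q * ∑ i, w a i * m ω i) * f (a, ω) ∂(K ∘ₘ unif q)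
        ∂(W ∘ₘ unif q) := by
  have hd (i) : Measurable fun p : Ω' × Ω =>
      ENNReal.ofReal (q * w p.1 i) * ENNReal.ofReal (q * m p.2 i) :=
    (((hw.measurable_apply i).comp measurable_fst).const_mul _).ennreal_ofReal.mul
      (((hm.measurable_apply i).comp measurable_snd).const_mul _).ennreal_ofReal
  have hd' : Measurable fun p : Ω' × Ω => ENNReal.ofReal (q * ∑ i, w p.1 i * m p.2 i) :=
    ((Finset.measurable_fun_sum _ fun i _ => ((hw.measurable_apply i).comp measurable_fst).mul
      ((hm.measurable_apply i).comp measurable_snd)).const_mul _).ennreal_ofReal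
  rw [lintegral_comp_unif]
  simp only [prod_eq_withDensity hw hm, lintegral_withDensity_eq_lintegral_mul _ (hd _) hf,
    Pi.mul_apply]
  rw [← lintegral_finsetSum Finset.univ (f := fun (i : Fin q) (p : Ω' × Ω) =>
    ENNReal.ofReal (q * w p.1 i) * ENNReal.ofReal (q * m p.2 i) * f p) fun i _ => (hd i).mul hf,
    ← lintegral_const_mul _ (f := fun p : Ω' × Ω => ∑ i : Fin q,
      ENNReal.ofReal (q * w p.1 i) * ENNReal.ofReal (q * m p.2 i) * f p)
      (Finset.measurable_fun_sum _ fun i _ => (hd i).mul hf),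
    ← lintegral_prod (fun p : Ω' × Ω => ENNReal.ofReal (q * ∑ i, w p.1 i * m p.2 i) * f p)
      (hd'.mul hf).aemeasurable]
  refine lintegral_congr fun p => ?_
  have hw0 := (hw.mem p.1).1
  have hm0 := (hm.mem p.2).1
  rw [← Finset.sum_mul, ← mul_assoc]
  congr 1
  simp only [ENNReal.ofReal_mul (Nat.cast_nonneg q), ENNReal.ofReal_natCast]
  rw [ENNReal.ofReal_sum_of_nonneg fun i _ => mul_nonneg (hw0 i) (hm0 i), Finset.mul_sum,
    Finset.mul_sum]
  refine Finset.sum_congr rfl fun i _ => ?_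
  rw [ENNReal.ofReal_mul (hw0 i)]
  rw [show (q : ℝ≥0∞) * ENNReal.ofReal (w p.1 i) * (q * ENNReal.ofReal (m p.2 i)) =
    q * (q * (ENNReal.ofReal (w p.1 i) * ENNReal.ofReal (m p.2 i))) by ring,
    ← mul_assoc, ENNReal.inv_mul_cancel (natCast_ne_zero_ennreal q) (ENNReal.natCast_ne_top q),
    one_mul]

/-- The likelihood ratios between the two posteriors, extended to the coordinates which a further
observation with posterior `w` rules out, have mean `1`. -/
lemma lintegral_extended_ratio {W : Kernel (Fin q) Ω'} [IsMarkovKernel W] {w : Ω' → Fin q → ℝ}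
    (hw : IsPosterior W w) {K : Kernel (Fin q) Ω} [IsMarkovKernel K] {m n : Ω → Fin q → ℝ}
    (hm : IsPosterior K m) (hn : Calibrated K n) (hm0 : ∀ ω i, 0 < m ω i)
    (hn0 : ∀ ω i, 0 < n ω i) (i : Fin q) :
    ∫⁻ p, ENNReal.ofReal (m p.2 i / n p.2 i * ((∑ j, w p.1 j * n p.2 j) /
      ∑ j, w p.1 j * m p.2 j)) ∂((W ×ₖ K) ∘ₘ unif q) = 1 := by
  have hq : (0 : ℝ) < q := by exact_mod_cast NeZero.pos q
  have hwi (j) : Measurable fun p : Ω' × Ω => w p.1 j := (hw.measurable_apply j).comp measurable_fst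
  have hmi (j) : Measurable fun p : Ω' × Ω => m p.2 j := (hm.measurable_apply j).comp measurable_snd
  have hni (j) : Measurable fun p : Ω' × Ω => n p.2 j := (hn.measurable_apply j).comp measurable_snd
  have hmeas : Measurable fun p : Ω' × Ω => ENNReal.ofReal (m p.2 i / n p.2 i *
      ((∑ j, w p.1 j * n p.2 j) / ∑ j, w p.1 j * m p.2 j)) :=
    (((hmi i).div (hni i)).mul ((Finset.measurable_fun_sum _ fun j _ => (hwi j).mul (hni j)).div
      (Finset.measurable_fun_sum _ fun j _ => (hwi j).mul (hmi j)))).ennreal_ofReal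
  rw [lintegral_prod_comp_unif hw hm hmeas]
  have hinner (a : Ω') : ∫⁻ ω, ENNReal.ofReal (q * ∑ j, w a j * m ω j) *
      ENNReal.ofReal (m ω i / n ω i * ((∑ j, w a j * n ω j) / ∑ j, w a j * m ω j))
        ∂(K ∘ₘ unif q) = 1 := by
    have hw0 := (hw.mem a).1
    have hpos (ω) : 0 < ∑ j, w a j * m ω j := by
      by_contra hcon
      have h0 : ∑ j, w a j * m ω j = 0 := le_antisymm (not_lt.1 hcon)
        (Finset.sum_nonneg fun j _ => mul_nonneg (hw0 j) (hm0 ω j).le)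
      rw [Finset.sum_eq_zero_iff_of_nonneg fun j _ => mul_nonneg (hw0 j) (hm0 ω j).le] at h0
      have h1 : ∑ j, w a j = 0 := Finset.sum_eq_zero fun j hj =>
        (mul_eq_zero.1 (h0 j hj)).resolve_right (hm0 ω j).ne'
      rw [(hw.mem a).2] at h1
      exact one_ne_zero h1
    calc _ = ∫⁻ ω, ENNReal.ofReal (m ω i) * ENNReal.ofReal (q * (∑ j, w a j * n ω j) * (n ω i)⁻¹)
          ∂(K ∘ₘ unif q) := by
          refine lintegral_congr fun ω => ?_
          rw [← ENNReal.ofReal_mul (mul_nonneg hq.le (hpos ω).le), ← ENNReal.ofReal_mul (hm0 ω i).le]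
          congr 1
          have := (hpos ω).ne'
          field_simp
      _ = ∫⁻ ω, ENNReal.ofReal (n ω i) * ENNReal.ofReal (q * (∑ j, w a j * n ω j) * (n ω i)⁻¹)
          ∂(K ∘ₘ unif q) :=
          lintegral_ofReal_mul_of_calibrated hm hn i (h := fun x =>
            ENNReal.ofReal (q * (∑ j, w a j * x j) * (x i)⁻¹)) (by fun_prop)
      _ = ∫⁻ ω, ∑ j, ENNReal.ofReal (w a j) * ENNReal.ofReal (q * n ω j) ∂(K ∘ₘ unif q) := by
          refine lintegral_congr fun ω => ?_
          rw [← ENNReal.ofReal_mul (hn0 ω i).le]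
          simp only [← ENNReal.ofReal_mul (hw0 _)]
          rw [← ENNReal.ofReal_sum_of_nonneg fun j _ =>
            mul_nonneg (hw0 j) (mul_nonneg hq.le (hn0 ω j).le)]
          congr 1
          have := (hn0 ω i).ne'
          field_simp
          rw [Finset.mul_sum]
          exact Finset.sum_congr rfl fun j _ => by ring
      _ = ∑ j, ENNReal.ofReal (w a j) := by
          rw [lintegral_finsetSum _ fun j _ =>
            ((hn.measurable_apply j).const_mul _).ennreal_ofReal.const_mul _]
          refine Finset.sum_congr rfl fun j _ => ?_
          rw [lintegral_const_mul _ ((hn.measurable_apply j).const_mul _).ennreal_ofReal,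
            hn.lintegral_ofReal j, mul_one]
      _ = 1 := by
          rw [← ENNReal.ofReal_sum_of_nonneg fun j _ => hw0 j, (hw.mem a).2, ENNReal.ofReal_one]
  simp only [hinner, lintegral_const, measure_univ, mul_one]

/-- After a further observation, with posterior `w`, the Bregman divergence is still bounded by the
log likelihood ratios before it and a correction, which has mean zero by
`lintegral_extended_ratio`. In the coordinates where `w` does not vanish this is an equality; the
others use `log x ≤ x - 1`. -/
lemma bregman_normalize_mul_le {w a b l : Fin q → ℝ} {c : ℝ} (hw : w ∈ stdSimplex ℝ (Fin q))
    (ha : ∀ i, 0 < a i) (hb : ∀ i, 0 < b i) (hl : ∀ i, l i = Real.log (a i / b i) + c) :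
    bregman (normalize fun i => w i * a i) (normalize fun i => w i * b i) ≤
      ∑ i, ((normalize fun i => w i * a i) i - (q : ℝ)⁻¹) * l i +
        (q : ℝ)⁻¹ * ∑ i, (a i / b i * ((∑ j, w j * b j) / ∑ j, w j * a j) - 1) := by
  have hq : (0 : ℝ) < q := by exact_mod_cast NeZero.pos q
  have hpos {x : Fin q → ℝ} (hx : ∀ i, 0 < x i) : 0 < ∑ j, w j * x j := by
    obtain ⟨i, hi⟩ : ∃ i, 0 < w i := by
      by_contra! hcon
      have : ∑ i, w i ≤ 0 := Finset.sum_nonpos fun i _ => hcon i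
      rw [hw.2] at this
      linarith
    exact Finset.sum_pos' (fun j _ => mul_nonneg (hw.1 j) (hx j).le)
      ⟨i, Finset.mem_univ i, mul_pos hi (hx i)⟩
  have hA := hpos ha
  have hB := hpos hb
  set A := ∑ j, w j * a j
  set B := ∑ j, w j * b j
  have hM (i) : (normalize fun i => w i * a i) i = w i * a i / A :=
    normalize_of_sum_ne_zero hA.ne' i
  have hN (i) : (normalize fun i => w i * b i) i = w i * b i / B :=
    normalize_of_sum_ne_zero hB.ne' i
  have hMmem : (normalize fun i => w i * a i) ∈ stdSimplex ℝ (Fin q) :=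
    normalize_mem fun i => mul_nonneg (hw.1 i) (ha i).le
  have hNmem : (normalize fun i => w i * b i) ∈ stdSimplex ℝ (Fin q) :=
    normalize_mem fun i => mul_nonneg (hw.1 i) (hb i).le
  set M := normalize fun i => w i * a i
  set N := normalize fun i => w i * b i
  have hρ (i) : 0 < a i / b i * (B / A) := by
    have := ha i; have := hb i; positivity
  have term (i) : bregmanTerm q (M i) (N i) ≤ (M i - (q : ℝ)⁻¹) * Real.log (a i / b i * (B / A))
      + (N i - M i) + (q : ℝ)⁻¹ * (a i / b i * (B / A) - 1) := by
    rcases (hw.1 i).eq_or_lt with h | h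
    · have h1 : M i = 0 := by rw [hM, ← h]; simp
      have h2 : N i = 0 := by rw [hN, ← h]; simp
      rw [h1, h2, bregmanTerm_self]
      have h3 := Real.log_le_sub_one_of_pos (hρ i)
      have h4 := mul_nonneg (inv_nonneg.2 hq.le) (sub_nonneg.2 h3)
      linarith
    · have hai := ha i
      have hbi := hb i
      have h1 : 0 < M i := by rw [hM]; positivity
      have h2 : 0 < N i := by rw [hN]; positivity
      have h3 : M i / N i = a i / b i * (B / A) := by
        rw [hM, hN]; field_simp
      rw [bregmanTerm_eq_log h1 h2, h3]
  refine (Finset.sum_le_sum fun i _ => term i).trans (le_of_eq ?_)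
  rw [Finset.sum_add_distrib, Finset.sum_add_distrib, Finset.mul_sum]
  congr 1
  have h1 : ∑ i, (N i - M i) = 0 := by
    rw [Finset.sum_sub_distrib, hMmem.2, hNmem.2, sub_self]
  have h2 : ∑ i, (M i - (q : ℝ)⁻¹) = 0 := by
    rw [Finset.sum_sub_distrib, hMmem.2]
    simp
  have h3 (i) : (M i - (q : ℝ)⁻¹) * Real.log (a i / b i * (B / A)) =
      (M i - (q : ℝ)⁻¹) * l i + (M i - (q : ℝ)⁻¹) * (Real.log (B / A) - c) := by
    rw [hl i, Real.log_mul (div_pos (ha i) (hb i)).ne' (div_pos hB hA).ne']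
    ring
  rw [h1, add_zero]
  simp only [h3]
  rw [Finset.sum_add_distrib, ← Finset.sum_mul, h2, zero_mul, add_zero]

/-- Branching with mean offspring `d`, followed by a further observation, multiplies the expected
Bregman divergence by at most `d`: the log likelihood ratio between the two posteriors is, up to a
constant, the sum of those of the branches. -/
theorem lintegral_bregman_branch_le {W : Kernel (Fin q) Ω'} [IsMarkovKernel W]
    {w : Ω' → Fin q → ℝ} (hw : IsPosterior W w) {K : Kernel (Fin q) Ω} [IsMarkovKernel K]
    {m n : Ω → Fin q → ℝ} (hm : IsPosterior K m) (hn : Calibrated K n) {c : ℝ} (hc : 0 < c)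
    (hmc : ∀ ω i, c ≤ m ω i) (hnc : ∀ ω i, c ≤ n ω i) (ν : Measure ℕ) [IsProbabilityMeasure ν]
    {d : ℝ≥0} (hν : ∫⁻ b, (b : ℝ≥0∞) ∂ν = d) :
    ∫⁻ p, ENNReal.ofReal (bregman (normalize fun i => w p.1 i * starPosterior m p.2 i)
        (normalize fun i => w p.1 i * starPosterior n p.2 i)) ∂((W ×ₖ branch ν K) ∘ₘ unif q) ≤
      d * ∫⁻ ω, ENNReal.ofReal (bregman (m ω) (n ω)) ∂(K ∘ₘ unif q) := by
  have hm0 (ω i) : 0 < m ω i := hc.trans_le (hmc ω i)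
  have hn0 (ω i) : 0 < n ω i := hc.trans_le (hnc ω i)
  have hm1 (ω i) : m ω i ≤ 1 := le_one_of_mem_stdSimplex (hm.mem ω) i
  have hn1 (ω i) : n ω i ≤ 1 := le_one_of_mem_stdSimplex (hn.mem ω) i
  set r : Fin q → Ω → ℝ := fun i ω => Real.log (m ω i / n ω i) with hr
  have hrmeas (i) : Measurable (r i) :=
    ((hm.measurable_apply i).div (hn.measurable_apply i)).log
  have hrB (i ω) : |r i ω| ≤ -Real.log c := by
    have h1 : Real.log c ≤ Real.log (m ω i) := Real.log_le_log hc (hmc ω i)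
    have h2 : Real.log c ≤ Real.log (n ω i) := Real.log_le_log hc (hnc ω i)
    have h3 : Real.log (m ω i) ≤ 0 := Real.log_nonpos (hm0 ω i).le (hm1 ω i)
    have h4 : Real.log (n ω i) ≤ 0 := Real.log_nonpos (hn0 ω i).le (hn1 ω i)
    simp only [hr]
    rw [Real.log_div (hm0 ω i).ne' (hn0 ω i).ne', abs_le]
    constructor <;> linarith
  have hbr (i j : Fin q) := integral_branchMeasure_sum ν hν (K j) (hrmeas i) (hrB i)
  set l : Fin q → Ω' × (Σ b : ℕ, Fin b → Ω) → ℝ := fun i p => ∑ k, r i (p.2.2 k) with hl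
  have hlint (i j) : Integrable (l i) ((W ×ₖ branch ν K) j) := by
    rw [Kernel.prod_apply]
    exact Integrable.comp_snd (ν := branch ν K j) (hbr i j).1 (W j)
  have hlval (i j) : ∫ p, l i p ∂((W ×ₖ branch ν K) j) = d * ∫ ω, r i ω ∂K j := by
    rw [Kernel.prod_apply, ← (hbr i j).2, ← branch_apply]
    have := integral_fun_snd (μ := W j) (ν := branch ν K j) fun s => ∑ k, r i (s.2 k)
    simpa using this
  have hbm := hm.branch ν
  have hbn := hn.branch ν
  have hprod := hw.prod hbm
  have hle := lintegral_le_ratioMean hprod (l := l)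
    (r := fun i p => starPosterior m p.2 i / starPosterior n p.2 i *
      ((∑ j, w p.1 j * starPosterior n p.2 j) / ∑ j, w p.1 j * starPosterior m p.2 j))
    (F := fun p => bregman (normalize fun i => w p.1 i * starPosterior m p.2 i)
        (normalize fun i => w p.1 i * starPosterior n p.2 i))
    hlint ?_ ?_ ?_ ?_ ?_
  · refine hle.trans ?_
    have h1 : ratioMean (W ×ₖ branch ν K) l = d * ratioMean K r := by
      unfold ratioMean
      simp only [hlval, ← Finset.mul_sum, Finset.sum_sub_distrib]
      ring
    rw [h1, ENNReal.ofReal_mul d.coe_nonneg, ENNReal.ofReal_coe_nnreal]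
    gcongr
    exact ofReal_ratioMean_le hm hn hm0 hn0 fun i j =>
      Integrable.of_bound (hrmeas i).aestronglyMeasurable _ (ae_of_all _ (hrB i))
  · intro i
    have hwi (j) : Measurable fun p : Ω' × (Σ b : ℕ, Fin b → Ω) => w p.1 j :=
      (hw.measurable_apply j).comp measurable_fst
    have hmi (j) : Measurable fun p : Ω' × (Σ b : ℕ, Fin b → Ω) => starPosterior m p.2 j :=
      (hbm.measurable_apply j).comp measurable_snd
    have hni (j) : Measurable fun p : Ω' × (Σ b : ℕ, Fin b → Ω) => starPosterior n p.2 j :=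
      (hbn.measurable_apply j).comp measurable_snd
    exact ((hmi i).div (hni i)).mul ((Finset.measurable_fun_sum _ fun j _ => (hwi j).mul (hni j)).div
      (Finset.measurable_fun_sum _ fun j _ => (hwi j).mul (hmi j)))
  · intro i p
    have h1 (j) := (starPosterior_pos hm0 p.2 j).le
    have h2 (j) := (starPosterior_pos hn0 p.2 j).le
    have h3 := (hw.mem p.1).1
    exact mul_nonneg (div_nonneg (h1 i) (h2 i)) (div_nonneg
      (Finset.sum_nonneg fun j _ => mul_nonneg (h3 j) (h2 j))
      (Finset.sum_nonneg fun j _ => mul_nonneg (h3 j) (h1 j)))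
  · exact lintegral_extended_ratio hw hbm hbn (starPosterior_pos hm0) (starPosterior_pos hn0)
  · intro p
    exact bregman_nonneg (normalize_mem fun i => mul_nonneg ((hw.mem p.1).1 i) ((hbm.mem p.2).1 i)).1
      (normalize_mem fun i => mul_nonneg ((hw.mem p.1).1 i) ((hbn.mem p.2).1 i)).1
  · intro p
    have hmp (j) : 0 < ∏ k, m (p.2.2 k) j := Finset.prod_pos fun k _ => hm0 _ j
    have hnp (j) : 0 < ∏ k, n (p.2.2 k) j := Finset.prod_pos fun k _ => hn0 _ j
    have hne : (Finset.univ : Finset (Fin q)).Nonempty := Finset.univ_nonempty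
    have hms : 0 < ∑ j, ∏ k, m (p.2.2 k) j := Finset.sum_pos (fun j _ => hmp j) hne
    have hns : 0 < ∑ j, ∏ k, n (p.2.2 k) j := Finset.sum_pos (fun j _ => hnp j) hne
    refine bregman_normalize_mul_le (c := Real.log
      ((∑ j, ∏ k, m (p.2.2 k) j) / ∑ j, ∏ k, n (p.2.2 k) j)) (hw.mem p.1)
      (starPosterior_pos hm0 p.2) (starPosterior_pos hn0 p.2) fun i => ?_
    unfold starPosterior
    rw [normalize_of_sum_ne_zero hms.ne', normalize_of_sum_ne_zero hns.ne',
      ← Real.log_mul (div_pos (div_pos (hmp i) hms) (div_pos (hnp i) hns)).ne'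
        (div_pos hms hns).ne']
    have h1 : (∏ k, m (p.2.2 k) i) / (∑ j, ∏ k, m (p.2.2 k) j) /
        ((∏ k, n (p.2.2 k) i) / ∑ j, ∏ k, n (p.2.2 k) j) *
        ((∑ j, ∏ k, m (p.2.2 k) j) / ∑ j, ∏ k, n (p.2.2 k) j) =
        ∏ k, (m (p.2.2 k) i / n (p.2.2 k) i) := by
      rw [Finset.prod_div_distrib]
      have := (hnp i).ne'
      field_simp
    rw [h1, Real.log_prod fun k _ => (div_pos (hm0 _ i) (hn0 _ i)).ne']

end Additivity

/-! ### Mean offspring -/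

lemma lintegral_poissonMeasure_natCast (d : ℝ≥0) :
    ∫⁻ b, (b : ℝ≥0∞) ∂(poissonMeasure d) = d := by
  have h0 (n : ℕ) : 0 ≤ Real.exp (-d) * (d : ℝ) ^ n / n.factorial := by positivity
  have h1 : ∑' n : ℕ, ENNReal.ofReal (Real.exp (-d) * (d : ℝ) ^ n / n.factorial) = 1 := by
    rw [← ENNReal.ofReal_tsum_of_nonneg h0 (hasSum_one_poissonMeasure d).summable,
      (hasSum_one_poissonMeasure d).tsum_eq, ENNReal.ofReal_one]
  have h2 (n : ℕ) : ENNReal.ofReal (Real.exp (-d) * (d : ℝ) ^ (n + 1) / (n + 1).factorial) *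
      ((n + 1 : ℕ) : ℝ≥0∞) = d * ENNReal.ofReal (Real.exp (-d) * (d : ℝ) ^ n / n.factorial) := by
    rw [← ENNReal.ofReal_natCast, ← ENNReal.ofReal_coe_nnreal, ← ENNReal.ofReal_mul (h0 _),
      ← ENNReal.ofReal_mul d.coe_nonneg]
    congr 1
    rw [Nat.factorial_succ]
    push_cast
    field_simp
    ring
  rw [poissonMeasure, lintegral_sum_measure]
  simp only [lintegral_smul_measure, lintegral_dirac, smul_eq_mul]
  rw [tsum_eq_zero_add' ENNReal.summable]
  simp only [h2, ENNReal.tsum_mul_left, h1]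
  simp

lemma IsOffspringLaw.lintegral_eq {d : ℝ≥0} {ν : Measure ℕ} (h : IsOffspringLaw d ν) :
    ∫⁻ b, (b : ℝ≥0∞) ∂ν = d := by
  rcases h with ⟨n, rfl, rfl⟩ | rfl
  · simp
  · exact lintegral_poissonMeasure_natCast d

/-! ### Contraction along the tree -/

section Contraction

variable {q : ℕ} [NeZero q] {Ω Ω' : Type*} [MeasurableSpace Ω] [MeasurableSpace Ω']

/-- The posteriors `m` and `n` of a channel are `k` levels of the tree apart from being arbitrary.
For non-extreme `λ` their expected divergence after the Potts channel is of order `θ ^ k`, and the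
divergence before it has already contracted `k - 1` times; for `d < 1` they agree up to probability
`d ^ k`, for every input. -/
def IsSmall (lam : Param q) (d : ℝ≥0) (B θ : ℝ≥0∞) (k : ℕ) (K : Kernel (Fin q) Ω)
    (m n : Ω → Fin q → ℝ) : Prop :=
  (-(1 / ((q : ℝ) - 1)) < (lam : ℝ) ∧ (lam : ℝ) < 1 ∧
    ∫⁻ ω, ENNReal.ofReal (bregman (pottsMap lam (m ω)) (pottsMap lam (n ω))) ∂(K ∘ₘ unif q) ≤
      B * θ ^ k ∧
    ∀ j, k = j + 1 → ∫⁻ ω, ENNReal.ofReal (kl (m ω) (n ω)) ∂(K ∘ₘ unif q) ≤ d * (B * θ ^ j)) ∨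
  (d < 1 ∧ ∀ i, K i {ω | m ω ≠ n ω} ≤ (d : ℝ≥0∞) ^ k)

/-- Two posteriors are never more than a constant apart, after the Potts channel. -/
lemma exists_isSmall_zero (hq : 2 ≤ q) (lam : Param q) (d : ℝ≥0)
    (h : d < 1 ∨ (-(1 / ((q : ℝ) - 1)) < (lam : ℝ) ∧ (lam : ℝ) < 1)) (θ : ℝ≥0∞) :
    ∃ B : ℝ≥0∞, B ≠ ⊤ ∧ ∀ {Ω : Type u} [MeasurableSpace Ω] (K : Kernel (Fin q) Ω)
      [IsMarkovKernel K] (m n : Ω → Fin q → ℝ), (∀ ω, m ω ∈ stdSimplex ℝ (Fin q)) →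
      (∀ ω, n ω ∈ stdSimplex ℝ (Fin q)) → IsSmall lam d B θ 0 K m n := by
  rcases h with h | ⟨h1, h2⟩
  · refine ⟨0, ENNReal.zero_ne_top, fun K _ m n _ _ => Or.inr ⟨h, fun i => ?_⟩⟩
    rw [pow_zero]
    exact prob_le_one
  · obtain ⟨c, hc0, hc⟩ := exists_le_pottsMap hq h1 h2
    refine ⟨ENNReal.ofReal (q * (c⁻¹ + c⁻¹ ^ 2)), ENNReal.ofReal_ne_top, fun K _ m n hm hn =>
      Or.inl ⟨h1, h2, ?_, fun j hj => by omega⟩⟩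
    have hle (ω) : ENNReal.ofReal (bregman (pottsMap lam (m ω)) (pottsMap lam (n ω))) ≤
        ENNReal.ofReal (q * (c⁻¹ + c⁻¹ ^ 2)) := by
      refine ENNReal.ofReal_le_ofReal ?_
      unfold bregman
      refine (Finset.sum_le_sum fun i _ => bregmanTerm_le hc0 (hc _ (hm ω) i) (hc _ (hn ω) i)
        (le_one_of_mem_stdSimplex (pottsMap_mem_stdSimplex lam (hm ω)) i)
        (le_one_of_mem_stdSimplex (pottsMap_mem_stdSimplex lam (hn ω)) i)).trans (le_of_eq ?_)
      rw [Finset.sum_const, Finset.card_univ, Fintype.card_fin, nsmul_eq_mul]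
    rw [pow_zero, mul_one]
    refine (lintegral_mono hle).trans ?_
    simp

/-- The posterior of the root given the observation of the root and those in its `b` subtrees. -/
noncomputable def treePosterior (lam : Param q) (w : Ω' → Fin q → ℝ) (m : Ω → Fin q → ℝ)
    (p : Ω' × (Σ b : ℕ, Fin b → Ω)) : Fin q → ℝ :=
  normalize fun i => w p.1 i * starPosterior (fun ω => pottsMap lam (m ω)) p.2 i

lemma IsPosterior.tree {W : Kernel (Fin q) Ω'} [IsMarkovKernel W] {w : Ω' → Fin q → ℝ}
    (hw : IsPosterior W w) {K : Kernel (Fin q) Ω} [IsMarkovKernel K] {m : Ω → Fin q → ℝ}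
    (hm : IsPosterior K m) (lam : Param q) (ν : Measure ℕ) [IsProbabilityMeasure ν] :
    IsPosterior (W ×ₖ Potts.branch ν (K ∘ₖ pottsKernel q lam)) (treePosterior lam w m) :=
  hw.prod ((hm.comp_potts lam).branch ν)

lemma measure_comp_potts_le (K : Kernel (Fin q) Ω) (lam : Param q) {s : Set Ω} {a : ℝ≥0∞}
    (hs : MeasurableSet s) (h : ∀ i, K i s ≤ a) (i : Fin q) :
    (K ∘ₖ pottsKernel q lam) i s ≤ a := by
  rw [Kernel.comp_apply' _ _ _ hs]
  refine (lintegral_mono h).trans ?_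
  simp

/-- One level of the tree. For non-extreme `λ` the divergence is multiplied by at most `d` in the
branching and by at most `λ ^ 2 * C^L` in the Potts channel. The event that two posteriors differ
needs some branch on which they differ. -/
lemma IsSmall.step (hq : 2 ≤ q) {lam : Param q} {d : ℝ≥0} {B θ : ℝ≥0∞} {k : ℕ}
    {K : Kernel (Fin q) Ω} [IsMarkovKernel K] {m n : Ω → Fin q → ℝ} (hm : IsPosterior K m)
    (hn : Calibrated K n) (h : IsSmall lam d B θ k K m n)
    (hθ : ENNReal.ofReal ((d : ℝ) * (lam : ℝ) ^ 2) * CL q lam ≤ θ)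
    {W : Kernel (Fin q) Ω'} [IsMarkovKernel W] {w : Ω' → Fin q → ℝ} (hw : IsPosterior W w)
    {ν : Measure ℕ} [IsProbabilityMeasure ν] (hν : ∫⁻ b, (b : ℝ≥0∞) ∂ν = d) :
    IsSmall lam d B θ (k + 1) (W ×ₖ branch ν (K ∘ₖ pottsKernel q lam))
      (treePosterior lam w m) (treePosterior lam w n) := by
  have hmemstar {x : Ω → Fin q → ℝ} (hx : ∀ ω, x ω ∈ stdSimplex ℝ (Fin q))
      (s : Σ b : ℕ, Fin b → Ω) (i) : 0 ≤ starPosterior (fun ω => pottsMap lam (x ω)) s i :=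
    (normalize_mem fun i => Finset.prod_nonneg fun l _ =>
      (pottsMap_mem_stdSimplex lam (hx _)).1 i).1 i
  have hmem {x : Ω → Fin q → ℝ} (hx : ∀ ω, x ω ∈ stdSimplex ℝ (Fin q)) (p) :
      treePosterior lam w x p ∈ stdSimplex ℝ (Fin q) :=
    normalize_mem fun i => mul_nonneg ((hw.mem p.1).1 i) (hmemstar hx p.2 i)
  rcases h with ⟨h1, h2, h3, -⟩ | ⟨hd, h⟩
  · obtain ⟨c, hc0, hc⟩ := exists_le_pottsMap hq h1 h2
    have hbr := lintegral_bregman_branch_le hw (hm.comp_potts lam) (hn.comp_potts lam) hc0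
      (fun ω => hc _ (hm.mem ω)) (fun ω => hc _ (hn.mem ω)) ν hν
    rw [comp_potts_comp_unif] at hbr
    have hbr' := hbr.trans (mul_le_mul_right h3 (d : ℝ≥0∞))
    refine Or.inl ⟨h1, h2, ?_, fun j hj => ?_⟩
    · have hpos {x : Ω → Fin q → ℝ} (hx : ∀ ω, x ω ∈ stdSimplex ℝ (Fin q))
          (p : Ω' × (Σ b : ℕ, Fin b → Ω)) (i : Fin q) :
          treePosterior lam w x p i = 0 ↔ w p.1 i = 0 := by
        have hs (j) : 0 < starPosterior (fun ω => pottsMap lam (x ω)) p.2 j :=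
          starPosterior_pos (fun ω i => hc0.trans_le (hc _ (hx ω) i)) p.2 j
        have hsum : ∑ j, w p.1 j * starPosterior (fun ω => pottsMap lam (x ω)) p.2 j ≠ 0 := by
          intro h0
          rw [Finset.sum_eq_zero_iff_of_nonneg fun j _ =>
            mul_nonneg ((hw.mem p.1).1 j) (hs j).le] at h0
          have h4 : ∑ j, w p.1 j = 0 := Finset.sum_eq_zero fun j hj =>
            (mul_eq_zero.1 (h0 j hj)).resolve_right (hs j).ne'
          rw [(hw.mem p.1).2] at h4
          exact one_ne_zero h4
        unfold treePosterior
        rw [normalize_of_sum_ne_zero hsum, div_eq_zero_iff, mul_eq_zero]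
        simp [hsum, (hs i).ne']
      have hle (p) : ENNReal.ofReal (bregman (pottsMap lam (treePosterior lam w m p))
          (pottsMap lam (treePosterior lam w n p))) ≤
          ENNReal.ofReal ((lam : ℝ) ^ 2 * (CL q lam).toReal) *
            ENNReal.ofReal (bregman (treePosterior lam w m p) (treePosterior lam w n p)) := by
        rw [← ENNReal.ofReal_mul (by positivity)]
        exact ENNReal.ofReal_le_ofReal (bregman_pottsMap_le hq lam h1 h2 (hmem hm.mem p)
          (hmem hn.mem p) fun i => (hpos hm.mem p i).trans (hpos hn.mem p i).symm)
      refine (lintegral_mono hle).trans ?_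
      rw [lintegral_const_mul' _ _ ENNReal.ofReal_ne_top]
      refine (mul_le_mul_right hbr' _).trans ?_
      have htop : CL q lam ≠ ⊤ :=
        ((CL_le_sq hq lam).trans_lt (ENNReal.pow_lt_top (ENNReal.natCast_lt_top q))).ne
      have hθ' : ENNReal.ofReal ((lam : ℝ) ^ 2 * (CL q lam).toReal) * d ≤ θ := by
        rw [ENNReal.ofReal_mul (sq_nonneg _), ENNReal.ofReal_toReal htop]
        rw [ENNReal.ofReal_mul d.coe_nonneg, ENNReal.ofReal_coe_nnreal] at hθ
        refine le_trans (le_of_eq ?_) hθ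
        ring
      calc _ = (ENNReal.ofReal ((lam : ℝ) ^ 2 * (CL q lam).toReal) * d) * (B * θ ^ k) := by ring
        _ ≤ θ * (B * θ ^ k) := by gcongr
        _ = B * θ ^ (k + 1) := by ring
    · obtain rfl : k = j := by omega
      refine le_trans (lintegral_mono fun p => ENNReal.ofReal_le_ofReal ?_) hbr'
      exact kl_le_bregman (hmem hm.mem p).1 (hmem hn.mem p).1
  · refine Or.inr ⟨hd, fun i => ?_⟩
    have hset : MeasurableSet {ω | m ω ≠ n ω} :=
      (measurableSet_eq_fun hm.measurable hn.measurable).compl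
    have hnt : Measurable (treePosterior lam w n) := by
      have h1 := ((hn.comp_potts lam).branch ν).measurable
      refine measurable_normalize.comp (measurable_pi_lambda _ fun i => ?_)
      exact ((hw.measurable_apply i).comp measurable_fst).mul
        ((measurable_pi_apply i).comp (h1.comp measurable_snd))
    have hset' : MeasurableSet {p | treePosterior lam w m p ≠ treePosterior lam w n p} :=
      (measurableSet_eq_fun (hw.tree hm lam ν).measurable hnt).compl
    have hg : Measurable ({ω | m ω ≠ n ω}.indicator (1 : Ω → ℝ≥0∞)) := measurable_one.indicator hset
    have hgs : Measurable fun s : (Σ b : ℕ, Fin b → Ω) =>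
        ∑ l, {ω | m ω ≠ n ω}.indicator (1 : Ω → ℝ≥0∞) (s.2 l) :=
      measurable_of_sigma fun b => Finset.measurable_fun_sum Finset.univ
        (f := fun (l : Fin b) (z : Fin b → Ω) => {ω | m ω ≠ n ω}.indicator (1 : Ω → ℝ≥0∞) (z l))
        fun l _ => hg.comp (measurable_pi_apply l)
    have hle (p : Ω' × (Σ b : ℕ, Fin b → Ω)) :
        {p | treePosterior lam w m p ≠ treePosterior lam w n p}.indicator
            (1 : Ω' × (Σ b : ℕ, Fin b → Ω) → ℝ≥0∞) p ≤
          ∑ l, {ω | m ω ≠ n ω}.indicator (1 : Ω → ℝ≥0∞) (p.2.2 l) := by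
      by_cases hp : ∀ l, m (p.2.2 l) = n (p.2.2 l)
      · have : treePosterior lam w m p = treePosterior lam w n p := by
          unfold treePosterior starPosterior
          simp only [hp]
        rw [Set.indicator_of_notMem (by simpa using this)]
        exact zero_le
      · push Not at hp
        obtain ⟨l, hl⟩ := hp
        refine (Set.indicator_le_self' (fun _ _ => zero_le) p).trans ?_
        refine le_trans (le_of_eq ?_) (Finset.single_le_sum (fun _ _ => zero_le)
          (Finset.mem_univ l))
        rw [Set.indicator_of_mem (by exact hl)]
        rfl
    rw [← lintegral_indicator_one hset']
    refine (lintegral_mono hle).trans ?_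
    rw [Kernel.prod_apply, lintegral_prod (fun p : Ω' × (Σ b : ℕ, Fin b → Ω) =>
      ∑ l, {ω | m ω ≠ n ω}.indicator (1 : Ω → ℝ≥0∞) (p.2.2 l))
      (hgs.comp measurable_snd).aemeasurable]
    change ∫⁻ _, ∫⁻ s, ∑ l, {ω | m ω ≠ n ω}.indicator (1 : Ω → ℝ≥0∞) (s.2 l)
      ∂branchMeasure ν ((K ∘ₖ pottsKernel q lam) i) ∂W i ≤ _
    rw [lintegral_branchMeasure_sum ν _ hg, lintegral_const, measure_univ, mul_one, hν,
      lintegral_indicator_one hset, pow_succ']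
    gcongr
    exact measure_comp_potts_le K lam hset h i

lemma mul_log_sq_le {x : ℝ} (h0 : 0 ≤ x) (h1 : x ≤ 1) : x * Real.log x ^ 2 ≤ 4 := by
  rcases h0.eq_or_lt with h | h
  · simp [← h]
  have hs : 0 < √x := Real.sqrt_pos.2 h
  have hs1 : √x ≤ 1 := Real.sqrt_le_one.2 h1
  have h2 : Real.log x = 2 * Real.log √x := by rw [Real.log_sqrt h0]; ring
  have h3 : Real.log √x ≤ 0 := Real.log_nonpos hs.le hs1
  have h4 : -(√x * Real.log √x) ≤ 1 := by
    have := Real.log_le_sub_one_of_pos (inv_pos.2 hs)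
    rw [Real.log_inv] at this
    have h5 := mul_le_mul_of_nonneg_left this hs.le
    rw [mul_sub, mul_inv_cancel₀ hs.ne'] at h5
    linarith
  have h6 : 0 ≤ -(√x * Real.log √x) := by
    have := mul_nonneg hs.le (neg_nonneg.2 h3)
    linarith
  calc x * Real.log x ^ 2 = 4 * (-(√x * Real.log √x)) ^ 2 := by
        rw [h2]
        nth_rw 1 [← Real.sq_sqrt h0]
        ring
    _ ≤ 4 * 1 := by gcongr; nlinarith
    _ = 4 := mul_one 4

lemma mul_klFun_div_le {a b e : ℝ} (ha0 : 0 ≤ a) (ha1 : a ≤ 1) (hb0 : 0 ≤ b) (hb1 : b ≤ 1)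
    (he : 0 < e) : b * klFun (a / b) ≤ (1 + (4 * e)⁻¹) + a * (e * Real.log b ^ 2) := by
  have h0 : 0 ≤ a * (e * Real.log b ^ 2) := by positivity
  have h00 : 0 ≤ (4 * e)⁻¹ := by positivity
  rcases hb0.eq_or_lt with h | hb
  · rw [← h]; simp; positivity
  have h1 : b * klFun (a / b) = a * Real.log (a / b) + b - a := by
    rw [klFun_apply]; field_simp
  have h2 : a * Real.log (a / b) ≤ a * -Real.log b := by
    rcases ha0.eq_or_lt with h | ha
    · simp [← h]
    · gcongr
      rw [Real.log_div ha.ne' hb.ne']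
      linarith [Real.log_nonpos ha0 ha1]
  have h3 : -Real.log b ≤ (4 * e)⁻¹ + e * Real.log b ^ 2 := by
    have h4 : (4 * e)⁻¹ + e * Real.log b ^ 2 + Real.log b =
        (4 * e)⁻¹ * (1 + 2 * e * Real.log b) ^ 2 := by field_simp; ring
    have : 0 ≤ (4 * e)⁻¹ * (1 + 2 * e * Real.log b) ^ 2 := by positivity
    linarith
  have h5 := mul_le_mul_of_nonneg_left h3 ha0
  have h6 : a * (4 * e)⁻¹ ≤ 1 * (4 * e)⁻¹ := by gcongr
  rw [mul_add] at h5
  linarith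

/-- If two posteriors differ with small probability then their expected Kullback-Leibler divergence
is small, although the divergence itself is unbounded: `mᵢ log² nᵢ` has the same expectation as
`nᵢ log² nᵢ`. -/
lemma lintegral_kl_le_of_measure_le {K : Kernel (Fin q) Ω} [IsMarkovKernel K]
    {m n : Ω → Fin q → ℝ} (hm : IsPosterior K m) (hn : Calibrated K n) {s : ℝ≥0∞}
    (hs : ∀ i, K i {ω | m ω ≠ n ω} ≤ s) {e : ℝ} (he : 0 < e) :
    ∫⁻ ω, ENNReal.ofReal (kl (m ω) (n ω)) ∂(K ∘ₘ unif q) ≤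
      q * (ENNReal.ofReal (1 + (4 * e)⁻¹) * s) + q * ENNReal.ofReal (4 * e) := by
  have hset : MeasurableSet {ω | m ω ≠ n ω} :=
    (measurableSet_eq_fun hm.measurable hn.measurable).compl
  have havg : (K ∘ₘ unif q) {ω | m ω ≠ n ω} ≤ s := by
    rw [Measure.bind_apply hset K.aemeasurable]
    refine (lintegral_mono hs).trans ?_
    simp
  have hle (ω) : ENNReal.ofReal (kl (m ω) (n ω)) ≤ ∑ i,
      ({ω | m ω ≠ n ω}.indicator (fun _ => ENNReal.ofReal (1 + (4 * e)⁻¹)) ω +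
        ENNReal.ofReal (m ω i) * ENNReal.ofReal (e * Real.log (n ω i) ^ 2)) := by
    have hm0 := (hm.mem ω).1
    have hn0 := (hn.mem ω).1
    by_cases h : m ω = n ω
    · have : kl (m ω) (n ω) = 0 := by
        unfold kl
        refine Finset.sum_eq_zero fun i _ => ?_
        rw [h]
        by_cases hi : n ω i = 0
        · simp [hi]
        · simp [div_self hi, klFun_one]
      simp [this]
    · rw [Set.indicator_of_mem (by exact h)]
      unfold kl
      rw [ENNReal.ofReal_sum_of_nonneg fun i _ =>
        mul_nonneg (hn0 i) (klFun_nonneg (div_nonneg (hm0 i) (hn0 i)))]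
      refine Finset.sum_le_sum fun i _ => ?_
      rw [← ENNReal.ofReal_mul (hm0 i),
        ← ENNReal.ofReal_add (by positivity) (mul_nonneg (hm0 i) (by positivity))]
      exact ENNReal.ofReal_le_ofReal (mul_klFun_div_le (hm0 i)
        (le_one_of_mem_stdSimplex (hm.mem ω) i) (hn0 i) (le_one_of_mem_stdSimplex (hn.mem ω) i) he)
  have hlog (i : Fin q) : Measurable fun x : Fin q → ℝ => ENNReal.ofReal (e * Real.log (x i) ^ 2) :=
    (((measurable_pi_apply i).log.pow_const 2).const_mul e).ennreal_ofReal
  have hmeas (i : Fin q) : Measurable fun ω => ENNReal.ofReal (m ω i) *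
      ENNReal.ofReal (e * Real.log (n ω i) ^ 2) :=
    (hm.measurable_apply i).ennreal_ofReal.mul ((hlog i).comp hn.measurable)
  refine (lintegral_mono hle).trans ?_
  rw [lintegral_finsetSum Finset.univ (f := fun (i : Fin q) ω =>
    {ω | m ω ≠ n ω}.indicator (fun _ => ENNReal.ofReal (1 + (4 * e)⁻¹)) ω +
      ENNReal.ofReal (m ω i) * ENNReal.ofReal (e * Real.log (n ω i) ^ 2))
    fun i _ => (measurable_const.indicator hset).add (hmeas i)]
  have hi (i : Fin q) : ∫⁻ ω, ({ω | m ω ≠ n ω}.indicator (fun _ => ENNReal.ofReal (1 + (4 * e)⁻¹)) ω +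
        ENNReal.ofReal (m ω i) * ENNReal.ofReal (e * Real.log (n ω i) ^ 2)) ∂(K ∘ₘ unif q) ≤
        ENNReal.ofReal (1 + (4 * e)⁻¹) * s + ENNReal.ofReal (4 * e) := by
    rw [lintegral_add_left (measurable_const.indicator hset), lintegral_indicator_const hset,
      lintegral_ofReal_mul_of_calibrated hm hn i (hlog i)]
    gcongr
    have hb (ω) : ENNReal.ofReal (n ω i) * ENNReal.ofReal (e * Real.log (n ω i) ^ 2) ≤
        ENNReal.ofReal (4 * e) := by
      rw [← ENNReal.ofReal_mul ((hn.mem ω).1 i)]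
      refine ENNReal.ofReal_le_ofReal ?_
      have := mul_log_sq_le ((hn.mem ω).1 i) (le_one_of_mem_stdSimplex (hn.mem ω) i)
      nlinarith
    refine (lintegral_mono hb).trans ?_
    simp
  refine (Finset.sum_le_sum fun i _ => hi i).trans (le_of_eq ?_)
  rw [Finset.sum_const, Finset.card_univ, Fintype.card_fin, nsmul_eq_mul, mul_add]

/-- Far down the tree, the expected Kullback-Leibler divergence is small. -/
lemma eventually_lintegral_kl_le (lam : Param q) (d : ℝ≥0) {B θ : ℝ≥0∞} (hB : B ≠ ⊤) (hθ : θ < 1)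
    {δ : ℝ≥0∞} (hδ : 0 < δ) :
    ∀ᶠ k in atTop, ∀ {Ω : Type u} [MeasurableSpace Ω] (K : Kernel (Fin q) Ω) [IsMarkovKernel K]
      (m n : Ω → Fin q → ℝ), IsPosterior K m → Calibrated K n → IsSmall lam d B θ k K m n →
      ∫⁻ ω, ENNReal.ofReal (kl (m ω) (n ω)) ∂(K ∘ₘ unif q) ≤ δ := by
  have h1 : Tendsto (fun j : ℕ => (d : ℝ≥0∞) * (B * θ ^ j)) atTop (𝓝 0) := by
    have h := ENNReal.Tendsto.const_mul (a := (d : ℝ≥0∞) * B)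
      (ENNReal.tendsto_pow_atTop_nhds_zero_of_lt_one hθ)
      (Or.inr (ENNReal.mul_ne_top ENNReal.coe_ne_top hB))
    simpa [mul_assoc] using h
  -- the two terms of `lintegral_kl_le_of_measure_le` get `δ / 2` each
  obtain ⟨e, he, heδ⟩ : ∃ e : ℝ, 0 < e ∧ q * ENNReal.ofReal (4 * e) ≤ δ / 2 := by
    by_cases htop : δ = ⊤
    · exact ⟨1, one_pos, by rw [htop, ENNReal.top_div_of_ne_top (by simp)]; exact le_top⟩
    · have hq : (0 : ℝ) < q := by exact_mod_cast NeZero.pos q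
      have hδ' : 0 < δ.toReal := ENNReal.toReal_pos hδ.ne' htop
      refine ⟨δ.toReal / (8 * q), by positivity, le_of_eq ?_⟩
      rw [← ENNReal.ofReal_natCast, ← ENNReal.ofReal_mul hq.le]
      have h2 : (q : ℝ) * (4 * (δ.toReal / (8 * q))) = δ.toReal / 2 := by field_simp; norm_num
      rw [h2, ENNReal.ofReal_div_of_pos (by norm_num), ENNReal.ofReal_toReal htop]
      simp
  have h3 : d < 1 → Tendsto (fun k : ℕ => (q : ℝ≥0∞) * (ENNReal.ofReal (1 + (4 * e)⁻¹) *
      (d : ℝ≥0∞) ^ k)) atTop (𝓝 0) := by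
    intro hd
    have h := ENNReal.Tendsto.const_mul (a := (q : ℝ≥0∞) * ENNReal.ofReal (1 + (4 * e)⁻¹))
      (ENNReal.tendsto_pow_atTop_nhds_zero_of_lt_one (r := (d : ℝ≥0∞)) (by exact_mod_cast hd))
      (Or.inr (ENNReal.mul_ne_top (ENNReal.natCast_ne_top q) ENNReal.ofReal_ne_top))
    simpa [mul_assoc] using h
  have h4 : ∀ᶠ k : ℕ in atTop, d < 1 → (q : ℝ≥0∞) * (ENNReal.ofReal (1 + (4 * e)⁻¹) *
      (d : ℝ≥0∞) ^ k) ≤ δ / 2 := by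
    by_cases hd : d < 1
    · filter_upwards [ENNReal.tendsto_nhds_zero.1 (h3 hd) (δ / 2) (ENNReal.half_pos hδ.ne')]
        with k hk _ using hk
    · exact Eventually.of_forall fun k hd' => absurd hd' hd
  have h5 : ∀ᶠ k : ℕ in atTop, (d : ℝ≥0∞) * (B * θ ^ (k - 1)) ≤ δ :=
    (tendsto_sub_atTop_nat 1).eventually (ENNReal.tendsto_nhds_zero.1 h1 δ hδ)
  filter_upwards [h4, h5, eventually_ge_atTop 1] with k hk4 hk5 hk1 Ω _ K _ m n hm hn hsmall
  rcases hsmall with ⟨-, -, -, h⟩ | ⟨hd, h⟩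
  · exact (h (k - 1) (by omega)).trans hk5
  · refine (lintegral_kl_le_of_measure_le hm hn h he).trans ?_
    calc _ ≤ δ / 2 + δ / 2 := add_le_add (hk4 hd) heδ
      _ = δ := ENNReal.add_halves δ

end Contraction

/-! ### Mutual information as an expected divergence of posteriors -/

section Information

variable {q : ℕ} [NeZero q] {Ω Ω' X Y Z : Type*} [MeasurableSpace Ω] [MeasurableSpace Ω']
  [MeasurableSpace X] [MeasurableSpace Y] [MeasurableSpace Z]

/-- The Markov kernel of sampling from the law `m ω` on `[q]`. -/
noncomputable def colorKernel {q : ℕ} (m : Ω → Fin q → ℝ) (hm : Measurable m) :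
    Kernel Ω (Fin q) where
  toFun ω := ∑ i, ENNReal.ofReal (m ω i) • Measure.dirac i
  measurable' := by
    refine Measure.measurable_of_measurable_coe _ fun s _ => ?_
    simp only [Measure.coe_finsetSum, Finset.sum_apply, Measure.smul_apply, smul_eq_mul]
    exact Finset.measurable_fun_sum _ fun i _ =>
      ((measurable_pi_apply i).comp hm).ennreal_ofReal.mul_const _

lemma lintegral_colorKernel {q : ℕ} (m : Ω → Fin q → ℝ) (hm : Measurable m) (ω : Ω)
    (f : Fin q → ℝ≥0∞) :
    ∫⁻ i, f i ∂colorKernel m hm ω = ∑ i, ENNReal.ofReal (m ω i) * f i := by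
  change ∫⁻ i, f i ∂(∑ i, ENNReal.ofReal (m ω i) • Measure.dirac i : Measure (Fin q)) = _
  rw [lintegral_finsetSum_measure]
  simp only [lintegral_smul_measure, lintegral_dirac, smul_eq_mul]

lemma isMarkovKernel_colorKernel {q : ℕ} {m : Ω → Fin q → ℝ} (hm : Measurable m)
    (h : ∀ ω, m ω ∈ stdSimplex ℝ (Fin q)) : IsMarkovKernel (colorKernel m hm) := by
  refine ⟨fun ω => ⟨?_⟩⟩
  rw [← lintegral_one, lintegral_colorKernel]
  simp only [mul_one]
  rw [← ENNReal.ofReal_sum_of_nonneg fun i _ => (h ω).1 i, (h ω).2, ENNReal.ofReal_one]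

lemma lintegral_compProd_colorKernel {q : ℕ} (ρ : Measure Ω) [SFinite ρ] {m : Ω → Fin q → ℝ}
    (hm : Measurable m) (h : ∀ ω, m ω ∈ stdSimplex ℝ (Fin q)) {f : Ω × Fin q → ℝ≥0∞}
    (hf : Measurable f) :
    ∫⁻ p, f p ∂(ρ ⊗ₘ colorKernel m hm) = ∫⁻ ω, ∑ i, ENNReal.ofReal (m ω i) * f (ω, i) ∂ρ := by
  have := isMarkovKernel_colorKernel hm h
  rw [Measure.lintegral_compProd hf]
  simp only [lintegral_colorKernel]

/-- The posterior gives the conditional law of a color `c` given an observation `g`, when both are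
read off the output of a channel `T` whose input is `c`. The observation may be replaced by
anything with the same law. -/
lemma map_comp_unif_eq_compProd {T : Kernel (Fin q) X} {c : X → Fin q} (hc : Measurable c)
    (hT : ∀ i, ∀ᵐ t ∂T i, c t = i) {g : X → Y} (hg : Measurable g)
    {K : Kernel (Fin q) Ω} [IsMarkovKernel K] {j : Ω → Y} (hj : Measurable j)
    (h : ∀ i, (K i).map j = (T i).map g) {m : Ω → Fin q → ℝ} (hm : IsPosterior K m) :
    (T ∘ₘ unif q).map (fun t => (g t, c t)) =
      ((K ∘ₘ unif q) ⊗ₘ colorKernel m hm.measurable).map (Prod.map j id) := by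
  ext s hs
  set f : Y × Fin q → ℝ≥0∞ := s.indicator 1 with hfdef
  have hf : Measurable f := measurable_one.indicator hs
  have hfi (i : Fin q) : Measurable fun y => f (y, i) := hf.comp measurable_prodMk_right
  have hji : Measurable (Prod.map j (id : Fin q → Fin q)) := hj.prodMap measurable_id
  rw [← lintegral_indicator_one hs, ← lintegral_indicator_one hs, ← hfdef,
    lintegral_map hf (hg.prodMk hc), lintegral_map hf hji,
    lintegral_compProd_colorKernel _ hm.measurable hm.mem
      (f := fun p => f (Prod.map j id p)) (hf.comp hji), lintegral_comp_unif]
  have h1 (i : Fin q) : ∫⁻ t, f (g t, c t) ∂T i =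
      ∫⁻ ω, ENNReal.ofReal (q * m ω i) * f (j ω, i) ∂(K ∘ₘ unif q) := by
    rw [← hm.lintegral_eq i (f := fun ω => f (j ω, i)) ((hfi i).comp hj), ← lintegral_map (hfi i) hj, h i,
      lintegral_map (hfi i) hg]
    refine lintegral_congr_ae ?_
    filter_upwards [hT i] with t ht
    rw [ht]
  have hmf (i : Fin q) : Measurable fun ω => ENNReal.ofReal (m ω i) * f (j ω, i) :=
    (hm.measurable_apply i).ennreal_ofReal.mul ((hfi i).comp hj)
  have h2 (i : Fin q) : ∫⁻ ω, ENNReal.ofReal (q * m ω i) * f (j ω, i) ∂(K ∘ₘ unif q) =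
      q * ∫⁻ ω, ENNReal.ofReal (m ω i) * f (j ω, i) ∂(K ∘ₘ unif q) := by
    rw [← lintegral_const_mul _ (hmf i)]
    refine lintegral_congr fun ω => ?_
    rw [ENNReal.ofReal_mul (Nat.cast_nonneg q), ENNReal.ofReal_natCast, mul_assoc]
  simp only [h1, h2]
  rw [← Finset.mul_sum, ← mul_assoc, ENNReal.inv_mul_cancel (natCast_ne_zero_ennreal q)
    (ENNReal.natCast_ne_top q), one_mul]
  exact (lintegral_finsetSum Finset.univ (f := fun i ω => ENNReal.ofReal (m ω i) * f (j ω, i))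
    fun i _ => hmf i).symm

/-- The divergence of two joint laws with a common marginal is the expected divergence of the
conditional laws. Calibration of `n` makes the first joint law absolutely continuous. -/
lemma klDiv_compProd_colorKernel {K : Kernel (Fin q) Ω} [IsMarkovKernel K] {m n : Ω → Fin q → ℝ}
    (hm : IsPosterior K m) (hn : Calibrated K n) :
    klDiv ((K ∘ₘ unif q) ⊗ₘ colorKernel m hm.measurable)
      ((K ∘ₘ unif q) ⊗ₘ colorKernel n hn.measurable) =
      ∫⁻ ω, ENNReal.ofReal (kl (m ω) (n ω)) ∂(K ∘ₘ unif q) := by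
  have := isMarkovKernel_colorKernel hm.measurable hm.mem
  have := isMarkovKernel_colorKernel hn.measurable hn.mem
  set r : Ω × Fin q → ℝ := fun p => m p.1 p.2 / n p.1 p.2 with hrdef
  have hr : Measurable r := measurable_from_prod_countable_left fun i =>
    (hm.measurable_apply i).div (hn.measurable_apply i)
  have hr0 (p) : 0 ≤ r p := div_nonneg ((hm.mem p.1).1 p.2) ((hn.mem p.1).1 p.2)
  have hzero (i : Fin q) : ∀ᵐ ω ∂(K ∘ₘ unif q), n ω i = 0 → m ω i = 0 := by
    have hset : MeasurableSet {x : Fin q → ℝ | x i = 0} :=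
      measurable_pi_apply i (measurableSet_singleton 0)
    have h1 := lintegral_ofReal_mul_of_calibrated hm hn i
      (h := {x : Fin q → ℝ | x i = 0}.indicator 1) (measurable_one.indicator hset)
    have h2 : ∫⁻ ω, ENNReal.ofReal (n ω i) * {x : Fin q → ℝ | x i = 0}.indicator 1 (n ω)
        ∂(K ∘ₘ unif q) = 0 := by
      rw [lintegral_eq_zero_of_ae_eq_zero]
      refine ae_of_all _ fun ω => ?_
      by_cases h : n ω i = 0 <;> simp [h]
    rw [h2, lintegral_eq_zero_iff (f := fun ω => ENNReal.ofReal (m ω i) *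
      {x : Fin q → ℝ | x i = 0}.indicator 1 (n ω)) ((hm.measurable_apply i).ennreal_ofReal.mul
      ((measurable_one.indicator hset).comp hn.measurable))] at h1
    filter_upwards [h1] with ω hω h0
    simp only [Pi.zero_apply, mul_eq_zero, ENNReal.ofReal_eq_zero] at hω
    rcases hω with h | h
    · exact le_antisymm h ((hm.mem ω).1 i)
    · simp [h0] at h
  have hdens : (K ∘ₘ unif q) ⊗ₘ colorKernel m hm.measurable =
      ((K ∘ₘ unif q) ⊗ₘ colorKernel n hn.measurable).withDensity
        fun p => ENNReal.ofReal (r p) := by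
    ext s hs
    have hf : Measurable (s.indicator (1 : Ω × Fin q → ℝ≥0∞)) := measurable_one.indicator hs
    rw [withDensity_apply _ hs, ← lintegral_indicator_one hs, ← lintegral_indicator hs,
      lintegral_compProd_colorKernel _ hm.measurable hm.mem hf,
      lintegral_compProd_colorKernel _ hn.measurable hn.mem (hr.ennreal_ofReal.indicator hs)]
    refine lintegral_congr_ae ?_
    filter_upwards [ae_all_iff.2 hzero] with ω hω
    refine Finset.sum_congr rfl fun i _ => ?_
    by_cases his : (ω, i) ∈ s
    · rw [Set.indicator_of_mem his, Set.indicator_of_mem his, ← ENNReal.ofReal_mul ((hn.mem ω).1 i)]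
      simp only [Pi.one_apply, mul_one, hrdef]
      congr 1
      by_cases h : n ω i = 0
      · rw [h, hω i h, zero_mul]
      · field_simp
    · simp [Set.indicator_of_notMem his]
  have hac : (K ∘ₘ unif q) ⊗ₘ colorKernel m hm.measurable ≪
      (K ∘ₘ unif q) ⊗ₘ colorKernel n hn.measurable := by
    rw [hdens]; exact withDensity_absolutelyContinuous _ _
  have hrn : ((K ∘ₘ unif q) ⊗ₘ colorKernel m hm.measurable).rnDeriv
      ((K ∘ₘ unif q) ⊗ₘ colorKernel n hn.measurable) =ᵐ[(K ∘ₘ unif q) ⊗ₘ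
        colorKernel n hn.measurable] fun p => ENNReal.ofReal (r p) := by
    conv_lhs => rw [hdens]
    exact Measure.rnDeriv_withDensity _ hr.ennreal_ofReal
  rw [klDiv_eq_lintegral_klFun_of_ac hac]
  have h3 : ∫⁻ p, ENNReal.ofReal (klFun
      (((K ∘ₘ unif q) ⊗ₘ colorKernel m hm.measurable).rnDeriv
        ((K ∘ₘ unif q) ⊗ₘ colorKernel n hn.measurable) p).toReal)
      ∂((K ∘ₘ unif q) ⊗ₘ colorKernel n hn.measurable) =
      ∫⁻ p, ENNReal.ofReal (klFun (r p))
        ∂((K ∘ₘ unif q) ⊗ₘ colorKernel n hn.measurable) := by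
    refine lintegral_congr_ae ?_
    filter_upwards [hrn] with p hp
    rw [hp, ENNReal.toReal_ofReal (hr0 p)]
  rw [h3, lintegral_compProd_colorKernel _ hn.measurable hn.mem
    (f := fun p => ENNReal.ofReal (klFun (r p)))
    (measurable_klFun.comp hr).ennreal_ofReal]
  refine lintegral_congr fun ω => ?_
  unfold kl
  rw [ENNReal.ofReal_sum_of_nonneg fun i _ => mul_nonneg ((hn.mem ω).1 i)
    (klFun_nonneg (hr0 (ω, i)))]
  exact Finset.sum_congr rfl fun i _ => (ENNReal.ofReal_mul ((hn.mem ω).1 i)).symm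

/-- The conditional mutual information of the color and an observation `y` given another
observation `z` is at most the expected divergence of the posteriors given `(y, z)` and given
`z`. -/
lemma condMutualInfo_le {T : Kernel (Fin q) X} [IsMarkovKernel T] {c : X → Fin q}
    (hc : Measurable c) (hT : ∀ i, ∀ᵐ t ∂T i, c t = i) {y : X → Y} (hy : Measurable y) {z : X → Z}
    (hz : Measurable z) {K : Kernel (Fin q) Ω} [IsMarkovKernel K] {j : Ω → Y × Z}
    (hj : Measurable j) (h : ∀ i, (K i).map j = (T i).map fun t => (y t, z t))
    {m : Ω → Fin q → ℝ} (hm : IsPosterior K m) {n : Z → Fin q → ℝ} (hn : IsPosterior (T.map z) n) :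
    condMutualInfo (T ∘ₘ unif q) c y z ≤
      ∫⁻ ω, ENNReal.ofReal (kl (m ω) (n (j ω).2)) ∂(K ∘ₘ unif q) := by
  have hyz : Measurable fun t => (y t, z t) := hy.prodMk hz
  have hTz (i : Fin q) : (T i).map z = T.map z i := (Kernel.map_apply _ hz i).symm
  have : IsMarkovKernel (T.map z) := Kernel.IsMarkovKernel.map _ hz
  have hn' : Calibrated K (n ∘ fun ω => (j ω).2) := by
    refine hn.comp_calibrated (measurable_snd.comp hj) fun i => ?_
    rw [← hTz, ← Measure.map_map measurable_snd hj, h i, Measure.map_map measurable_snd hyz]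
    rfl
  have := isMarkovKernel_colorKernel hn.measurable hn.mem
  have := isMarkovKernel_colorKernel hn'.measurable hn'.mem
  have := isMarkovKernel_colorKernel hm.measurable hm.mem
  have hcd : condDistrib c z (T ∘ₘ unif q) =ᵐ[(T ∘ₘ unif q).map z]
      colorKernel n hn.measurable := by
    refine condDistrib_ae_eq_of_measure_eq_compProd z hc.aemeasurable ?_
    rw [map_comp_unif_eq_compProd hc hT hz measurable_id
      (fun i => by rw [Measure.map_id, hTz]) hn, map_comp_unif hz hTz]
    simp
  have hmarg : (T ∘ₘ unif q).map (fun t => (y t, z t)) = (K ∘ₘ unif q).map j := by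
    rw [map_comp_unif hj (N := T.map fun t => (y t, z t)) fun i => by
        rw [h i, Kernel.map_apply _ hyz],
      map_comp_unif hyz fun i => (Kernel.map_apply _ hyz i).symm]
  have hji : Measurable (Prod.map j (id : Fin q → Fin q)) := hj.prodMap measurable_id
  have h2 : (T ∘ₘ unif q).map (fun t => (y t, z t)) ⊗ₘ
        Kernel.prodMkLeft Y (condDistrib c z (T ∘ₘ unif q)) =
      ((K ∘ₘ unif q) ⊗ₘ colorKernel _ hn'.measurable).map (Prod.map j id) := by
    have h3 : Kernel.prodMkLeft Y (condDistrib c z (T ∘ₘ unif q))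
        =ᵐ[(T ∘ₘ unif q).map fun t => (y t, z t)]
        Kernel.prodMkLeft Y (colorKernel n hn.measurable) := by
      have h4 : ∀ᵐ p ∂((T ∘ₘ unif q).map fun t => (y t, z t)),
          condDistrib c z (T ∘ₘ unif q) p.2 = colorKernel n hn.measurable p.2 := by
        refine ae_of_ae_map (f := (Prod.snd : Y × Z → Z))
          (p := fun a => condDistrib c z (T ∘ₘ unif q) a = colorKernel n hn.measurable a)
          measurable_snd.aemeasurable ?_
        rw [Measure.map_map measurable_snd hyz]
        exact hcd
      filter_upwards [h4] with p hp
      exact hp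
    rw [Measure.compProd_congr h3, hmarg]
    ext s hs
    have hf : Measurable (s.indicator (1 : (Y × Z) × Fin q → ℝ≥0∞)) := measurable_one.indicator hs
    rw [← lintegral_indicator_one hs, ← lintegral_indicator_one hs, lintegral_map hf hji,
      lintegral_compProd_colorKernel _ hn'.measurable hn'.mem
        (f := fun p => s.indicator 1 (Prod.map j id p)) (hf.comp hji),
      Measure.lintegral_compProd hf, lintegral_map hf.lintegral_kernel_prod_right' hj]
    refine lintegral_congr fun ω => ?_
    rw [Kernel.prodMkLeft_apply, lintegral_colorKernel]
    rfl
  unfold condMutualInfo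
  rw [h2, map_comp_unif_eq_compProd hc hT hyz hj h hm]
  refine (klDiv_map_le _ _ hji).trans (le_of_eq ?_)
  exact klDiv_compProd_colorKernel hm hn'

end Information

/-! ### The boundary of the tree -/

section Tree

variable {q : ℕ} [NeZero q]

/-- The color of the root is the input of the broadcasting channel. -/
lemma ae_root_fst_eq (lam : Param q) (ν : Measure ℕ) [IsProbabilityMeasure ν] (W : Channel.{u} q)
    (k : ℕ) (i : Fin q) : ∀ᵐ t ∂broadcast lam ν W k i, (LTree.root k t).1 = i := by
  have hW : ∀ᵐ p ∂(Kernel.id ×ₖ W.kernel) i, p.1 = i := by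
    refine ae_of_ae_map (f := (Prod.fst : Fin q × W.Out → Fin q)) (p := fun a => a = i)
      measurable_fst.aemeasurable ?_
    rw [Kernel.prod_apply, Measure.map_fst_prod, Kernel.id_apply, measure_univ, one_smul]
    exact (ae_dirac_iff (measurableSet_singleton i)).2 rfl
  cases k with
  | zero => exact hW
  | succ k =>
    change ∀ᵐ t ∂((Kernel.id ×ₖ W.kernel) ×ₖ
      branch ν (broadcast lam ν W k ∘ₖ pottsKernel q lam)) i,
      t.1.1 = i
    refine ae_of_ae_map (f := (Prod.fst : (Fin q × W.Out) × (Σ b : ℕ, Fin b →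
      LTree (Fin q × W.Out) k) → Fin q × W.Out)) (p := fun a => a.1 = i)
      measurable_fst.aemeasurable ?_
    rw [Kernel.prod_apply, Measure.map_fst_prod, measure_univ, one_smul]
    exact hW

/-- Observe the survey at the root and the function `g` of each subtree. -/
lemma broadcast_succ_map {X : Type*} [MeasurableSpace X] (lam : Param q) (ν : Measure ℕ)
    [IsProbabilityMeasure ν] (W : Channel.{u} q) (k : ℕ) {g : LTree (Fin q × W.Out) k → X}
    (hg : Measurable g) (i : Fin q) :
    (broadcast lam ν W (k + 1) i).map (fun t =>
      (t.1.2, (⟨t.2.1, fun l => g (t.2.2 l)⟩ : Σ b : ℕ, Fin b → X))) =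
    (W.kernel ×ₖ branch ν ((broadcast lam ν W k).map g ∘ₖ pottsKernel q lam)) i := by
  have : IsMarkovKernel ((broadcast lam ν W k).map g) := Kernel.IsMarkovKernel.map _ hg
  change (((Kernel.id ×ₖ W.kernel) ×ₖ branch ν (broadcast lam ν W k ∘ₖ pottsKernel q lam)) i).map
    (Prod.map Prod.snd fun s : (Σ b : ℕ, Fin b → LTree (Fin q × W.Out) k) =>
      (⟨s.1, fun l => g (s.2 l)⟩ : Σ b : ℕ, Fin b → X)) = _
  rw [Kernel.prod_apply, Kernel.prod_apply, Kernel.prod_apply,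
    ← Measure.map_prod_map _ _ measurable_snd (measurable_sigmaMap hg), Measure.map_snd_prod,
    measure_univ, one_smul, branch_apply, branch_apply,
    branchMeasure_map ν _ hg, ← Kernel.map_comp, Kernel.map_apply _ hg]

/-- The survey on the tree is a channel built level by level. -/
lemma broadcast_succ_map_snd (lam : Param q) (ν : Measure ℕ) [IsProbabilityMeasure ν]
    (W : Channel.{u} q) (k : ℕ) :
    ((broadcast lam ν W (k + 1)).map (LTree.map Prod.snd (k + 1)) :
      Kernel (Fin q) (W.Out × (Σ b : ℕ, Fin b → LTree W.Out k))) =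
    W.kernel ×ₖ
      branch ν ((broadcast lam ν W k).map (LTree.map Prod.snd k) ∘ₖ pottsKernel q lam) := by
  refine Kernel.ext fun i => ?_
  exact (Kernel.map_apply (broadcast lam ν W (k + 1))
    (LTree.measurable_map measurable_snd (k + 1)) i).trans <|
    broadcast_succ_map lam ν W k (LTree.measurable_map measurable_snd k) i

/-- The colors of the vertices at depth `k`, and the survey. -/
def LTree.observe {q : ℕ} {Out : Type u} (k : ℕ) (t : LTree (Fin q × Out) k) :
    LeafTree (Fin q) k × LTree Out k :=
  (LTree.leaves k (LTree.map Prod.fst k t), LTree.map Prod.snd k t)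

lemma LTree.measurable_observe {q : ℕ} {Out : Type u} [MeasurableSpace Out] (k : ℕ) :
    Measurable (LTree.observe (q := q) (Out := Out) k) :=
  ((LTree.measurable_leaves k).comp (LTree.measurable_map measurable_fst k)).prodMk
    (LTree.measurable_map measurable_snd k)

/-- The boundary colors and the survey are, up to a relabelling of the outputs, the output of a
channel that is built level by level, like the survey alone. Hence the posteriors with and without
the boundary are close. -/
lemma exists_boundary_channel (hq : 2 ≤ q) {lam : Param q} {d : ℝ≥0} {B θ : ℝ≥0∞}
    (hθ : ENNReal.ofReal ((d : ℝ) * (lam : ℝ) ^ 2) * CL q lam ≤ θ)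
    (hB : ∀ {Ω : Type u} [MeasurableSpace Ω] (K : Kernel (Fin q) Ω) [IsMarkovKernel K]
      (m n : Ω → Fin q → ℝ), (∀ ω, m ω ∈ stdSimplex ℝ (Fin q)) →
      (∀ ω, n ω ∈ stdSimplex ℝ (Fin q)) → IsSmall lam d B θ 0 K m n)
    {ν : Measure ℕ} [IsProbabilityMeasure ν] (hν : ∫⁻ b, (b : ℝ≥0∞) ∂ν = d)
    (W : Channel.{u} q) (k : ℕ) :
    ∃ (Ω : Type u) (_ : MeasurableSpace Ω) (K : Kernel (Fin q) Ω) (_ : IsMarkovKernel K)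
      (j : Ω → LeafTree (Fin q) k × LTree W.Out k) (m : Ω → Fin q → ℝ)
      (n : LTree W.Out k → Fin q → ℝ), Measurable j ∧
      (∀ i, (K i).map j = (broadcast lam ν W k i).map (LTree.observe k)) ∧
      IsPosterior K m ∧ IsPosterior ((broadcast lam ν W k).map (LTree.map Prod.snd k)) n ∧
      IsSmall lam d B θ k K m fun ω => n (j ω).2 := by
  have hsnd (k : ℕ) : Measurable (LTree.map (Prod.snd : Fin q × W.Out → W.Out) k) :=
    LTree.measurable_map measurable_snd k
  have hN (k : ℕ) : IsMarkovKernel ((broadcast lam ν W k).map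
    (LTree.map (Prod.snd : Fin q × W.Out → W.Out) k)) := Kernel.IsMarkovKernel.map _ (hsnd k)
  induction k with
  | zero =>
    obtain ⟨m, hm⟩ := exists_isPosterior (broadcast lam ν W 0)
    obtain ⟨n, hn⟩ := exists_isPosterior ((broadcast lam ν W 0).map
      (LTree.map (Prod.snd : Fin q × W.Out → W.Out) 0))
    exact ⟨LTree (Fin q × W.Out) 0, inferInstance, broadcast lam ν W 0, inferInstance,
      LTree.observe 0, m, n, LTree.measurable_observe 0, fun _ => rfl, hm, hn,
      hB _ _ _ hm.mem fun _ => hn.mem _⟩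
  | succ k ih =>
    obtain ⟨Ω, _, K, _, j, m, n, hj, hK, hm, hn, hsmall⟩ := ih
    obtain ⟨w, hw⟩ := exists_isPosterior W.kernel
    have hobs := LTree.measurable_observe (q := q) (Out := W.Out) k
    have hn' : Calibrated K fun ω => n (j ω).2 := by
      refine hn.comp_calibrated (measurable_snd.comp hj) fun i => ?_
      rw [Kernel.map_apply _ (hsnd k), ← Measure.map_map measurable_snd hj, hK i,
        Measure.map_map measurable_snd hobs]
      rfl
    -- regroup the observations of the subtrees into a boundary and a survey
    let zip (p : W.Out × (Σ b : ℕ, Fin b → LeafTree (Fin q) k × LTree W.Out k)) :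
        LeafTree (Fin q) (k + 1) × LTree W.Out (k + 1) :=
      (⟨p.2.1, fun l => (p.2.2 l).1⟩, (p.1, ⟨p.2.1, fun l => (p.2.2 l).2⟩))
    have hzip : Measurable zip :=
      ((measurable_sigmaMap measurable_fst).comp measurable_snd).prodMk
        (measurable_fst.prodMk ((measurable_sigmaMap measurable_snd).comp measurable_snd))
    let j₁ (p : W.Out × (Σ b : ℕ, Fin b → Ω)) :
        W.Out × (Σ b : ℕ, Fin b → LeafTree (Fin q) k × LTree W.Out k) :=
      Prod.map id (fun s : (Σ b : ℕ, Fin b → Ω) =>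
        (⟨s.1, fun l => j (s.2 l)⟩ : Σ b : ℕ, Fin b → LeafTree (Fin q) k × LTree W.Out k)) p
    have hj₁ : Measurable j₁ := measurable_id.prodMap (measurable_sigmaMap hj)
    have hpost := hw.tree hn lam ν
    rw [← broadcast_succ_map_snd lam ν W k] at hpost
    refine ⟨W.Out × (Σ b : ℕ, Fin b → Ω), inferInstance,
      W.kernel ×ₖ branch ν (K ∘ₖ pottsKernel q lam), inferInstance, zip ∘ j₁,
      treePosterior lam w m, treePosterior lam w n, hzip.comp hj₁, fun i => ?_,
      hw.tree hm lam ν, hpost, hsmall.step hq hm hn' hθ hw hν⟩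
    have h1 : ((W.kernel ×ₖ branch ν (K ∘ₖ pottsKernel q lam)) i).map j₁ =
        (W.kernel ×ₖ branch ν
          ((broadcast lam ν W k).map (LTree.observe k) ∘ₖ pottsKernel q lam)) i := by
      have h2 : (broadcast lam ν W k).map (LTree.observe k) = K.map j := by
        refine Kernel.ext fun i => ?_
        rw [Kernel.map_apply _ hobs, Kernel.map_apply _ hj, hK i]
      have : IsMarkovKernel (K.map j) := Kernel.IsMarkovKernel.map _ hj
      rw [h2, Kernel.prod_apply, Kernel.prod_apply,
        ← Measure.map_prod_map _ _ measurable_id (measurable_sigmaMap hj), Measure.map_id,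
        branch_apply, branch_apply, branchMeasure_map ν _ hj, ← Kernel.map_comp,
        Kernel.map_apply _ hj]
    rw [← Measure.map_map hzip hj₁, h1, ← broadcast_succ_map lam ν W k hobs i,
      Measure.map_map hzip]
    · rfl
    · exact (measurable_snd.comp measurable_fst).prodMk
        ((measurable_sigmaMap hobs).comp measurable_snd)

lemma boundaryIrrelevance_of_lt_one (hq : 2 ≤ q) {lam : Param q} {d : ℝ≥0}
    (hext : d < 1 ∨ (-(1 / ((q : ℝ) - 1)) < (lam : ℝ) ∧ (lam : ℝ) < 1))
    (hlt : ENNReal.ofReal ((d : ℝ) * (lam : ℝ) ^ 2) * CL q lam < 1)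
    {ν : Measure ℕ} [IsProbabilityMeasure ν] (hν : ∫⁻ b, (b : ℝ≥0∞) ∂ν = d) :
    BoundaryIrrelevance.{u} lam ν := by
  intro W _ _
  obtain ⟨B, hBtop, hB⟩ := exists_isSmall_zero.{u} hq lam d hext
    (ENNReal.ofReal ((d : ℝ) * (lam : ℝ) ^ 2) * CL q lam)
  refine ENNReal.tendsto_nhds_zero.2 fun δ hδ => ?_
  filter_upwards [eventually_lintegral_kl_le.{u} lam d hBtop hlt hδ] with k hk
  obtain ⟨Ω, _, K, _, j, m, n, hj, hK, hm, hn, hsmall⟩ :=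
    exists_boundary_channel hq le_rfl hB hν W k
  have hsnd : Measurable (LTree.map (Prod.snd : Fin q × W.Out → W.Out) k) :=
    LTree.measurable_map measurable_snd k
  have hobs := LTree.measurable_observe (q := q) (Out := W.Out) k
  have hn' : Calibrated K fun ω => n (j ω).2 := by
    refine hn.comp_calibrated (measurable_snd.comp hj) fun i => ?_
    rw [Kernel.map_apply _ hsnd, ← Measure.map_map measurable_snd hj, hK i,
      Measure.map_map measurable_snd hobs]
    rfl
  refine le_trans ?_ (hk K m _ hm hn' hsmall)
  exact condMutualInfo_le (measurable_fst.comp (LTree.measurable_root k))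
    (ae_root_fst_eq lam ν W k)
    ((LTree.measurable_leaves k).comp (LTree.measurable_map measurable_fst k)) hsnd hj hK hm hn

end Tree

/-! ### Belief propagation -/

section BeliefPropagation

variable {q : ℕ} [NeZero q] {Ω Ω' : Type*} [MeasurableSpace Ω] [MeasurableSpace Ω']

lemma normalize_const (c : ℝ) : normalize (fun _ : Fin q => c) = fun _ => (q : ℝ)⁻¹ := by
  funext i
  unfold normalize
  by_cases hc : c = 0
  · simp [hc]
  · have hq : (q : ℝ) ≠ 0 := by exact_mod_cast NeZero.ne q
    have hqc : ∑ _j : Fin q, c ≠ 0 := by simp [hc, hq]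
    rw [if_neg hqc]
    simp
    field_simp

lemma uniform_mem : (fun _ => (q : ℝ)⁻¹) ∈ stdSimplex ℝ (Fin q) :=
  ⟨fun _ => by positivity, by simp⟩

lemma pottsMap_uniform {q : ℕ} (lam : ℝ) :
    pottsMap lam (fun _ : Fin q => (q : ℝ)⁻¹) = fun _ => (q : ℝ)⁻¹ := by
  funext i
  unfold pottsMap
  ring

lemma isPosterior_const (ρ : Measure Ω) [IsProbabilityMeasure ρ] :
    IsPosterior (Kernel.const (Fin q) ρ) fun _ _ => (q : ℝ)⁻¹ where
  measurable := measurable_const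
  mem _ := uniform_mem
  eq_withDensity i := by
    have hq : (q : ℝ) ≠ 0 := by exact_mod_cast NeZero.ne q
    simp [hq]

lemma calibrated_const (K : Kernel (Fin q) Ω) [IsMarkovKernel K] :
    Calibrated K fun _ _ => (q : ℝ)⁻¹ where
  measurable := measurable_const
  mem _ := uniform_mem
  lintegral_eq i h _ := by
    have hq : (q : ℝ) ≠ 0 := by exact_mod_cast NeZero.ne q
    simp [hq]

lemma IsSmall.of_map {lam : Param q} {d : ℝ≥0} {B θ : ℝ≥0∞} {k : ℕ} {K : Kernel (Fin q) Ω}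
    {K' : Kernel (Fin q) Ω'} {g : Ω → Ω'} (hg : Measurable g) (h : ∀ i, (K i).map g = K' i)
    {m n : Ω' → Fin q → ℝ} (hm : Measurable m) (hn : Measurable n)
    (hs : IsSmall lam d B θ k K (fun ω => m (g ω)) fun ω => n (g ω)) :
    IsSmall lam d B θ k K' m n := by
  have hpotts : Measurable (pottsMap (q := q) lam) := measurable_pi_lambda _ fun i =>
    ((measurable_pi_apply i).const_mul _).add_const _
  unfold IsSmall
  rw [← map_comp_unif hg h, lintegral_map (f := fun ω => ENNReal.ofReal
      (bregman (pottsMap lam (m ω)) (pottsMap lam (n ω))))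
      (measurable_bregman.comp ((hpotts.comp hm).prodMk (hpotts.comp hn))).ennreal_ofReal hg,
    lintegral_map (f := fun ω => ENNReal.ofReal (kl (m ω) (n ω)))
      (measurable_kl.comp (hm.prodMk hn)).ennreal_ofReal hg]
  refine hs.imp id fun h1 => ⟨h1.1, fun i => ?_⟩
  have hset : MeasurableSet {ω | m ω ≠ n ω} := (measurableSet_eq_fun hm hn).compl
  rw [← h i, Measure.map_apply hg hset]
  exact h1.2 i

/-- The posterior after `k` rounds of belief propagation is close to the uniform law: compare it
with the posterior without any observation. -/
lemma exists_isPosterior_iterate_BP (hq : 2 ≤ q) {lam : Param q} {d : ℝ≥0} {B θ : ℝ≥0∞}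
    (hθ : ENNReal.ofReal ((d : ℝ) * (lam : ℝ) ^ 2) * CL q lam ≤ θ)
    (hB : ∀ {Ω : Type u} [MeasurableSpace Ω] (K : Kernel (Fin q) Ω) [IsMarkovKernel K]
      (m n : Ω → Fin q → ℝ), (∀ ω, m ω ∈ stdSimplex ℝ (Fin q)) →
      (∀ ω, n ω ∈ stdSimplex ℝ (Fin q)) → IsSmall lam d B θ 0 K m n)
    {ν : Measure ℕ} [IsProbabilityMeasure ν] (hν : ∫⁻ b, (b : ℝ≥0∞) ∂ν = d)
    (P : Channel.{u} q) (k : ℕ) :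
    ∃ m, IsPosterior ((BP lam ν)^[k] P).kernel m ∧
      IsSmall lam d B θ k ((BP lam ν)^[k] P).kernel m fun _ _ => (q : ℝ)⁻¹ := by
  induction k with
  | zero =>
    obtain ⟨m, hm⟩ := exists_isPosterior P.kernel
    exact ⟨m, hm, hB _ _ _ hm.mem fun _ => uniform_mem⟩
  | succ k ih =>
    obtain ⟨m, hm, hs⟩ := ih
    rw [Function.iterate_succ_apply']
    have hstar := (hm.comp_potts lam).branch ν
    refine ⟨starPosterior fun y => pottsMap lam (m y), hstar, ?_⟩
    have hq0 : (q : ℝ)⁻¹ ≠ 0 := inv_ne_zero (by exact_mod_cast NeZero.ne q)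
    have h1 := hs.step hq hm (calibrated_const _) hθ
      (isPosterior_const (q := q) (Measure.dirac ())) hν
    refine IsSmall.of_map measurable_snd (fun i => ?_) hstar.measurable measurable_const ?_
      (K := Kernel.const (Fin q) (Measure.dirac ()) ×ₖ
        branch ν (((BP lam ν)^[k] P).kernel ∘ₖ pottsKernel q lam))
    · rw [Kernel.prod_apply, Measure.map_snd_prod, measure_univ, one_smul]
      rfl
    · convert h1 using 1
      · funext p
        unfold treePosterior
        rw [normalize_smul _ hq0, normalize_of_mem (hstar.mem p.2)]
      · funext p
        unfold treePosterior starPosterior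
        simp only [pottsMap_uniform, Finset.prod_const, normalize_const]

/-- A quadratic lower bound on bounded intervals. -/
lemma sub_one_sq_le_mul_klFun {x c : ℝ} (h0 : 0 ≤ x) (hc : x ≤ c) :
    (x - 1) ^ 2 ≤ 2 * (c + 1) * klFun x := by
  have hs := Real.sqrt_nonneg x
  have hx : √x ^ 2 = x := Real.sq_sqrt h0
  -- `klFun x - (√x - 1) ^ 2 = 2 * √x * klFun √x`
  have h1 : (√x - 1) ^ 2 ≤ klFun x := by
    have h2 := mul_nonneg hs (klFun_nonneg hs)
    rw [klFun_apply] at h2 ⊢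
    rw [Real.log_sqrt h0] at h2
    have h3 : x * Real.log x = √x ^ 2 * Real.log x := by rw [hx]
    nlinarith
  have h4 : (√x + 1) ^ 2 ≤ 2 * (c + 1) := by nlinarith [sq_nonneg (√x - 1)]
  calc (x - 1) ^ 2 = (√x + 1) ^ 2 * (√x - 1) ^ 2 := by rw [← hx]; ring_nf; simp [hx]
    _ ≤ 2 * (c + 1) * klFun x := mul_le_mul h4 h1 (sq_nonneg _) (by linarith)

lemma dist_uniform_le {m : Fin q → ℝ} (hm : m ∈ stdSimplex ℝ (Fin q)) {e : ℝ} (he : 0 < e) :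
    dist m (fun _ => (q : ℝ)⁻¹) ≤ e + 2 * (q + 1) / e * kl m fun _ => (q : ℝ)⁻¹ := by
  have hq : (1 : ℝ) ≤ q := by exact_mod_cast NeZero.one_le
  have hq0 : (q : ℝ) ≠ 0 := by positivity
  have hkl : 0 ≤ kl m fun _ => (q : ℝ)⁻¹ := kl_nonneg hm.1 uniform_mem.1
  refine (dist_pi_le_iff (by positivity)).2 fun i => ?_
  have hx0 : 0 ≤ q * m i := mul_nonneg (by positivity) (hm.1 i)
  have hx1 : q * m i ≤ q := mul_le_of_le_one_right (by positivity) (le_one_of_mem_stdSimplex hm i)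
  have h1 := sub_one_sq_le_mul_klFun hx0 hx1
  have h2 : (q : ℝ)⁻¹ * klFun (q * m i) ≤ kl m fun _ => (q : ℝ)⁻¹ := by
    have := Finset.single_le_sum (f := fun i => (q : ℝ)⁻¹ * klFun (m i / (q : ℝ)⁻¹))
      (fun j _ => mul_nonneg (by positivity) (klFun_nonneg (div_nonneg (hm.1 j) (by positivity))))
      (Finset.mem_univ i)
    simpa only [kl, div_inv_eq_mul, mul_comm (m i)] using this
  have h3 : |q * m i - 1| ≤ e + (q * m i - 1) ^ 2 / e := by
    rw [← sq_abs]
    have h5 : e + |q * m i - 1| ^ 2 / e - |q * m i - 1| =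
        ((|q * m i - 1| - e / 2) ^ 2 + 3 / 4 * e ^ 2) / e := by field_simp; ring
    have : 0 ≤ ((|q * m i - 1| - e / 2) ^ 2 + 3 / 4 * e ^ 2) / e := by positivity
    linarith
  have h4 : dist (m i) (q : ℝ)⁻¹ = (q : ℝ)⁻¹ * |q * m i - 1| := by
    rw [Real.dist_eq, ← abs_of_nonneg (show (0 : ℝ) ≤ (q : ℝ)⁻¹ by positivity), ← abs_mul,
      abs_of_nonneg (show (0 : ℝ) ≤ (q : ℝ)⁻¹ by positivity), mul_sub, inv_mul_cancel_left₀ hq0,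
      mul_one]
  calc dist (m i) (q : ℝ)⁻¹ ≤ (q : ℝ)⁻¹ * (e + 2 * (q + 1) * klFun (q * m i) / e) := by
        rw [h4]; gcongr; exact h3.trans (by gcongr)
    _ = (q : ℝ)⁻¹ * e + 2 * (q + 1) / e * ((q : ℝ)⁻¹ * klFun (q * m i)) := by ring
    _ ≤ 1 * e + 2 * (q + 1) / e * kl m fun _ => (q : ℝ)⁻¹ := by
        gcongr
        exact inv_le_one_of_one_le₀ hq
    _ = _ := by rw [one_mul]

/-- If the posteriors approach the uniform law in expected divergence, the channels converge weakly
to any channel whose posterior is uniform. -/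
lemma convergesWeakly_of_tendsto_kl {P : ℕ → Channel.{u} q} {L : Channel.{v} q}
    (hL : IsPosterior L.kernel fun _ _ => (q : ℝ)⁻¹)
    (h : Tendsto (fun k => ∫⁻ y, ENNReal.ofReal (kl ((P k).posteriorAt y).1 fun _ => (q : ℝ)⁻¹)
      ∂((P k).kernel ∘ₘ unif q)) atTop (𝓝 0)) :
    ConvergesWeakly P L := by
  set U : stdSimplex ℝ (Fin q) := ⟨fun _ => (q : ℝ)⁻¹, uniform_mem⟩ with hU
  have hdist : Tendsto (fun k => ∫⁻ y, edist ((P k).posteriorAt y) U ∂((P k).kernel ∘ₘ unif q))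
      atTop (𝓝 0) := by
    refine ENNReal.tendsto_nhds_zero.2 fun δ hδ => ?_
    obtain ⟨e, he0, heδ⟩ : ∃ e : ℝ≥0, 0 < e ∧ (e : ℝ≥0∞) < δ :=
      let ⟨e, h1, h2⟩ := ENNReal.lt_iff_exists_nnreal_btwn.1 hδ
      ⟨e, by exact_mod_cast h1, h2⟩
    have he : (0 : ℝ) < (e : ℝ) := by exact_mod_cast he0
    have hlim : Tendsto (fun k => (e : ℝ≥0∞) + ENNReal.ofReal (2 * (q + 1) / e) *
        ∫⁻ y, ENNReal.ofReal (kl ((P k).posteriorAt y).1 fun _ => (q : ℝ)⁻¹)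
          ∂((P k).kernel ∘ₘ unif q)) atTop (𝓝 (e : ℝ≥0∞)) := by
      simpa using (ENNReal.Tendsto.const_mul h (Or.inr (ENNReal.ofReal_ne_top
        (r := 2 * ((q : ℝ) + 1) / e)))).const_add (e : ℝ≥0∞)
    filter_upwards [hlim.eventually_lt_const heδ] with k hk
    refine le_trans ?_ hk.le
    rw [← lintegral_const_mul' _ _ ENNReal.ofReal_ne_top]
    refine (lintegral_mono (g := fun y => (e : ℝ≥0∞) + ENNReal.ofReal (2 * (q + 1) / e) *
      ENNReal.ofReal (kl ((P k).posteriorAt y).1 fun _ => (q : ℝ)⁻¹)) fun y => ?_).trans ?_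
    · change edist ((P k).posteriorAt y) U ≤ _
      beta_reduce
      rw [edist_dist, ← ENNReal.ofReal_mul (by positivity), ← ENNReal.ofReal_coe_nnreal,
        ← ENNReal.ofReal_add he.le (mul_nonneg (by positivity)
          (kl_nonneg ((P k).posteriorAt y).2.1 uniform_mem.1))]
      exact ENNReal.ofReal_le_ofReal (dist_uniform_le ((P k).posteriorAt y).2 he)
    · rw [lintegral_add_left measurable_const, lintegral_const, measure_univ, mul_one]
  refine tendsto_iff_forall_lipschitz_integral_tendsto.2 ?_
  rintro f ⟨C, hC⟩ ⟨Λ, hΛ⟩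
  have hfm : Measurable f := hΛ.continuous.measurable
  have hint {Q : Channel.{u} q} : ∫ p, f p ∂(Q.posteriorDist : Measure (stdSimplex ℝ (Fin q))) =
      ∫ y, f (Q.posteriorAt y) ∂(Q.kernel ∘ₘ unif q) :=
    integral_map Q.measurable_posteriorAt.aemeasurable hfm.aestronglyMeasurable
  have hlimL : ∫ p, f p ∂(L.posteriorDist : Measure (stdSimplex ℝ (Fin q))) = f U := by
    refine (integral_map L.measurable_posteriorAt.aemeasurable hfm.aestronglyMeasurable).trans ?_
    have h1 : (fun y => f (L.posteriorAt y)) =ᵐ[L.kernel ∘ₘ unif q] fun _ => f U := by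
      filter_upwards [(isPosterior_posteriorAt L).ae_eq hL] with y hy
      exact congrArg f (Subtype.ext hy)
    rw [integral_congr_ae h1]
    simp
  rw [hlimL, tendsto_iff_edist_tendsto_0]
  have hlim : Tendsto (fun k => (Λ : ℝ≥0∞) *
      ∫⁻ y, edist ((P k).posteriorAt y) U ∂((P k).kernel ∘ₘ unif q)) atTop (𝓝 0) := by
    simpa using ENNReal.Tendsto.const_mul hdist (Or.inr (ENNReal.coe_ne_top (r := Λ)))
  refine tendsto_of_tendsto_of_tendsto_of_le_of_le tendsto_const_nhds hlim (fun _ => zero_le)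
    fun k => ?_
  have hfi : Integrable (fun y => f ((P k).posteriorAt y)) ((P k).kernel ∘ₘ unif q) := by
    refine Integrable.of_bound (hfm.comp (P k).measurable_posteriorAt).aestronglyMeasurable
      (C + ‖f U‖) (ae_of_all _ fun y => ?_)
    have h1 := hC ((P k).posteriorAt y) U
    rw [dist_eq_norm] at h1
    linarith [norm_le_norm_sub_add (f ((P k).posteriorAt y)) (f U)]
  have h2 : (∫ y, f ((P k).posteriorAt y) ∂((P k).kernel ∘ₘ unif q)) - f U =
      ∫ y, (f ((P k).posteriorAt y) - f U) ∂((P k).kernel ∘ₘ unif q) := by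
    rw [integral_sub hfi (integrable_const _)]
    simp
  change edist _ _ ≤ _
  rw [hint, edist_eq_enorm_sub, h2, ← lintegral_const_mul' _ _ ENNReal.coe_ne_top]
  refine (enorm_integral_le_lintegral_enorm _).trans (lintegral_mono fun y => ?_)
  rw [← edist_eq_enorm_sub]
  exact hΛ _ _

lemma convergesWeakly_iterate_BP (hq : 2 ≤ q) {lam : Param q} {d : ℝ≥0}
    (hext : d < 1 ∨ (-(1 / ((q : ℝ) - 1)) < (lam : ℝ) ∧ (lam : ℝ) < 1))
    (hlt : ENNReal.ofReal ((d : ℝ) * (lam : ℝ) ^ 2) * CL q lam < 1)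
    {ν : Measure ℕ} [IsProbabilityMeasure ν] (hν : ∫⁻ b, (b : ℝ≥0∞) ∂ν = d)
    (P : Channel.{u} q) {L : Channel.{v} q} (hL : IsPosterior L.kernel fun _ _ => (q : ℝ)⁻¹) :
    ConvergesWeakly (fun k => (BP lam ν)^[k] P) L := by
  obtain ⟨B, hBtop, hB⟩ := exists_isSmall_zero.{u} hq lam d hext
    (ENNReal.ofReal ((d : ℝ) * (lam : ℝ) ^ 2) * CL q lam)
  refine convergesWeakly_of_tendsto_kl hL (ENNReal.tendsto_nhds_zero.2 fun δ hδ => ?_)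
  filter_upwards [eventually_lintegral_kl_le.{u} lam d hBtop hlt hδ] with k hk
  obtain ⟨m, hm, hs⟩ := exists_isPosterior_iterate_BP hq le_rfl hB hν P k
  refine le_trans (le_of_eq (lintegral_congr_ae ?_)) (hk _ m _ hm (calibrated_const _) hs)
  filter_upwards [(isPosterior_posteriorAt _).ae_eq hm] with y hy
  exact congrArg (fun x => ENNReal.ofReal (kl x fun _ => (q : ℝ)⁻¹)) hy

end BeliefPropagation

/-- The channel with a single output. -/
noncomputable def trivialChannel (q : ℕ) : Channel.{0} q where
  Out := Unit
  kernel := Kernel.const (Fin q) (Measure.dirac ())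

lemma trivialChannel_isFMS (q : ℕ) : (trivialChannel q).IsFMS := by
  refine ⟨1, fun _ => measurable_id, fun τ x E _ => ?_⟩
  exact congrArg ((trivialChannel q).kernel x) (Set.image_id E).symm

lemma stableBPFixedPoint_of_lt_one {q : ℕ} [NeZero q] (hq : 2 ≤ q) {lam : Param q} {d : ℝ≥0}
    (hext : d < 1 ∨ (-(1 / ((q : ℝ) - 1)) < (lam : ℝ) ∧ (lam : ℝ) < 1))
    (hlt : ENNReal.ofReal ((d : ℝ) * (lam : ℝ) ^ 2) * CL q lam < 1)
    {ν : Measure ℕ} [IsProbabilityMeasure ν] (hν : ∫⁻ b, (b : ℝ≥0∞) ∂ν = d) :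
    StableBPFixedPoint.{v} lam ν := by
  have hL : IsPosterior (trivialChannel q).kernel fun _ _ => (q : ℝ)⁻¹ :=
    isPosterior_const (Measure.dirac ())
  exact ⟨trivialChannel q, trivialChannel_isFMS q,
    convergesWeakly_iterate_BP hq hext hlt hν _ hL,
    fun P _ _ => convergesWeakly_iterate_BP hq hext hlt hν P hL⟩

/-- For extreme `λ` one has `1 ≤ λ ^ 2 * C^L`, so that the tree is subcritical. -/
lemma lt_one_or_of_mul_CL_lt_one {q : ℕ} [NeZero q] (hq : 2 ≤ q) (lam : Param q) (d : ℝ≥0)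
    (hlt : ENNReal.ofReal ((d : ℝ) * (lam : ℝ) ^ 2) * CL q lam < 1) :
    d < 1 ∨ (-(1 / ((q : ℝ) - 1)) < (lam : ℝ) ∧ (lam : ℝ) < 1) := by
  by_contra! hcon
  obtain ⟨hd, hext⟩ := hcon
  have h1 := one_le_sq_mul_CL_of_extreme hq lam fun h => absurd h.2 (not_lt.2 (hext h.1))
  have htop : CL q lam ≠ ⊤ :=
    ((CL_le_sq hq lam).trans_lt (ENNReal.pow_lt_top (ENNReal.natCast_lt_top q))).ne
  rw [← ENNReal.ofReal_toReal htop, ← ENNReal.ofReal_mul (by positivity), ← ENNReal.ofReal_one,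
    ENNReal.ofReal_lt_ofReal_iff one_pos] at hlt
  have hd' : (1 : ℝ) ≤ d := by exact_mod_cast hd
  nlinarith

end Potts

theorem mainTheorem2 (q : ℕ) [NeZero q] (hq : 2 ≤ q) (lam : Potts.Param q) (d : ℝ≥0)
    (ν : Measure ℕ) [IsProbabilityMeasure ν] (hν : Potts.IsOffspringLaw d ν) :
    Potts.CL q lam ≤ (q : ℝ≥0∞) ^ 2 ∧
    (ENNReal.ofReal ((d : ℝ) * (lam : ℝ) ^ 2) * Potts.CL q lam < 1 →
      Potts.BoundaryIrrelevance.{u} lam ν ∧ Potts.StableBPFixedPoint.{v} lam ν) := by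
  refine ⟨Potts.CL_le_sq hq lam, fun hlt => ?_⟩
  have hext := Potts.lt_one_or_of_mul_CL_lt_one hq lam d hlt
  exact ⟨Potts.boundaryIrrelevance_of_lt_one hq hext hlt hν.lintegral_eq,
    Potts.stableBPFixedPoint_of_lt_one hq hext hlt hν.lintegral_eq⟩
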